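/- Let $f\colon Y\to X$ be a continuous map of topological spaces. Sheaves are sheaves of abelian groups, and $D^+(X)$ denotes the derived category of bounded below complexes of sheaves on $X$. A continuous map is *proper* if it is universally closed; $f$ is *separated* if the diagonal $Y\to Y\times_X Y$ has closed image; $f$ is *locally proper* if for every $y\in Y$ every neighbourhood $V$ of $y$ contains a neighbourhood $A$ of $y$ such that, for some neighbourhood $U$ of $f(y)$, one has $f(A)\subseteq U$ and the induced map $f\colon A\to U$ is proper. For a sheaf $\mathcal F$ on $Y$ let $f_{(!)}\mathcal F$ be the sheaf on $X$ with $$(f_{(!)}\mathcal F)(U)=\{s\in\mathcal F(f^{-1}(U)) : f\colon \operatorname{supp}s\to U \text{ is proper}\},$$ let $f_!\colon D^+(Y)\to D^+(X)$ be the right derived functor of $f_{(!)}$, let $f^*\colon D^+(X)\to D^+(Y)$ be the functor induced by the exact inverse image functor $f^{(*)}$ of sheaves, and let $\otimes^{\mathrm L}$ be the left derived functor, as a functor of two variables $D^+\times D^+\to D^+$, of the (total) tensor product of bounded below complexes of sheaves. **Theorem (Derived projection formula).** Let $f\colon Y\to X$ be separated and locally proper. Then $\otimes^{\mathrm L}$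 exists on $D^+(X)$ and on $D^+(Y)$, and there is a canonical isomorphism $$(f_!\mathcal F)\otimes^{\mathrm L}\mathcal G\;\xrightarrow{\ \sim\ }\;f_!(\mathcal F\otimes^{\mathrm L}f^*\mathcal G),$$ natural in $\mathcal F\in D^+(Y)$ and $\mathcal G\in D^+(X)$. Here "canonical" means that it is induced by the morphism $(f_{(!)}\mathcal F)\otimes\mathcal G\to f_{(!)}(\mathcal F\otimes f^{(*)}\mathcal G)$, $s\otimes t\mapsto s\otimes f^{(*)}t$, of sheaves: for all bounded below complexes $K$ of sheaves on $Y$ and $L$ of sheaves on $X$, the two composites $$(f_{(!)}K)\otimes^{\mathrm L}L\to (f_!K)\otimes^{\mathrm L}L\xrightarrow{\sim} f_!(K\otimes^{\mathrm L}f^*L)\to f_!(K\otimes f^{(*)}L),$$ $$(f_{(!)}K)\otimes^{\mathrm L}L\to (f_{(!)}K)\otimes L\to f_{(!)}(K\otimes f^{(*)}L)\to f_!(K\otimes f^{(*)}L)$$ in $D^+(X)$ coincide, where the unnamed arrows are the canonical ones between underived and derived functors and the total complex version of the morphism above. -/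

import Mathlib

open CategoryTheory TopologicalSpace Topology Opposite Limits

universe w₁ w₂ u

set_option linter.unusedSectionVars false

noncomputable section

namespace ProperImage

/-- A map `f : Y → X` of topological spaces is locally proper if it is continuous and every
neighbourhood `V` of every point `y` contains a neighbourhood `A` of `y` such that `f` induces a
proper map from `A` to some neighbourhood `U` of `f y`. -/
def IsLocallyProper {Y X : Type*} [TopologicalSpace Y] [TopologicalSpace X] (f : Y → X) : Prop :=
  Continuous f ∧ ∀ (y : Y), ∀ V ∈ 𝓝 y, ∃ A ∈ 𝓝 y, A ⊆ V ∧ ∃ U ∈ 𝓝 (f y),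
    ∃ h : Set.MapsTo f A U, IsProperMap (h.restrict f A U)

/-- Sheaves of abelian groups on `X`. -/
abbrev Sh (X : TopCat.{u}) := TopCat.Sheaf AddCommGrpCat.{u} X

instance hasSheafify_opens (X : TopCat.{u}) :
    HasSheafify (Opens.grothendieckTopology X) AddCommGrpCat.{u} := inferInstance

section Proper

variable {Y X : Type*} [TopologicalSpace Y] [TopologicalSpace X] {f : Y → X}

lemma isProperMap_restrict_iff (hf : Continuous f) {S : Set Y} {U : Set X}
    (h : Set.MapsTo f S U) :
    IsProperMap (h.restrict f S U) ↔ ∀ (𝒰 : Ultrafilter Y), S ∈ 𝒰 → ∀ x ∈ U,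
      Filter.Tendsto f 𝒰 (𝓝 x) → ∃ y ∈ S, f y = x ∧ (𝒰 : Filter Y) ≤ 𝓝 y := by
  rw [isProperMap_iff_ultrafilter]
  constructor
  · rintro ⟨-, H⟩ 𝒰 hS x hx hlim
    let 𝒱 : Ultrafilter S := Ultrafilter.ofComapInfPrincipal (m := ((↑) : S → Y)) (g := 𝒰)
      (s := Set.univ) (by simpa using hS)
    have h𝒱 : (𝒱.map ((↑) : S → Y)) = 𝒰 :=
      Ultrafilter.ofComapInfPrincipal_eq_of_map (by simpa using hS)
    have hlim' : Filter.Tendsto (h.restrict f S U) 𝒱 (𝓝 ⟨x, hx⟩) := by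
      rw [tendsto_subtype_rng]
      have : Filter.Tendsto (f ∘ ((↑) : S → Y)) 𝒱 (𝓝 x) := by
        rw [← Filter.tendsto_map'_iff]
        have := congrArg (fun u : Ultrafilter Y => (u : Filter Y)) h𝒱
        simp only [Ultrafilter.coe_map] at this
        rwa [this]
      exact this
    obtain ⟨y, hy, hle⟩ := H hlim'
    refine ⟨y, y.2, congrArg Subtype.val hy, ?_⟩
    rw [← h𝒱, Ultrafilter.coe_map]
    exact (Filter.map_mono hle).trans continuous_subtype_val.continuousAt
  · intro H
    refine ⟨hf.restrict h, ?_⟩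
    intro 𝒱 x hlim
    have hS : S ∈ (𝒱.map ((↑) : S → Y)) := by
      rw [Ultrafilter.mem_map]
      exact Filter.univ_mem' (fun y => y.2)
    obtain ⟨y, hyS, hy, hle⟩ := H (𝒱.map ((↑) : S → Y)) hS x x.2 (by
      rw [Ultrafilter.coe_map, Filter.tendsto_map'_iff]
      exact (tendsto_subtype_rng.1 hlim))
    refine ⟨⟨y, hyS⟩, Subtype.ext hy, ?_⟩
    rw [nhds_subtype]
    exact Filter.map_le_iff_le_comap.1 (by simpa using hle)

lemma isProperMap_restrict_mono (hf : Continuous f) {S S' : Set Y} {U : Set X}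
    (h : Set.MapsTo f S U) (h' : Set.MapsTo f S' U) (hS : S' ⊆ S)
    (hcl : ∀ y, f y ∈ U → y ∈ closure S' → y ∈ S')
    (hp : IsProperMap (h.restrict f S U)) : IsProperMap (h'.restrict f S' U) := by
  rw [isProperMap_restrict_iff hf] at hp ⊢
  intro 𝒰 hS' x hx hlim
  obtain ⟨y, -, rfl, hle⟩ := hp 𝒰 (Filter.mem_of_superset hS' hS) x hx hlim
  exact ⟨y, hcl y hx (mem_closure_iff_ultrafilter.2 ⟨𝒰, hS', hle⟩), rfl, hle⟩

lemma isProperMap_restrict_union (hf : Continuous f) {S S' : Set Y} {U : Set X}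
    (h : Set.MapsTo f S U) (h' : Set.MapsTo f S' U)
    (hp : IsProperMap (h.restrict f S U)) (hp' : IsProperMap (h'.restrict f S' U)) :
    IsProperMap ((h.union h').restrict f (S ∪ S') U) := by
  rw [isProperMap_restrict_iff hf] at hp hp' ⊢
  intro 𝒰 hS x hx hlim
  rcases Ultrafilter.union_mem_iff.1 hS with hS | hS
  · obtain ⟨y, hy, h⟩ := hp 𝒰 hS x hx hlim
    exact ⟨y, Or.inl hy, h⟩
  · obtain ⟨y, hy, h⟩ := hp' 𝒰 hS x hx hlim
    exact ⟨y, Or.inr hy, h⟩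

lemma isProperMap_restrict_inter (hf : Continuous f) {S S' : Set Y} {U V : Set X}
    (h : Set.MapsTo f S U) (h' : Set.MapsTo f S' V) (hVU : V ⊆ U) (hS : S' = S ∩ f ⁻¹' V)
    (hp : IsProperMap (h.restrict f S U)) : IsProperMap (h'.restrict f S' V) := by
  subst hS
  rw [isProperMap_restrict_iff hf] at hp ⊢
  intro 𝒰 hS' x hx hlim
  obtain ⟨y, hy, rfl, hle⟩ :=
    hp 𝒰 (Filter.mem_of_superset hS' Set.inter_subset_left) x (hVU hx) hlim
  exact ⟨y, ⟨hy, hx⟩, rfl, hle⟩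

lemma isProperMap_restrict_of_cover (hf : Continuous f) {ι : Type*} {S : Set Y} {U : Set X}
    (h : Set.MapsTo f S U) (T : ι → Set Y) (V : ι → Set X) (hV : ∀ i, IsOpen (V i))
    (hU : U ⊆ ⋃ i, V i) (h' : ∀ i, Set.MapsTo f (T i) (V i))
    (hT : ∀ i, T i = S ∩ f ⁻¹' (V i))
    (hp : ∀ i, IsProperMap ((h' i).restrict f (T i) (V i))) :
    IsProperMap (h.restrict f S U) := by
  rw [isProperMap_restrict_iff hf]
  intro 𝒰 hS x hx hlim
  obtain ⟨i, hi⟩ := Set.mem_iUnion.1 (hU hx)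
  have := hp i
  rw [isProperMap_restrict_iff hf] at this
  obtain ⟨y, hy, h⟩ := this 𝒰 (by
    rw [hT]
    exact Filter.inter_mem hS (hlim ((hV i).mem_nhds hi))) x hi hlim
  rw [hT] at hy
  exact ⟨y, hy.1, h⟩

end Proper

section Support

variable {Y : TopCat.{u}}

/-- The support of a section `s` of `F` over `W`: the set of points of `W` at which the germ of
`s` does not vanish. -/
def supp (F : Sh Y) {W : Opens Y} (s : F.obj.obj (op W)) : Set Y :=
  {y | ∃ hy : y ∈ W, TopCat.Presheaf.germ F.obj W y hy s ≠ 0}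

variable (F : Sh Y)

lemma supp_subset {W : Opens Y} (s : F.obj.obj (op W)) : supp F s ⊆ W := fun _ h => h.1

lemma notMem_supp_iff {W : Opens Y} (s : F.obj.obj (op W)) {y : Y} (hy : y ∈ W) :
    y ∉ supp F s ↔ ∃ (V : Opens Y) (_ : y ∈ V) (i : V ⟶ W), F.obj.map i.op s = 0 := by
  constructor
  · intro h
    have h0 : TopCat.Presheaf.germ F.obj W y hy s = TopCat.Presheaf.germ F.obj W y hy 0 := by
      rw [map_zero]
      by_contra h1
      exact h ⟨hy, h1⟩
    obtain ⟨V, hV, i, j, e⟩ := TopCat.Presheaf.germ_eq F.obj y hy hy s 0 h0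
    exact ⟨V, hV, i, by rw [e, map_zero]⟩
  · rintro ⟨V, hV, i, e⟩ ⟨_, h⟩
    apply h
    rw [← TopCat.Presheaf.germ_res_apply F.obj i y hV, e, map_zero]

lemma mem_supp_of_mem_closure {W : Opens Y} (s : F.obj.obj (op W)) {y : Y} (hy : y ∈ W)
    (h : y ∈ closure (supp F s)) : y ∈ supp F s := by
  by_contra hn
  obtain ⟨V, hV, i, e⟩ := (notMem_supp_iff F s hy).1 hn
  obtain ⟨z, hzV, hz⟩ := mem_closure_iff.1 h V V.isOpen hV
  exact (notMem_supp_iff F s (i.le hzV)).2 ⟨V, hzV, i, e⟩ hz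

lemma supp_zero (W : Opens Y) : supp F (0 : F.obj.obj (op W)) = ∅ := by
  ext y; simp [supp]

lemma supp_add {W : Opens Y} (s t : F.obj.obj (op W)) :
    supp F (s + t) ⊆ supp F s ∪ supp F t := by
  rintro y ⟨hy, h⟩
  by_contra hn
  simp only [Set.mem_union, supp, Set.mem_ofPred_eq, not_or, not_exists, not_not] at hn
  exact h (by rw [map_add, hn.1 hy, hn.2 hy, add_zero])

lemma supp_neg {W : Opens Y} (s : F.obj.obj (op W)) : supp F (-s) = supp F s := by
  ext y; simp [supp]

lemma supp_map {V W : Opens Y} (i : V ⟶ W) (s : F.obj.obj (op W)) :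
    supp F (F.obj.map i.op s) = supp F s ∩ V := by
  ext y
  constructor
  · rintro ⟨hy, h⟩
    rw [TopCat.Presheaf.germ_res_apply F.obj] at h
    exact ⟨⟨i.le hy, h⟩, hy⟩
  · rintro ⟨⟨hy, h⟩, hV⟩
    exact ⟨hV, by rwa [TopCat.Presheaf.germ_res_apply F.obj]⟩

lemma supp_hom {F G : Sh Y} (φ : F ⟶ G) {W : Opens Y} (s : F.obj.obj (op W)) :
    supp G (φ.hom.app (op W) s) ⊆ supp F s := by
  rintro y ⟨hy, h⟩
  refine ⟨hy, fun h0 => h ?_⟩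
  have := TopCat.Presheaf.stalkFunctor_map_germ_apply W y hy φ.hom s
  rw [h0] at this
  exact this.symm.trans (map_zero ((TopCat.Presheaf.stalkFunctor AddCommGrpCat y).map φ.hom).hom)

end Support

section ProperDirectImage

variable {Y X : TopCat.{u}} (f : Y ⟶ X)

lemma mapsTo_supp (F : Sh Y) {U : Opens X} (s : F.obj.obj (op ((Opens.map f).obj U))) :
    Set.MapsTo f (supp F s) U := fun _ h => h.1

/-- The sections `s` of `F` over `f ⁻¹ U` such that `f : supp s → U` is proper. -/
def properSections (F : Sh Y) (U : Opens X) :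
    AddSubgroup (F.obj.obj (op ((Opens.map f).obj U))) where
  carrier := {s | IsProperMap ((mapsTo_supp f F s).restrict f (supp F s) U)}
  zero_mem' := by
    rw [Set.mem_ofPred_eq, isProperMap_restrict_iff f.hom.continuous]
    intro 𝒰 h
    rw [supp_zero] at h
    exact absurd h 𝒰.empty_notMem
  add_mem' {s t} hs ht :=
    isProperMap_restrict_mono f.hom.continuous _ _ (supp_add F s t)
      (fun _ hy h => mem_supp_of_mem_closure F _ hy h)
      (isProperMap_restrict_union f.hom.continuous _ _ hs ht)
  neg_mem' {s} hs :=
    isProperMap_restrict_mono f.hom.continuous _ _ (supp_neg F s).subset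
      (fun _ hy h => mem_supp_of_mem_closure F _ hy h) hs

lemma mem_properSections_map {F : Sh Y} {U V : Opens X} (i : V ⟶ U)
    {s : F.obj.obj (op ((Opens.map f).obj U))} (hs : s ∈ properSections f F U) :
    F.obj.map ((Opens.map f).map i).op s ∈ properSections f F V :=
  isProperMap_restrict_inter f.hom.continuous _ _ i.le (supp_map F _ s) hs

lemma mem_properSections_hom {F G : Sh Y} (φ : F ⟶ G) {U : Opens X}
    {s : F.obj.obj (op ((Opens.map f).obj U))} (hs : s ∈ properSections f F U) :
    φ.hom.app _ s ∈ properSections f G U :=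
  isProperMap_restrict_mono f.hom.continuous _ _ (supp_hom φ s)
    (fun _ hy h => mem_supp_of_mem_closure G _ hy h) hs

/-- The proper direct image of a sheaf, as a presheaf. -/
def properImagePresheaf (F : Sh Y) : TopCat.Presheaf AddCommGrpCat.{u} X where
  obj U := AddCommGrpCat.of (properSections f F U.unop)
  map {U V} i := AddCommGrpCat.ofHom
    (((F.obj.map ((Opens.map f).map i.unop).op).hom.comp
      (properSections f F U.unop).subtype).codRestrict (properSections f F V.unop)
        (fun s => mem_properSections_map f i.unop s.2))
  map_id U := by
    ext s
    exact ConcreteCategory.congr_hom (F.obj.map_id _) s.1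
  map_comp i j := by
    ext s
    exact ConcreteCategory.congr_hom (F.obj.map_comp
      ((Opens.map f).map i.unop).op ((Opens.map f).map j.unop).op) s.1

lemma isSheaf_properImagePresheaf (F : Sh Y) : (properImagePresheaf f F).IsSheaf := by
  rw [TopCat.Presheaf.isSheaf_iff_isSheafUniqueGluing]
  intro ι U sf hsf
  have hle : (Opens.map f).obj (iSup U) ≤ ⨆ i, (Opens.map f).obj (U i) := by
    intro y hy
    obtain ⟨i, hi⟩ := Opens.mem_iSup.1 hy
    exact Opens.mem_iSup.2 ⟨i, hi⟩
  obtain ⟨s, hs, huniq⟩ := F.existsUnique_gluing' (fun i => (Opens.map f).obj (U i))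
    ((Opens.map f).obj (iSup U)) (fun i => (Opens.map f).map (Opens.leSupr U i)) hle
    (fun i => (sf i).1) (fun i j => congrArg Subtype.val (hsf i j))
  have hmem : s ∈ properSections f F (iSup U) := by
    refine isProperMap_restrict_of_cover f.hom.continuous _ (fun i => supp F (sf i).1)
      (fun i => (U i : Set X)) (fun i => (U i).isOpen) (by simp)
      (fun i => mapsTo_supp f F (sf i).1) (fun i => ?_) (fun i => (sf i).2)
    rw [← hs i, supp_map]
    rfl
  refine ⟨⟨s, hmem⟩, fun i => Subtype.ext (hs i), fun t ht => Subtype.ext ?_⟩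
  exact huniq t.1 (fun i => congrArg Subtype.val (ht i))

/-- The proper direct image functor `Sh(Y) ⥤ Sh(X)`. -/
def properImage : Sh Y ⥤ Sh X where
  obj F := ⟨properImagePresheaf f F, isSheaf_properImagePresheaf f F⟩
  map {F G} φ := ⟨
    { app U := AddCommGrpCat.ofHom
        (((φ.hom.app (op ((Opens.map f).obj U.unop))).hom.comp
          (properSections f F U.unop).subtype).codRestrict (properSections f G U.unop)
            (fun s => mem_properSections_hom f φ s.2))
      naturality U V i := by
        ext s
        exact Subtype.ext (ConcreteCategory.congr_hom
          (φ.hom.naturality ((Opens.map f).map i.unop).op) s.1) }⟩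
  map_id F := rfl
  map_comp φ ψ := rfl

instance : (properImage f).Additive where
  map_add := rfl

end ProperDirectImage

section Tensor

open scoped TensorProduct

lemma tensor_hom_ext {A B C : AddCommGrpCat.{u}} {φ ψ : AddCommGrpCat.of (A ⊗[ℤ] B) ⟶ C}
    (h : ∀ (a : A) (b : B), φ.hom (a ⊗ₜ[ℤ] b) = ψ.hom (a ⊗ₜ[ℤ] b)) : φ = ψ := by
  ext x
  induction x using TensorProduct.induction_on with
  | zero => exact (map_zero φ.hom).trans (map_zero ψ.hom).symm
  | tmul a b => exact h a b
  | add x y hx hy =>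
    exact (map_add φ.hom x y).trans ((congrArg₂ (· + ·) hx hy).trans (map_add ψ.hom x y).symm)

/-- The tensor product of abelian groups as a bifunctor. -/
def tensorAb : AddCommGrpCat.{u} ⥤ AddCommGrpCat.{u} ⥤ AddCommGrpCat.{u} where
  obj A :=
    { obj B := AddCommGrpCat.of (A ⊗[ℤ] B)
      map g := AddCommGrpCat.ofHom
        (TensorProduct.map LinearMap.id g.hom.toIntLinearMap).toAddMonoidHom
      map_id _ := tensor_hom_ext fun _ _ => rfl
      map_comp _ _ := tensor_hom_ext fun _ _ => rfl }
  map a :=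
    { app _ := AddCommGrpCat.ofHom
        (TensorProduct.map a.hom.toIntLinearMap LinearMap.id).toAddMonoidHom
      naturality _ _ _ := tensor_hom_ext fun _ _ => rfl }
  map_id _ := NatTrans.ext (funext fun _ => tensor_hom_ext fun _ _ => rfl)
  map_comp _ _ := NatTrans.ext (funext fun _ => tensor_hom_ext fun _ _ => rfl)

lemma tensorAb_hom_ext {A B C : AddCommGrpCat.{u}} {φ ψ : (tensorAb.obj A).obj B ⟶ C}
    (h : ∀ (a : A) (b : B), φ.hom (a ⊗ₜ[ℤ] b) = ψ.hom (a ⊗ₜ[ℤ] b)) : φ = ψ :=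
  tensor_hom_ext h

lemma tensorAb_map_app_tmul {A A' : AddCommGrpCat.{u}} (g : A ⟶ A') (B : AddCommGrpCat.{u})
    (a : A) (b : B) : ((tensorAb.map g).app B).hom (a ⊗ₜ[ℤ] b) = (g.hom a) ⊗ₜ[ℤ] b := rfl

lemma tensorAb_obj_map_tmul (A : AddCommGrpCat.{u}) {B B' : AddCommGrpCat.{u}} (g : B ⟶ B')
    (a : A) (b : B) : ((tensorAb.obj A).map g).hom (a ⊗ₜ[ℤ] b) = a ⊗ₜ[ℤ] (g.hom b) := rfl

instance : tensorAb.{u}.Additive where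
  map_add {A A' a a'} := by
    ext B : 2
    exact tensorAb_hom_ext fun x y => TensorProduct.add_tmul (a.hom x) (a'.hom x) y

instance (A : AddCommGrpCat.{u}) : (tensorAb.obj A).Additive where
  map_add {_ _ b b'} :=
    tensorAb_hom_ext fun x y => TensorProduct.tmul_add x (b.hom y) (b'.hom y)

variable (X : TopCat.{u})

/-- The presheaf tensor product `U ↦ F(U) ⊗ G(U)`. -/
def tensorPresheaf : TopCat.Presheaf AddCommGrpCat.{u} X ⥤ TopCat.Presheaf AddCommGrpCat.{u} X ⥤
    TopCat.Presheaf AddCommGrpCat.{u} X where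
  obj F :=
    { obj G :=
        { obj U := (tensorAb.obj (F.obj U)).obj (G.obj U)
          map {U V} i := (tensorAb.map (F.map i)).app (G.obj U) ≫
            (tensorAb.obj (F.obj V)).map (G.map i)
          map_id U := by simp
          map_comp i j := by simp }
      map {G G'} ψ :=
        { app U := (tensorAb.obj (F.obj U)).map (ψ.app U)
          naturality U V i := by simp [← Functor.map_comp] }
      map_id G := NatTrans.ext (funext fun U => (tensorAb.obj (F.obj U)).map_id (G.obj U))
      map_comp φ ψ := NatTrans.ext (funext fun U =>
        (tensorAb.obj (F.obj U)).map_comp (φ.app U) (ψ.app U)) }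
  map {F F'} φ :=
    { app G :=
        { app U := (tensorAb.map (φ.app U)).app (G.obj U)
          naturality U V i := by
            simp only [Category.assoc, NatTrans.naturality]
            simp only [← Category.assoc, ← NatTrans.comp_app, ← Functor.map_comp,
              NatTrans.naturality] }
      naturality G G' ψ := NatTrans.ext (funext fun U =>
        (tensorAb.map (φ.app U)).naturality (ψ.app U)) }
  map_id F := NatTrans.ext (funext fun G => NatTrans.ext (funext fun U =>
    congrArg (fun α => α.app (G.obj U)) (tensorAb.map_id (F.obj U))))
  map_comp φ ψ := NatTrans.ext (funext fun G => NatTrans.ext (funext fun U =>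
    congrArg (fun α => α.app (G.obj U)) (tensorAb.map_comp (φ.app U) (ψ.app U))))

instance : (tensorPresheaf X).Additive where
  map_add {_ _ φ ψ} := NatTrans.ext (funext fun G => NatTrans.ext (funext fun U =>
    congrArg (fun α => α.app (G.obj U)) (tensorAb.map_add (f := φ.app U) (g := ψ.app U))))

instance (F : TopCat.Presheaf AddCommGrpCat.{u} X) : ((tensorPresheaf X).obj F).Additive where
  map_add {_ _ φ ψ} := NatTrans.ext (funext fun U =>
    (tensorAb.obj (F.obj U)).map_add (f := φ.app U) (g := ψ.app U))

/-- The tensor product of sheaves: the sheafification of the presheaf tensor product. -/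
def tensorSheaf : Sh X ⥤ Sh X ⥤ Sh X :=
  TopCat.Sheaf.forget _ X ⋙ tensorPresheaf X ⋙
    (Functor.whiskeringLeft _ _ _).obj (TopCat.Sheaf.forget _ X) ⋙
    (Functor.whiskeringRight _ _ _).obj
      (presheafToSheaf (Opens.grothendieckTopology X) AddCommGrpCat.{u})

instance : (tensorSheaf X).Additive where
  map_add {F F' φ ψ} := by
    ext1; ext1 G
    exact (congrArg (fun α => (presheafToSheaf (Opens.grothendieckTopology X)
      AddCommGrpCat.{u}).map (α.app G.obj)) ((tensorPresheaf X).map_add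
        (f := φ.hom) (g := ψ.hom))).trans (Functor.map_add _)

instance (F : Sh X) : ((tensorSheaf X).obj F).Additive where
  map_add {_ _ φ ψ} :=
    (congrArg (fun α => (presheafToSheaf (Opens.grothendieckTopology X)
      AddCommGrpCat.{u}).map α) (((tensorPresheaf X).obj F.obj).map_add
        (f := φ.hom) (g := ψ.hom))).trans (Functor.map_add _)

end Tensor

section Projection

open scoped TensorProduct

variable {Y X : TopCat.{u}} (f : Y ⟶ X)

/-- The inverse image functor `Sh(X) ⥤ Sh(Y)`. -/
abbrev inverseImage : Sh X ⥤ Sh Y := TopCat.Sheaf.pullback AddCommGrpCat.{u} f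

/-- The pullback `G(U) ⟶ (f^* G)(f ⁻¹ U)` of sections. -/
def pullbackSection (G : Sh X) (U : Opens X) :
    G.obj.obj (op U) ⟶ ((inverseImage f).obj G).obj.obj (op ((Opens.map f).obj U)) :=
  ((TopCat.Sheaf.pullbackPushforwardAdjunction AddCommGrpCat.{u} f).unit.app G).hom.app (op U)

/-- The map `F(W) ⊗ G(W) ⟶ (F ⊗ G)(W)`. -/
def tensorSection (F G : Sh Y) (W : Opens Y) :
    (tensorAb.obj (F.obj.obj (op W))).obj (G.obj.obj (op W)) ⟶
      (((tensorSheaf Y).obj F).obj G).obj.obj (op W) :=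
  ((sheafificationAdjunction (Opens.grothendieckTopology Y) AddCommGrpCat.{u}).unit.app
    (((tensorPresheaf Y).obj F.obj).obj G.obj)).app (op W)

lemma tensorSection_map (F G : Sh Y) {V W : Opens Y} (i : V ⟶ W) (s : F.obj.obj (op W))
    (t : G.obj.obj (op W)) :
    (((tensorSheaf Y).obj F).obj G).obj.map i.op ((tensorSection F G W).hom (s ⊗ₜ[ℤ] t)) =
      (tensorSection F G V).hom ((F.obj.map i.op s) ⊗ₜ[ℤ] (G.obj.map i.op t)) :=
  (ConcreteCategory.congr_hom (((sheafificationAdjunction (Opens.grothendieckTopology Y)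
    AddCommGrpCat.{u}).unit.app
      (((tensorPresheaf Y).obj F.obj).obj G.obj)).naturality i.op) (s ⊗ₜ[ℤ] t)).symm

lemma supp_tensorSection (F G : Sh Y) {W : Opens Y} (s : F.obj.obj (op W))
    (t : G.obj.obj (op W)) :
    supp (((tensorSheaf Y).obj F).obj G) ((tensorSection F G W).hom (s ⊗ₜ[ℤ] t)) ⊆
      supp F s := by
  rintro y hy
  by_contra hn
  have hW := supp_subset _ _ hy
  obtain ⟨V, hV, i, e⟩ := (notMem_supp_iff F s hW).1 hn
  refine (notMem_supp_iff _ _ hW).2 ⟨V, hV, i, ?_⟩ hy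
  rw [tensorSection_map, e, TensorProduct.zero_tmul]
  exact map_zero (tensorSection F G V).hom

/-- The map `F(f ⁻¹ U) ⊗ G(U) ⟶ (F ⊗ f^* G)(f ⁻¹ U)`, `s ⊗ t ↦ s ⊗ f^* t`, restricted to the
sections `s` whose support is proper over `U`. -/
def projectionSection (F : Sh Y) (G : Sh X) (U : Opens X) :
    (tensorAb.obj (((properImage f).obj F).obj.obj (op U))).obj (G.obj.obj (op U)) ⟶
      (((tensorSheaf Y).obj F).obj ((inverseImage f).obj G)).obj.obj
        (op ((Opens.map f).obj U)) :=
  (tensorAb.map (AddCommGrpCat.ofHom (properSections f F U).subtype)).app (G.obj.obj (op U)) ≫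
    (tensorAb.obj (F.obj.obj (op ((Opens.map f).obj U)))).map (pullbackSection f G U) ≫
    tensorSection F ((inverseImage f).obj G) ((Opens.map f).obj U)

lemma projectionSection_mem (F : Sh Y) (G : Sh X) (U : Opens X)
    (x : (tensorAb.obj (((properImage f).obj F).obj.obj (op U))).obj (G.obj.obj (op U))) :
    (projectionSection f F G U).hom x ∈
      properSections f (((tensorSheaf Y).obj F).obj ((inverseImage f).obj G)) U := by
  change _ ⊗[ℤ] _ at x
  induction x using TensorProduct.induction_on with
  | zero => exact ((properSections f _ U).comap (projectionSection f F G U).hom).zero_mem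
  | tmul s t =>
    exact isProperMap_restrict_mono f.hom.continuous _ _
      (supp_tensorSection F ((inverseImage f).obj G) s.1 ((pullbackSection f G U).hom t))
      (fun _ hy h => mem_supp_of_mem_closure _ _ hy h) s.2
  | add x y hx hy =>
    exact ((properSections f _ U).comap (projectionSection f F G U).hom).add_mem hx hy

/-- The morphism `(f_! F)(U) ⊗ G(U) ⟶ (f_! (F ⊗ f^* G))(U)`, `s ⊗ t ↦ s ⊗ f^* t`,
as a morphism of presheaves. -/
def projectionPresheaf (F : Sh Y) (G : Sh X) :
    ((tensorPresheaf X).obj ((properImage f).obj F).obj).obj G.obj ⟶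
      ((properImage f).obj (((tensorSheaf Y).obj F).obj ((inverseImage f).obj G))).obj where
  app U := AddCommGrpCat.ofHom ((projectionSection f F G U.unop).hom.codRestrict _
    (projectionSection_mem f F G U.unop))
  naturality U V i := by
    apply tensorAb_hom_ext
    intro s t
    apply Subtype.ext
    have h := ConcreteCategory.congr_hom (((TopCat.Sheaf.pullbackPushforwardAdjunction
      AddCommGrpCat.{u} f).unit.app G).hom.naturality i) t
    have h' := tensorSection_map F ((inverseImage f).obj G) ((Opens.map f).map i.unop) s.1
      ((pullbackSection f G U.unop).hom t)
    refine Eq.trans ?_ h'.symm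
    exact congrArg (fun z => (tensorSection F ((inverseImage f).obj G) _).hom
      ((F.obj.map ((Opens.map f).map i.unop).op s.1) ⊗ₜ[ℤ] z)) h

/-- The canonical morphism `(f_! F) ⊗ G ⟶ f_! (F ⊗ f^* G)` of sheaves. -/
def projection (F : Sh Y) (G : Sh X) :
    ((tensorSheaf X).obj ((properImage f).obj F)).obj G ⟶
      (properImage f).obj (((tensorSheaf Y).obj F).obj ((inverseImage f).obj G)) :=
  ((sheafificationAdjunction (Opens.grothendieckTopology X) AddCommGrpCat.{u}).homEquiv _ _).symm
    (projectionPresheaf f F G)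

lemma projection_naturality_left {F F' : Sh Y} (φ : F ⟶ F') (G : Sh X) :
    ((tensorSheaf X).map ((properImage f).map φ)).app G ≫ projection f F' G =
      projection f F G ≫ (properImage f).map
        (((tensorSheaf Y).map φ).app ((inverseImage f).obj G)) := by
  refine (Adjunction.homEquiv_naturality_left_symm _ _ _).symm.trans
    (Eq.trans ?_ (Adjunction.homEquiv_naturality_right_symm _ _ _))
  congr 1
  apply NatTrans.ext
  ext1 U
  apply tensorAb_hom_ext
  intro s t
  apply Subtype.ext
  exact (ConcreteCategory.congr_hom (NatTrans.congr_app
    ((sheafificationAdjunction (Opens.grothendieckTopology Y) AddCommGrpCat.{u}).unit.naturality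
      (((tensorPresheaf Y).map φ.hom).app ((inverseImage f).obj G).obj))
        (op ((Opens.map f).obj U.unop))) (s.1 ⊗ₜ[ℤ] ((pullbackSection f G U.unop).hom t)))

lemma projection_naturality_right (F : Sh Y) {G G' : Sh X} (ψ : G ⟶ G') :
    ((tensorSheaf X).obj ((properImage f).obj F)).map ψ ≫ projection f F G' =
      projection f F G ≫ (properImage f).map
        (((tensorSheaf Y).obj F).map ((inverseImage f).map ψ)) := by
  refine ((sheafificationAdjunction (Opens.grothendieckTopology X)
    AddCommGrpCat.{u}).homEquiv_naturality_left_symm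
      (Y := (properImage f).obj (((tensorSheaf Y).obj F).obj ((inverseImage f).obj G')))
      (((tensorPresheaf X).obj ((properImage f).obj F).obj).map ψ.hom)
      (projectionPresheaf f F G')).symm.trans
    (Eq.trans ?_ (Adjunction.homEquiv_naturality_right_symm _ _ _))
  congr 1
  apply NatTrans.ext
  ext1 U
  apply tensorAb_hom_ext
  intro s t
  apply Subtype.ext
  have h := ConcreteCategory.congr_hom (NatTrans.congr_app (congrArg
    (fun α : G ⟶ (TopCat.Sheaf.pushforward AddCommGrpCat.{u} f).obj ((inverseImage f).obj G') =>
      α.hom) ((TopCat.Sheaf.pullbackPushforwardAdjunction AddCommGrpCat.{u} f).unit.naturality ψ)) U) t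
  refine Eq.trans ?_ (ConcreteCategory.congr_hom (NatTrans.congr_app
    ((sheafificationAdjunction (Opens.grothendieckTopology Y) AddCommGrpCat.{u}).unit.naturality
      (((tensorPresheaf Y).obj F.obj).map ((inverseImage f).map ψ).hom))
        (op ((Opens.map f).obj U.unop))) (s.1 ⊗ₜ[ℤ] ((pullbackSection f G U.unop).hom t)))
  exact congrArg (fun z => (tensorSection F ((inverseImage f).obj G') _).hom (s.1 ⊗ₜ[ℤ] z)) h

end Projection

section TotalComplex

open HomologicalComplex

lemma ι_mapBifunctor_d {C₁ C₂ D : Type*} [Category* C₁] [Category* C₂] [Category* D]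
    [Preadditive C₁] [Preadditive C₂] [Preadditive D] (T : C₁ ⥤ C₂ ⥤ D) [T.Additive]
    [∀ F, (T.obj F).Additive] (K : CochainComplex C₁ ℤ) (L : CochainComplex C₂ ℤ)
    [HomologicalComplex.HasMapBifunctor K L T (.up ℤ)] (p q n n' : ℤ)
    (h : p + q = n) (hp : p + 1 + q = n') (hq : p + (q + 1) = n') :
    ιMapBifunctor K L T (.up ℤ) p q n h ≫ (mapBifunctor K L T (.up ℤ)).d n n' =
      ComplexShape.ε₁ (.up ℤ) (.up ℤ) (.up ℤ) (p, q) •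
        ((T.map (K.d p (p + 1))).app (L.X q) ≫ ιMapBifunctor K L T (.up ℤ) (p + 1) q n' hp) +
      ComplexShape.ε₂ (.up ℤ) (.up ℤ) (.up ℤ) (p, q) •
        ((T.obj (K.X p)).map (L.d q (q + 1)) ≫ ιMapBifunctor K L T (.up ℤ) p (q + 1) n' hq) := by
  have e₁ : (ComplexShape.up ℤ).Rel p (p + 1) := rfl
  have e₂ : (ComplexShape.up ℤ).Rel q (q + 1) := rfl
  rw [mapBifunctor.d_eq, Preadditive.comp_add, mapBifunctor.ι_D₁, mapBifunctor.ι_D₂,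
    mapBifunctor.d₁_eq _ _ _ _ e₁ _ _ hp, mapBifunctor.d₂_eq _ _ _ _ _ e₂ _ hq]

variable {A B : Type*} [Category* A] [Category* B] [Preadditive A] [Preadditive B]
  (P : A ⥤ B) [P.Additive] (T : A ⥤ A ⥤ A) (T' : B ⥤ B ⥤ B)
  [T.Additive] [∀ F, (T.obj F).Additive] [T'.Additive] [∀ F, (T'.obj F).Additive]
  (N L : CochainComplex B ℤ) (K M : CochainComplex A ℤ)
  [HomologicalComplex.HasMapBifunctor N L T' (.up ℤ)]
  [HomologicalComplex.HasMapBifunctor K M T (.up ℤ)]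
  (π : ∀ p q, (T'.obj (N.X p)).obj (L.X q) ⟶ P.obj ((T.obj (K.X p)).obj (M.X q)))

lemma totalDesc_comm
    (h₁ : ∀ p p' q, (T'.map (N.d p p')).app (L.X q) ≫ π p' q =
      π p q ≫ P.map ((T.map (K.d p p')).app (M.X q)))
    (h₂ : ∀ p q q', (T'.obj (N.X p)).map (L.d q q') ≫ π p q' =
      π p q ≫ P.map ((T.obj (K.X p)).map (M.d q q')))
    (p q n n' : ℤ)
    (h : p + q = n) (hp : p + 1 + q = n') (hq : p + (q + 1) = n') :
    (π p q ≫ P.map (ιMapBifunctor K M T (.up ℤ) p q n h)) ≫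
      P.map ((mapBifunctor K M T (.up ℤ)).d n n') =
    ComplexShape.ε₁ (.up ℤ) (.up ℤ) (.up ℤ) (p, q) • ((T'.map (N.d p (p + 1))).app (L.X q) ≫
      π (p + 1) q ≫ P.map (ιMapBifunctor K M T (.up ℤ) (p + 1) q n' hp)) +
    ComplexShape.ε₂ (.up ℤ) (.up ℤ) (.up ℤ) (p, q) • ((T'.obj (N.X p)).map (L.d q (q + 1)) ≫
      π p (q + 1) ≫ P.map (ιMapBifunctor K M T (.up ℤ) p (q + 1) n' hq)) := by
  rw [Category.assoc, ← P.map_comp, ι_mapBifunctor_d T K M p q n n' h hp hq, P.map_add,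
    Functor.map_units_smul, Functor.map_units_smul, Preadditive.comp_add, Linear.comp_units_smul,
    Linear.comp_units_smul, P.map_comp, P.map_comp, reassoc_of% (h₁ p (p + 1) q),
    reassoc_of% (h₂ p q (q + 1))]

/-- The morphism `N ⊗ L ⟶ P (K ⊗ M)` of complexes whose components on the summands of the total
complexes are given by morphisms `π p q : N^p ⊗ L^q ⟶ P (K^p ⊗ M^q)`. -/
def totalDesc
    (h₁ : ∀ p p' q, (T'.map (N.d p p')).app (L.X q) ≫ π p' q =
      π p q ≫ P.map ((T.map (K.d p p')).app (M.X q)))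
    (h₂ : ∀ p q q', (T'.obj (N.X p)).map (L.d q q') ≫ π p q' =
      π p q ≫ P.map ((T.obj (K.X p)).map (M.d q q'))) :
    mapBifunctor N L T' (.up ℤ) ⟶
      (P.mapHomologicalComplex _).obj (mapBifunctor K M T (.up ℤ) : CochainComplex A ℤ) where
  f n := mapBifunctorDesc (fun p q h => π p q ≫ P.map (ιMapBifunctor K M T (.up ℤ) p q n h))
  comm' n n' hn := by
    apply mapBifunctor.hom_ext
    intro p q h
    have hn' : n + 1 = n' := hn
    have h' : p + q = n := h
    have hp : p + 1 + q = n' := by lia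
    have hq : p + (q + 1) = n' := by lia
    refine Eq.trans ?_ ((totalDesc_comm P T T' N L K M π h₁ h₂ p q n n' h hp hq).trans ?_)
    · rw [ι_mapBifunctorDesc_assoc]
      rfl
    · rw [reassoc_of% (ι_mapBifunctor_d T' N L p q n n' h hp hq),
        Preadditive.add_comp, Linear.units_smul_comp, Linear.units_smul_comp,
        Category.assoc, Category.assoc, ι_mapBifunctorDesc, ι_mapBifunctorDesc]
      rfl

/-- The morphism `(P K) ⊗ L ⟶ P (K ⊗ I L)` of complexes whose components on the summands of the
total complexes are given by a natural transformation `π F G : (P F) ⊗ G ⟶ P (F ⊗ I G)`. -/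
def totalProjection (I : B ⥤ A) [I.Additive]
    (ρ : ∀ F G, (T'.obj (P.obj F)).obj G ⟶ P.obj ((T.obj F).obj (I.obj G)))
    (h₁ : ∀ {F F' : A} (φ : F ⟶ F') (G : B), (T'.map (P.map φ)).app G ≫ ρ F' G =
      ρ F G ≫ P.map ((T.map φ).app (I.obj G)))
    (h₂ : ∀ (F : A) {G G' : B} (ψ : G ⟶ G'), (T'.obj (P.obj F)).map ψ ≫ ρ F G' =
      ρ F G ≫ P.map ((T.obj F).map (I.map ψ)))
    (K : CochainComplex A ℤ) (L : CochainComplex B ℤ)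
    [HomologicalComplex.HasMapBifunctor ((P.mapHomologicalComplex _).obj K) L T' (.up ℤ)]
    [HomologicalComplex.HasMapBifunctor K ((I.mapHomologicalComplex _).obj L) T (.up ℤ)] :
    mapBifunctor ((P.mapHomologicalComplex _).obj K) L T' (.up ℤ) ⟶
      (P.mapHomologicalComplex _).obj
        (mapBifunctor K ((I.mapHomologicalComplex _).obj L) T (.up ℤ) : CochainComplex A ℤ) :=
  totalDesc P T T' ((P.mapHomologicalComplex _).obj K) L K
    ((I.mapHomologicalComplex _).obj L) (fun p q => ρ (K.X p) (L.X q))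
    (fun p p' q => h₁ (K.d p p') (L.X q)) (fun p q q' => h₂ (K.X p) (L.d q q'))

lemma isStrictlyGE_mapBifunctor (K M : CochainComplex A ℤ)
    [HomologicalComplex.HasMapBifunctor K M T (.up ℤ)] (m n : ℤ)
    [K.IsStrictlyGE m] [M.IsStrictlyGE n] :
    CochainComplex.IsStrictlyGE (mapBifunctor K M T (.up ℤ)) (m + n) := by
  rw [CochainComplex.isStrictlyGE_iff]
  intro i hi
  rw [IsZero.iff_id_eq_zero]
  apply mapBifunctor.hom_ext
  intro p q h
  have h' : p + q = i := h
  refine IsZero.eq_of_src ?_ _ _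
  by_cases hp : p < m
  · have hz := K.isZero_of_isStrictlyGE m p hp
    refine (IsZero.iff_id_eq_zero _).2 ?_
    rw [← NatTrans.id_app, ← T.map_id, hz.eq_of_src (𝟙 _) 0, T.map_zero]
    rfl
  · have hz := M.isZero_of_isStrictlyGE n q (by lia)
    refine (IsZero.iff_id_eq_zero _).2 ?_
    rw [← (T.obj (K.X p)).map_id, hz.eq_of_src (𝟙 _) 0, (T.obj (K.X p)).map_zero]

/-- The total complex of the double complex `T K^p M^q`, for bounded below complexes. -/
def totalPlus
    [∀ K M : CochainComplex A ℤ, HomologicalComplex.HasMapBifunctor K M T (.up ℤ)] :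
    CochainComplex.Plus A × CochainComplex.Plus A ⥤ CochainComplex.Plus A :=
  ObjectProperty.lift _
    ((CochainComplex.Plus.ι A).prod (CochainComplex.Plus.ι A) ⋙
      Functor.uncurry.obj T.map₂CochainComplex) (by
    rintro ⟨⟨K, m, hm⟩, ⟨M, n, hn⟩⟩
    exact ⟨m + n, isStrictlyGE_mapBifunctor T K M m n⟩)

/-- The morphism `(P K) ⊗ L ⟶ P (K ⊗ I L)` of bounded below complexes whose components on the
summands of the total complexes are given by a natural transformation. -/
def totalProjectionPlus (I : B ⥤ A) [I.Additive]
    (ρ : ∀ F G, (T'.obj (P.obj F)).obj G ⟶ P.obj ((T.obj F).obj (I.obj G)))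
    (h₁ : ∀ {F F' : A} (φ : F ⟶ F') (G : B), (T'.map (P.map φ)).app G ≫ ρ F' G =
      ρ F G ≫ P.map ((T.map φ).app (I.obj G)))
    (h₂ : ∀ (F : A) {G G' : B} (ψ : G ⟶ G'), (T'.obj (P.obj F)).map ψ ≫ ρ F G' =
      ρ F G ≫ P.map ((T.obj F).map (I.map ψ)))
    [∀ K M : CochainComplex A ℤ, HomologicalComplex.HasMapBifunctor K M T (.up ℤ)]
    [∀ K M : CochainComplex B ℤ, HomologicalComplex.HasMapBifunctor K M T' (.up ℤ)]
    (K : CochainComplex.Plus A) (L : CochainComplex.Plus B) :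
    (totalPlus T').obj (P.mapCochainComplexPlus.obj K, L) ⟶
      P.mapCochainComplexPlus.obj ((totalPlus T).obj (K, I.mapCochainComplexPlus.obj L)) :=
  ObjectProperty.homMk (totalProjection P T T' I ρ h₁ h₂ K.obj L.obj)

end TotalComplex

section Complexes

open HomologicalComplex

variable (X : TopCat.{u})

instance hasMapBifunctor_tensorSheaf (K L : CochainComplex (Sh X) ℤ) :
    HomologicalComplex.HasMapBifunctor K L (tensorSheaf X) (ComplexShape.up ℤ) := by
  have : HasColimitsOfSize.{0, 0} (Sh X) := hasColimitsOfSizeShrink.{0, 0, u, u} (Sh X)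
  intro n
  infer_instance

/-- The tensor product (total complex) of bounded below complexes of sheaves. -/
abbrev tensorComplex :
    CochainComplex.Plus (Sh X) × CochainComplex.Plus (Sh X) ⥤ CochainComplex.Plus (Sh X) :=
  totalPlus (tensorSheaf X)

variable {X} {Y : TopCat.{u}} (f : Y ⟶ X)

instance : PreservesFiniteLimits (inverseImage f) :=
  have : ReflectsLimits (forget AddCommGrpCat.{u}) := reflectsLimits_of_reflectsIsomorphisms
  Functor.sheafPullbackConstruction.preservesFiniteLimits (Opens.map f) AddCommGrpCat.{u}
    (Opens.grothendieckTopology X) (Opens.grothendieckTopology Y)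

instance : PreservesFiniteColimits (inverseImage f) :=
  have := (TopCat.Sheaf.pullbackPushforwardAdjunction
    AddCommGrpCat.{u} f).leftAdjoint_preservesColimits
  inferInstance

instance : (inverseImage f).Additive :=
  Functor.additive_of_preserves_binary_products _

/-- The canonical morphism `(f_! K) ⊗ L ⟶ f_! (K ⊗ f^* L)` of bounded below complexes, given on
the summands of the total complexes by `projection`. -/
def projectionComplex (K : CochainComplex.Plus (Sh Y)) (L : CochainComplex.Plus (Sh X)) :
    (tensorComplex X).obj ((properImage f).mapCochainComplexPlus.obj K, L) ⟶
      (properImage f).mapCochainComplexPlus.obj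
        ((tensorComplex Y).obj (K, (inverseImage f).mapCochainComplexPlus.obj L)) :=
  totalProjectionPlus (properImage f) (tensorSheaf Y) (tensorSheaf X) (inverseImage f)
    (projection f) (projection_naturality_left f) (projection_naturality_right f) K L

end Complexes

section Derived

variable (X : TopCat.{u}) [HasDerivedCategory.{w₁} (Sh X)]

/-- The bounded below derived category `D⁺(X)`. -/
abbrev DPlus := DerivedCategory.Plus (Sh X)

/-- The quasi-isomorphisms of bounded below complexes. -/
abbrev qis : MorphismProperty (CochainComplex.Plus (Sh X)) := CochainComplex.Plus.quasiIso (Sh X)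

/-- The localization functor `C⁺(X) ⥤ D⁺(X)`. -/
abbrev Q : CochainComplex.Plus (Sh X) ⥤ DPlus X := DerivedCategory.Plus.Q

instance : (Q X).IsLocalization (qis X) :=
  inferInstanceAs ((HomotopyCategory.Plus.quotient (Sh X) ⋙
    DerivedCategory.Plus.Qh).IsLocalization (CochainComplex.Plus.quasiIso (Sh X)))

instance : (qis X).ContainsIdentities where
  id_mem K := inferInstanceAs (QuasiIso (𝟙 K.obj))

/-- The total tensor product `C⁺(X) × C⁺(X) ⥤ C⁺(X) ⥤ D⁺(X)` admits a left derived functor with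
respect to pairs of quasi-isomorphisms. -/
abbrev HasDerivedTensor : Prop :=
  (tensorComplex X ⋙ Q X).HasLeftDerivedFunctor ((qis X).prod (qis X))

/-- The derived tensor product `⊗^L : D⁺(X) × D⁺(X) ⥤ D⁺(X)`: the total left derived functor of
the tensor product of bounded below complexes. -/
def derivedTensor [HasDerivedTensor X] : DPlus X × DPlus X ⥤ DPlus X :=
  (tensorComplex X ⋙ Q X).totalLeftDerived ((Q X).prod (Q X)) ((qis X).prod (qis X))

/-- The canonical morphism `K ⊗^L L ⟶ K ⊗ L`. -/
def derivedTensorCounit [HasDerivedTensor X] :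
    (Q X).prod (Q X) ⋙ derivedTensor X ⟶ tensorComplex X ⋙ Q X :=
  (tensorComplex X ⋙ Q X).totalLeftDerivedCounit ((Q X).prod (Q X)) ((qis X).prod (qis X))

variable {X} {Y : TopCat.{u}} [HasDerivedCategory.{w₂} (Sh Y)] (f : Y ⟶ X)

lemma inverseImage_inverts :
    (qis X).IsInvertedBy ((inverseImage f).mapCochainComplexPlus ⋙ Q Y) := by
  intro K L φ (hφ : QuasiIso φ.hom)
  refine Localization.inverts (Q Y) (qis Y) _ ?_
  exact HomologicalComplex.quasiIso_map_of_preservesHomology φ.hom (inverseImage f)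

/-- The derived inverse image `f^* : D⁺(X) ⥤ D⁺(Y)`, induced by the exact functor `f^*` of
sheaves. -/
def derivedInverseImage : DPlus X ⥤ DPlus Y :=
  Localization.lift ((inverseImage f).mapCochainComplexPlus ⋙ Q Y) (inverseImage_inverts f) (Q X)

/-- The derived inverse image is computed by applying the inverse image to a complex. -/
def derivedInverseImageIso :
    Q X ⋙ derivedInverseImage f ≅ (inverseImage f).mapCochainComplexPlus ⋙ Q Y :=
  Localization.fac ((inverseImage f).mapCochainComplexPlus ⋙ Q Y) (inverseImage_inverts f) (Q X)

/-- The derived proper direct image `f_! : D⁺(Y) ⥤ D⁺(X)`: the total right derived functor of the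
proper direct image of sheaves. -/
def derivedProperImage : DPlus Y ⥤ DPlus X := (properImage f).rightDerivedFunctorPlus

/-- The canonical morphism from the proper direct image of a complex to its derived proper direct
image. -/
def derivedProperImageUnit :
    (properImage f).mapCochainComplexPlus ⋙ Q X ⟶ Q Y ⋙ derivedProperImage f :=
  Functor.whiskerLeft (HomotopyCategory.Plus.quotient (Sh Y))
    (properImage f).rightDerivedFunctorPlusUnit

/-- A morphism `e : (f_! F) ⊗^L G ⟶ f_! (F ⊗^L f^* G)`, natural in `F` and `G`, is canonical if it is
induced by the underived morphism: for bounded below complexes `K` on `Y` and `L` on `X`, it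
makes the following diagram commute, in which `f₍!₎` is the underived proper direct image and the
vertical morphisms are the canonical ones relating underived and derived functors.
```
  (f₍!₎ K) ⊗^L L   ---->  (f_! K) ⊗^L L  --e-->  f_! (K ⊗^L f^* L)
        |                                               |
        v                                               v
   (f₍!₎ K) ⊗ L    ---->  f₍!₎ (K ⊗ f^* L)  ---->  f_! (K ⊗ f^* L)
```
-/
def IsCanonicalProjection [HasDerivedTensor X] [HasDerivedTensor Y]
    (e : (derivedProperImage f).prod (𝟭 (DPlus X)) ⋙ derivedTensor X ⟶
      (𝟭 (DPlus Y)).prod (derivedInverseImage f) ⋙ derivedTensor Y ⋙ derivedProperImage f) :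
    Prop :=
  ∀ (K : CochainComplex.Plus (Sh Y)) (L : CochainComplex.Plus (Sh X)),
    (derivedTensor X).map (Prod.mkHom ((derivedProperImageUnit f).app K) (𝟙 ((Q X).obj L))) ≫
      e.app ((Q Y).obj K, (Q X).obj L) ≫
      (derivedProperImage f).map
        ((derivedTensor Y).map
          (Prod.mkHom (𝟙 ((Q Y).obj K)) ((derivedInverseImageIso f).hom.app L)) ≫
        (derivedTensorCounit Y).app (K, (inverseImage f).mapCochainComplexPlus.obj L)) =
    (derivedTensorCounit X).app ((properImage f).mapCochainComplexPlus.obj K, L) ≫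
      (Q X).map (projectionComplex f K L) ≫
      (derivedProperImageUnit f).app
        ((tensorComplex Y).obj (K, (inverseImage f).mapCochainComplexPlus.obj L))

end Derived

end ProperImage

end

/-! Everything rests on one statement about sheaves: the morphism from (f_(!) F) ⊗ G to f_(!)(F ⊗
f^(*) G) is an isomorphism when F is soft along the fibres of f and G has flat stalks
(`isIso_projection`). The rest computes the derived functors with such sheaves.

Fibres. Local properness gives compact subsets of a fibre arbitrarily small neighbourhoods that are
proper over an open set of X, and separatedness makes these relatively closed. Hence a compactly
supported section over the fibre of x extends to a section with proper support
(`IsCompactSec.exists_properSections`), and a section with proper support that vanishes on the fibre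
vanishes over a neighbourhood of x (`exists_germs_eq_zero_of_fiber`). So the stalk of f_(!) F at x
consists of the compactly supported sections over the fibre. Sections over subsets that are not open
are handled as families of germs (`IsSec`).

Softness. F is `Soft` if sections over compact subsets of fibres extend to compactly supported
sections over the fibre. Injective sheaves are soft, a quotient of soft by soft is soft, and f_(!)
is exact on short exact sequences with soft first term. Hence bounded below complexes of soft
sheaves compute f_! (`isIso_derivedProperImageUnit`).

Soft tensor flat. The stalk of F ⊗ f^(*) G at y over x is F_y ⊗ G_x, so an element of Γ_c ⊗ G_x can
be evaluated at the points of the fibre. By flatness, a tensor vanishing at all points of a compact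
set comes from sections which themselves vanish there (`exists_rTensor_vanishing_eq`). This gives
injectivity on stalks. Together with softness it lets local expressions as tensors be glued, which
gives surjectivity and also the softness of F ⊗ f^(*) G (`Soft.tensor`).

Flat resolutions. Over ℤ flat means torsion-free, so the kernel of a flat cover is flat and every
sheaf has a functorial flat resolution of length one. Resolving a bounded below complex therefore
keeps it bounded below, and ⊗^L exists on D⁺ × D⁺ (`hasDerivedTensor`).

Conclusion. For K with injective terms and a flat resolution R L of L, all functors are computed by
underived ones and the projection morphism of complexes is an isomorphism. Such K already present
D⁺(Y) as a localization, which defines the isomorphism; naturality then gives canonicity for all K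
and L (`exists_projection_iso`). -/

noncomputable section

namespace ProperImage

/-! ### Sections over arbitrary subsets as families of germs -/

section Germs

variable {Y : TopCat.{u}} (F : Sh Y)

/-- The stalk of a sheaf at a point. -/
abbrev Stalk (F : Sh Y) (y : Y) : AddCommGrpCat.{u} := TopCat.Presheaf.stalk F.obj y

/-- The homomorphism induced on stalks by a morphism of sheaves. -/
def stalkMap {F G : Sh Y} (φ : F ⟶ G) (y : Y) : Stalk F y →+ Stalk G y :=
  ((TopCat.Presheaf.stalkFunctor AddCommGrpCat.{u} y).map φ.hom).hom

open scoped Classical in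
/-- The family of germs of a section over `V`, extended by zero to all points of `Y`. -/
def germs {V : Opens Y} (t : F.obj.obj (op V)) (y : Y) : Stalk F y :=
  if h : y ∈ V then TopCat.Presheaf.germ F.obj V y h t else 0

lemma germs_of_mem {V : Opens Y} (t : F.obj.obj (op V)) {y : Y} (h : y ∈ V) :
    germs F t y = TopCat.Presheaf.germ F.obj V y h t := dif_pos h

lemma germs_of_notMem {V : Opens Y} (t : F.obj.obj (op V)) {y : Y} (h : y ∉ V) :
    germs F t y = 0 := dif_neg h

lemma mem_supp_iff_germs {V : Opens Y} (t : F.obj.obj (op V)) (y : Y) :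
    y ∈ supp F t ↔ germs F t y ≠ 0 := by
  by_cases h : y ∈ V
  · rw [germs_of_mem F t h]
    exact ⟨fun h => h.2, fun h' => ⟨h, h'⟩⟩
  · rw [germs_of_notMem F t h]
    exact ⟨fun h' => absurd h'.1 h, fun h => absurd rfl h⟩

lemma germs_add {V : Opens Y} (t t' : F.obj.obj (op V)) (y : Y) :
    germs F (t + t') y = germs F t y + germs F t' y := by
  by_cases h : y ∈ V
  · simp only [germs_of_mem F _ h, map_add]
  · simp only [germs_of_notMem F _ h, add_zero]

lemma germs_neg {V : Opens Y} (t : F.obj.obj (op V)) (y : Y) :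
    germs F (-t) y = - germs F t y := by
  by_cases h : y ∈ V
  · simp only [germs_of_mem F _ h, map_neg]
  · simp only [germs_of_notMem F _ h, neg_zero]

lemma germs_zero {V : Opens Y} (y : Y) : germs F (0 : F.obj.obj (op V)) y = 0 := by
  by_cases h : y ∈ V
  · simp only [germs_of_mem F _ h, map_zero]
  · simp only [germs_of_notMem F _ h]

lemma germs_map {V W : Opens Y} (i : V ⟶ W) (t : F.obj.obj (op W)) {y : Y} (h : y ∈ V) :
    germs F (F.obj.map i.op t) y = germs F t y := by
  rw [germs_of_mem F _ h, germs_of_mem F _ (i.le h), TopCat.Presheaf.germ_res_apply]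

lemma germs_hom {F G : Sh Y} (φ : F ⟶ G) {V : Opens Y} (t : F.obj.obj (op V)) (y : Y) :
    germs G (φ.hom.app (op V) t) y =
      stalkMap φ y (germs F t y) := by
  by_cases h : y ∈ V
  · rw [germs_of_mem F _ h, germs_of_mem G _ h]
    exact (TopCat.Presheaf.stalkFunctor_map_germ_apply V y h φ.hom t).symm
  · rw [germs_of_notMem F _ h, germs_of_notMem G _ h]
    exact (map_zero (stalkMap φ y)).symm

lemma exists_germs_eq_stalk {y : Y} (a : Stalk F y) :
    ∃ (V : Opens Y) (_ : y ∈ V) (t : F.obj.obj (op V)), germs F t y = a := by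
  obtain ⟨V, hV, t, ht⟩ := TopCat.Presheaf.exists_germ_eq F.obj a
  exact ⟨V, hV, t, by rw [germs_of_mem F t hV, ht]⟩

lemma germs_ext {V : Opens Y} (t t' : F.obj.obj (op V))
    (h : ∀ y ∈ V, germs F t y = germs F t' y) : t = t' := by
  refine TopCat.Presheaf.section_ext F V t t' fun y hy => ?_
  have := h y hy
  rwa [germs_of_mem F _ hy, germs_of_mem F _ hy] at this

/-- Equality of germs is equality on a small open set, hence an open condition. -/
lemma germs_eventuallyEq {V V' : Opens Y} (t : F.obj.obj (op V)) (t' : F.obj.obj (op V')) {y : Y}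
    (hV : y ∈ V) (hV' : y ∈ V') (h : germs F t y = germs F t' y) :
    ∀ᶠ z in 𝓝 y, germs F t z = germs F t' z := by
  rw [germs_of_mem F t hV, germs_of_mem F t' hV'] at h
  obtain ⟨W, hW, i, i', e⟩ := TopCat.Presheaf.germ_eq F.obj y hV hV' t t' h
  filter_upwards [W.isOpen.mem_nhds hW] with z hz
  rw [← germs_map F i t hz, ← germs_map F i' t' hz, e]

/-- A family of germs `s` is a section of `F` over the subset `K` if it is locally on `K` the
family of germs of a section of `F` over an open subset. -/
def IsSec (K : Set Y) (s : ∀ y : Y, Stalk F y) : Prop :=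
  ∀ y ∈ K, ∃ (V : Opens Y) (_ : y ∈ V) (t : F.obj.obj (op V)),
    ∀ᶠ z in 𝓝[K] y, germs F t z = s z

variable {F} {K : Set Y} {s s' : ∀ y : Y, Stalk F y}

lemma isSec_germs {V : Opens Y} (t : F.obj.obj (op V)) (h : K ⊆ V) : IsSec F K (germs F t) :=
  fun _ hy => ⟨V, h hy, t, Filter.Eventually.of_forall fun _ => rfl⟩

lemma IsSec.mono {K' : Set Y} (h : IsSec F K s) (hK : K' ⊆ K) : IsSec F K' s := fun y hy =>
  have ⟨V, hV, t, e⟩ := h y (hK hy)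
  ⟨V, hV, t, e.filter_mono (nhdsWithin_mono _ hK)⟩

lemma IsSec.congr (h : IsSec F K s) (e : ∀ y ∈ K, s y = s' y) : IsSec F K s' := fun y hy => by
  obtain ⟨V, hV, t, e'⟩ := h y hy
  refine ⟨V, hV, t, ?_⟩
  filter_upwards [e', self_mem_nhdsWithin] with z hz hz'
  rw [hz, e z hz']

lemma IsSec.zero : IsSec F K (fun _ => 0) := fun _ _ =>
  ⟨⊤, trivial, 0, Filter.Eventually.of_forall fun z => germs_zero F z⟩

lemma IsSec.neg (h : IsSec F K s) : IsSec F K (fun y => - s y) := fun y hy => by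
  obtain ⟨V, hV, t, e⟩ := h y hy
  refine ⟨V, hV, -t, ?_⟩
  filter_upwards [e] with z hz
  rw [germs_neg, hz]

lemma IsSec.add (h : IsSec F K s) (h' : IsSec F K s') : IsSec F K (fun y => s y + s' y) :=
  fun y hy => by
  obtain ⟨V, hV, t, e⟩ := h y hy
  obtain ⟨V', hV', t', e'⟩ := h' y hy
  refine ⟨V ⊓ V', ⟨hV, hV'⟩, F.obj.map (Opens.infLELeft V V').op t +
    F.obj.map (Opens.infLERight V V').op t', ?_⟩
  filter_upwards [e, e', mem_nhdsWithin_of_mem_nhds ((V ⊓ V').isOpen.mem_nhds ⟨hV, hV'⟩)]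
    with z hz hz' hm
  rw [germs_add, germs_map F _ _ hm, germs_map F _ _ hm, hz, hz']

lemma IsSec.sub (h : IsSec F K s) (h' : IsSec F K s') : IsSec F K (fun y => s y - s' y) :=
  (h.add h'.neg).congr fun _ _ => (sub_eq_add_neg _ _).symm

lemma IsSec.hom {F G : Sh Y} {K : Set Y} {s : ∀ y : Y, Stalk F y} (h : IsSec F K s)
    (φ : F ⟶ G) :
    IsSec G K (fun y => stalkMap φ y (s y)) :=
  fun y hy => by
  obtain ⟨V, hV, t, e⟩ := h y hy
  refine ⟨V, hV, φ.hom.app (op V) t, ?_⟩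
  filter_upwards [e] with z hz
  rw [germs_hom, hz]

/-- Near `y` both families are germs of genuine sections, for which agreement is open. Every local
step of the compactness arguments below starts here. -/
lemma IsSec.eventuallyEq (h : IsSec F K s) (h' : IsSec F K s') {y : Y} (hy : y ∈ K)
    (e : s y = s' y) : ∀ᶠ z in 𝓝[K] y, s z = s' z := by
  obtain ⟨V, hV, t, et⟩ := h y hy
  obtain ⟨V', hV', t', et'⟩ := h' y hy
  have e₁ := et.self_of_nhdsWithin hy
  have e₁' := et'.self_of_nhdsWithin hy
  filter_upwards [et, et', mem_nhdsWithin_of_mem_nhds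
    (germs_eventuallyEq F t t' hV hV' (by rw [e₁, e₁', e]))] with z h₁ h₂ h₃
  rw [← h₁, ← h₂, h₃]

/-- Sections over two relatively closed subsets which agree glue. -/
lemma IsSec.union {K' : Set Y} (h : IsSec F K s) (h' : IsSec F K' s)
    (hK : ∀ y ∈ K', y ∈ closure K → y ∈ K) (hK' : ∀ y ∈ K, y ∈ closure K' → y ∈ K') :
    IsSec F (K ∪ K') s := by
  -- At a point outside the closure of one of the sets, that set does not contribute to the
  -- neighbourhood filter, so the local section on the other one suffices.
  have bot : ∀ {A : Set Y} {y : Y}, y ∉ closure A → 𝓝[A] y = ⊥ := fun hy => by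
    rwa [mem_closure_iff_nhdsWithin_neBot, Filter.not_neBot] at hy
  intro y hy
  rw [nhdsWithin_union]
  by_cases h₁ : y ∈ K
  · obtain ⟨V, hV, t, e⟩ := h y h₁
    refine ⟨V, hV, t, Filter.eventually_sup.2 ⟨e, ?_⟩⟩
    by_cases h₂ : y ∈ K'
    · obtain ⟨V', hV', t', e'⟩ := h' y h₂
      have e₁ := e.self_of_nhdsWithin h₁
      have e₁' := e'.self_of_nhdsWithin h₂
      filter_upwards [e', mem_nhdsWithin_of_mem_nhds
        (germs_eventuallyEq F t t' hV hV' (by rw [e₁, e₁']))] with z h₁ h₂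
      rw [h₂, h₁]
    · rw [bot fun hc => h₂ (hK' y h₁ hc)]
      exact Filter.eventually_bot
  · have h₂ : y ∈ K' := hy.resolve_left h₁
    obtain ⟨V, hV, t, e⟩ := h' y h₂
    refine ⟨V, hV, t, Filter.eventually_sup.2 ⟨?_, e⟩⟩
    rw [bot fun hc => h₁ (hK y h₂ hc)]
    exact Filter.eventually_bot

lemma isSec_of_eventually_of_isOpen {O : Set Y} (hO : IsOpen O)
    (h : ∀ y ∈ O, ∃ (V : Opens Y) (_ : y ∈ V) (t : F.obj.obj (op V)),
      ∀ᶠ z in 𝓝 y, germs F t z = s z) : IsSec F O s := fun y hy => by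
  rw [hO.nhdsWithin_eq hy]
  exact h y hy

/-- A section over an open subset in terms of germs comes from a section. -/
lemma IsSec.exists_germs_eq {O : Opens Y} (h : IsSec F O s) :
    ∃ t : F.obj.obj (op O), ∀ y ∈ O, germs F t y = s y := by
  have : ∀ y : O, ∃ (V : Opens Y) (_ : y.1 ∈ V) (_ : V ≤ O) (t : F.obj.obj (op V)),
      ∀ z ∈ V, germs F t z = s z := by
    rintro ⟨y, hy⟩
    obtain ⟨V, hV, t, e⟩ := h y hy
    rw [O.isOpen.nhdsWithin_eq hy] at e
    obtain ⟨W, hWs, hWo, hW⟩ := mem_nhds_iff.1 e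
    let W' : Opens Y := ⟨W, hWo⟩ ⊓ V ⊓ O
    have hW' : W' ≤ V := inf_le_left.trans inf_le_right
    refine ⟨W', ⟨⟨hW, hV⟩, hy⟩, inf_le_right, F.obj.map (homOfLE hW').op t, fun z hz => ?_⟩
    rw [germs_map F _ _ hz]
    exact hWs hz.1.1
  choose V hV hVO t ht using this
  obtain ⟨r, hr, -⟩ := F.existsUnique_gluing' V O (fun y => homOfLE (hVO y))
    (fun y hy => Opens.mem_iSup.2 ⟨⟨y, hy⟩, hV _⟩) t (fun i j => by
      refine germs_ext F _ _ fun z hz => ?_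
      rw [germs_map F _ _ hz, germs_map F _ _ hz, ht i z hz.1, ht j z hz.2])
  refine ⟨r, fun y hy => ?_⟩
  rw [← ht ⟨y, hy⟩ y (hV _), ← hr ⟨y, hy⟩, germs_map F _ _ (hV _)]

lemma IsSec.isOpen_eq {O : Set Y} (hO : IsOpen O) (h : IsSec F O s) (h' : IsSec F O s') :
    IsOpen {y | y ∈ O ∧ s y = s' y} := by
  rw [isOpen_iff_mem_nhds]
  rintro y ⟨hy, e⟩
  have := h.eventuallyEq h' hy e
  rw [hO.nhdsWithin_eq hy] at this
  filter_upwards [this, hO.mem_nhds hy] with z hz hz'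
  exact ⟨hz', hz⟩

end Germs

/-! ### Subsets that are proper over an open subset of the base -/

section ProperOn

variable {Y X : Type*} [TopologicalSpace Y] [TopologicalSpace X] {f : Y → X}

/-- The subset `C` of `Y` is mapped to `U` and `f : C → U` is proper, for a continuous map `f`. -/
def ProperOn (f : Y → X) (C : Set Y) (U : Set X) : Prop :=
  Set.MapsTo f C U ∧ ∀ (𝒰 : Ultrafilter Y), C ∈ 𝒰 → ∀ x ∈ U,
    Filter.Tendsto f 𝒰 (𝓝 x) → ∃ y ∈ C, f y = x ∧ (𝒰 : Filter Y) ≤ 𝓝 y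

variable {C : Set Y} {U : Set X}

lemma ProperOn.inter (h : ProperOn f C U) {U' : Set X} (hU : U' ⊆ U) :
    ProperOn f (C ∩ f ⁻¹' U') U' := by
  refine ⟨fun y hy => hy.2, fun 𝒰 hC x hx ht => ?_⟩
  obtain ⟨y, hy, rfl, hle⟩ := h.2 𝒰 (Filter.mem_of_superset hC Set.inter_subset_left) x (hU hx) ht
  exact ⟨y, ⟨hy, hx⟩, rfl, hle⟩

lemma ProperOn.of_closed (h : ProperOn f C U) {C' : Set Y} (hC : C' ⊆ C)
    (hcl : ∀ y, f y ∈ U → y ∈ closure C' → y ∈ C') : ProperOn f C' U := by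
  refine ⟨h.1.mono_left hC, fun 𝒰 hC' x hx ht => ?_⟩
  obtain ⟨y, hy, rfl, hle⟩ := h.2 𝒰 (Filter.mem_of_superset hC' hC) x hx ht
  exact ⟨y, hcl y hx (mem_closure_iff_ultrafilter.2 ⟨𝒰, hC', hle⟩), rfl, hle⟩

lemma ProperOn.biUnion {ι : Type*} (I : Finset ι) {C : ι → Set Y} (h : ∀ i ∈ I, ProperOn f (C i) U) :
    ProperOn f (⋃ i ∈ I, C i) U := by
  refine ⟨fun y hy => ?_, fun 𝒰 hC x hx ht => ?_⟩
  · obtain ⟨i, hi, hy⟩ := Set.mem_iUnion₂.1 hy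
    exact (h i hi).1 hy
  · obtain ⟨i, hi, hC⟩ := (Ultrafilter.finite_biUnion_mem_iff I.finite_toSet).1 hC
    obtain ⟨y, hy, e⟩ := (h i hi).2 𝒰 hC x hx ht
    exact ⟨y, Set.mem_iUnion₂.2 ⟨i, hi, hy⟩, e⟩

/-- An ultrafilter on `C` converging to `y` also converges, by properness, to a point of `C` over `f
y`; separatedness identifies the two limits. Thus subsets proper over `U` are relatively closed in
the preimage of `U`. -/
lemma ProperOn.mem_of_mem_closure (hf : Continuous f) (hsep : IsSeparatedMap f)
    (h : ProperOn f C U) {y : Y} (hy : f y ∈ U) (hc : y ∈ closure C) : y ∈ C := by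
  obtain ⟨𝒰, hC, hle⟩ := mem_closure_iff_ultrafilter.1 hc
  obtain ⟨y', hy', e, hle'⟩ := h.2 𝒰 hC (f y) hy (hf.continuousAt.mono_left hle)
  by_cases hne : y' = y
  · exact hne ▸ hy'
  · obtain ⟨s₁, s₂, h₁, h₂, m₁, m₂, d⟩ := hsep y' y e hne
    have := Filter.inter_mem (hle' (h₁.mem_nhds m₁)) (hle (h₂.mem_nhds m₂))
    rw [d.inter_eq] at this
    exact absurd this 𝒰.empty_notMem

/-- The complement in `U` of the image of a subset which is proper over `U` is a neighbourhood
of each of its points. -/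
lemma ProperOn.exists_isOpen (h : ProperOn f C U) (hU : IsOpen U) {x : X} (hx : x ∈ U)
    (hxC : ∀ y ∈ C, f y ≠ x) : ∃ U' ⊆ U, IsOpen U' ∧ x ∈ U' ∧ ∀ y ∈ C, f y ∉ U' := by
  have hn : x ∉ closure (f '' C) := by
    intro hc
    obtain ⟨𝒱, hC, hle⟩ := mem_closure_iff_ultrafilter.1 hc
    -- The ultrafilter on the image is lifted to one on `C`; properness then supplies a limit in `C`
    -- lying over `x`, which is excluded.
    have hne : (Filter.comap f 𝒱 ⊓ Filter.principal C).NeBot := by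
      rw [← Filter.map_neBot_iff f, Filter.push_pull', Filter.map_principal]
      rw [inf_eq_left.2 (Filter.le_principal_iff.2 hC)]
      exact 𝒱.neBot
    obtain ⟨y, hy, e, -⟩ := h.2 (Ultrafilter.of (Filter.comap f 𝒱 ⊓ Filter.principal C))
      (Ultrafilter.of_le _ (Filter.mem_inf_of_right (Filter.mem_principal_self C))) x hx
      (Filter.Tendsto.mono_right (Filter.tendsto_iff_comap.2
        ((Ultrafilter.of_le _).trans inf_le_left)) hle)
    exact hxC y hy e
  refine ⟨U ∩ (closure (f '' C))ᶜ, Set.inter_subset_left,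
    hU.inter isClosed_closure.isOpen_compl, ⟨hx, hn⟩, fun y hy hm => ?_⟩
  exact hm.2 (subset_closure ⟨y, hy, rfl⟩)

/-- The image of an ultrafilter on the fibre converges to `x` automatically, so properness provides
its limit. -/
lemma ProperOn.isCompact_inter_fiber (h : ProperOn f C U) {x : X} (hx : x ∈ U) :
    IsCompact (C ∩ f ⁻¹' {x}) := by
  rw [isCompact_iff_ultrafilter_le_nhds']
  intro 𝒰 hC
  have ht : Filter.Tendsto f 𝒰 (𝓝 x) :=
    (Filter.tendsto_pure.2 (Filter.mem_of_superset hC fun _ hy => hy.2)).mono_right (pure_le_nhds x)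
  obtain ⟨y, hy, e, hle⟩ := h.2 𝒰 (Filter.mem_of_superset hC Set.inter_subset_left) x hx ht
  exact ⟨y, ⟨hy, e⟩, hle⟩

end ProperOn

end ProperImage

namespace ProperImage

/-! ### Proper neighbourhoods of compact subsets of fibres -/

section Neighbourhoods

variable {Y X : Type*} [TopologicalSpace Y] [TopologicalSpace X] {f : Y → X}

/-- The base becomes open by replacing it with its interior and cutting the proper neighbourhood
down to the preimage. -/
lemma IsLocallyProper.exists_properOn (hlp : IsLocallyProper f) (y : Y) {O : Set Y}
    (hO : O ∈ 𝓝 y) : ∃ U : Set X, IsOpen U ∧ f y ∈ U ∧ ∃ C : Set Y, ProperOn f C U ∧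
      C ∈ 𝓝 y ∧ C ⊆ O := by
  obtain ⟨A, hA, hAO, U, hU, hm, hp⟩ := hlp.2 y O hO
  have hp' : ProperOn f A U := ⟨hm, (isProperMap_restrict_iff hlp.1 hm).1 hp⟩
  refine ⟨interior U, isOpen_interior, mem_interior_iff_mem_nhds.2 hU, _,
    hp'.inter interior_subset, Filter.inter_mem hA ?_, Set.inter_subset_left.trans hAO⟩
  exact hlp.1.continuousAt (interior_mem_nhds.2 hU)

/-- A compact subset of a fibre has arbitrarily small neighbourhoods which are proper over a
neighbourhood of the base point. -/
lemma IsLocallyProper.exists_properOn_of_isCompact (hlp : IsLocallyProper f) {x : X} {K : Set Y}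
    (hK : IsCompact K) (hKx : K ⊆ f ⁻¹' {x}) {O : Set Y} (hO : IsOpen O) (hKO : K ⊆ O) :
    ∃ U : Set X, IsOpen U ∧ x ∈ U ∧ ∃ C : Set Y, ProperOn f C U ∧ K ⊆ interior C ∧ C ⊆ O := by
  have : ∀ y : K, ∃ U : Set X, IsOpen U ∧ f y ∈ U ∧ ∃ C : Set Y, ProperOn f C U ∧
      C ∈ 𝓝 y.1 ∧ C ⊆ O := fun y => hlp.exists_properOn y.1 (hO.mem_nhds (hKO y.2))
  choose U hU hyU C hC hCy hCO using this
  obtain ⟨I, hI⟩ := hK.elim_finite_subcover (fun y : K => interior (C y))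
    (fun _ => isOpen_interior) fun y hy =>
      Set.mem_iUnion.2 ⟨⟨y, hy⟩, mem_interior_iff_mem_nhds.2 (hCy ⟨y, hy⟩)⟩
  have hUI : IsOpen (⋂ i ∈ I, U i) := isOpen_biInter_finset fun i _ => hU i
  have hxI : x ∈ ⋂ i ∈ I, U i := Set.mem_iInter₂.2 fun i _ => by
    have := hyU i
    rwa [hKx i.2] at this
  refine ⟨⋂ i ∈ I, U i, hUI, hxI, ⋃ i ∈ I, C i ∩ f ⁻¹' (⋂ i ∈ I, U i),
    ProperOn.biUnion I fun i hi => (hC i).inter (Set.biInter_subset_of_mem hi), fun y hy => ?_, ?_⟩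
  · obtain ⟨i, hi, hyi⟩ := Set.mem_iUnion₂.1 (hI hy)
    rw [mem_interior_iff_mem_nhds] at hyi ⊢
    filter_upwards [hyi, hlp.1.continuousAt (hUI.mem_nhds (by rwa [hKx hy]))] with z h₁ h₂
    exact Set.mem_iUnion₂.2 ⟨i, hi, h₁, h₂⟩
  · exact Set.iUnion₂_subset fun i _ => Set.inter_subset_left.trans (hCO i)

/-- The fibres of a separated map are Hausdorff, so their compact subsets are closed in them. -/
lemma mem_of_mem_closure_of_isCompact (hsep : IsSeparatedMap f) {x : X} {K : Set Y}
    (hK : IsCompact K) (hKx : K ⊆ f ⁻¹' {x}) {y : Y} (hy : f y = x) (hc : y ∈ closure K) :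
    y ∈ K := by
  obtain ⟨𝒰, hC, hle⟩ := mem_closure_iff_ultrafilter.1 hc
  obtain ⟨y', hy', hle'⟩ := isCompact_iff_ultrafilter_le_nhds'.1 hK 𝒰 hC
  by_cases hne : y' = y
  · exact hne ▸ hy'
  · obtain ⟨s₁, s₂, h₁, h₂, m₁, m₂, d⟩ := hsep y' y ((hKx hy').trans hy.symm) hne
    have := Filter.inter_mem (hle' (h₁.mem_nhds m₁)) (hle (h₂.mem_nhds m₂))
    rw [d.inter_eq] at this
    exact absurd this 𝒰.empty_notMem

lemma isCompact_inter_of_fiber (hsep : IsSeparatedMap f) {x : X} {K K' : Set Y}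
    (hK : IsCompact K) (hKx : K ⊆ f ⁻¹' {x}) (hK' : IsCompact K') (hKx' : K' ⊆ f ⁻¹' {x}) :
    IsCompact (K ∩ K') := by
  rw [isCompact_iff_ultrafilter_le_nhds']
  intro 𝒰 h
  obtain ⟨y, hy, hle⟩ := isCompact_iff_ultrafilter_le_nhds'.1 hK 𝒰
    (Filter.mem_of_superset h Set.inter_subset_left)
  exact ⟨y, ⟨hy, mem_of_mem_closure_of_isCompact hsep hK' hKx' (hKx hy)
    (mem_closure_iff_ultrafilter.2
      ⟨𝒰, Filter.mem_of_superset h Set.inter_subset_right, hle⟩)⟩, hle⟩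

end Neighbourhoods

/-! ### Extension of sections from a fibre to a neighbourhood -/

section Extension

variable {Y X : TopCat.{u}} {f : Y ⟶ X}
  {F : Sh Y} {x : X} {s : ∀ y : Y, Stalk F y}

open scoped Classical in
/-- A section over a compact subset of a fibre extends to an open neighbourhood. -/
lemma IsSec.exists_extension (hsep : IsSeparatedMap f) (hlp : IsLocallyProper f) {K : Set Y} (hK : IsCompact K) (hKx : K ⊆ f ⁻¹' {x})
    (hs : IsSec F K s) : ∃ (O : Set Y) (s' : ∀ y : Y, Stalk F y), IsOpen O ∧ K ⊆ O ∧
      IsSec F O s' ∧ ∀ y ∈ K, s' y = s y := by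
  -- Each point of `K` gets a neighbourhood `C`, proper over an open set, on which a local section
  -- `t` represents `s` at every point of `K`. Finitely many of the interiors cover `K`.
  have : ∀ y : K, ∃ (V : Opens Y) (t : F.obj.obj (op V)) (U : Set X) (C : Set Y), IsOpen U ∧
      f y.1 ∈ U ∧ ProperOn f C U ∧ C ∈ 𝓝 y.1 ∧ C ⊆ V ∧ ∀ z ∈ C, z ∈ K → germs F t z = s z := by
    rintro ⟨y, hy⟩
    obtain ⟨V, hV, t, e⟩ := hs y hy
    rw [eventually_nhdsWithin_iff] at e
    obtain ⟨U, hU, hyU, C, hC, hCy, hCO⟩ := hlp.exists_properOn y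
      (Filter.inter_mem (V.isOpen.mem_nhds hV) e)
    exact ⟨V, t, U, C, hU, hyU, hC, hCy, fun z hz => (hCO hz).1, fun z hz => (hCO hz).2⟩
  choose V t U C hU hyU hC hCy hCV ht using this
  obtain ⟨I, hI⟩ := hK.elim_finite_subcover (fun y : K => interior (C y))
    (fun _ => isOpen_interior) fun y hy =>
      Set.mem_iUnion.2 ⟨⟨y, hy⟩, mem_interior_iff_mem_nhds.2 (hCy ⟨y, hy⟩)⟩
  let UI : Set X := ⋂ i ∈ I, U i
  have hUI : IsOpen UI := isOpen_biInter_finset fun i _ => hU i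
  -- The locus over `UI`, covered by the interiors of the chosen `C i`, where all local sections
  -- available at a point have the same germ. It is open because the finitely many `C i` are
  -- relatively closed and agreement of germs is open.
  let W : Set Y := {y | f y ∈ UI ∧ (∃ i ∈ I, y ∈ interior (C i)) ∧
    ∀ i ∈ I, ∀ j ∈ I, y ∈ C i → y ∈ C j → germs F (t i) y = germs F (t j) y}
  have hWo : IsOpen W := by
    rw [isOpen_iff_eventually]
    rintro y ⟨hy₁, ⟨i, hi, hy₂⟩, hy₃⟩
    have cl : ∀ i ∈ I, y ∉ C i → ∀ᶠ z in 𝓝 y, z ∉ C i := fun i hi hn => by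
      have : y ∉ closure (C i) := fun hc => hn ((hC i).mem_of_mem_closure hlp.1 hsep
        (Set.mem_iInter₂.1 hy₁ i hi) hc)
      filter_upwards [isClosed_closure.isOpen_compl.mem_nhds this] with z hz hz'
      exact hz (subset_closure hz')
    have hy₁' : ∀ᶠ z in 𝓝 y, f z ∈ UI := hlp.1.continuousAt (hUI.mem_nhds hy₁)
    refine hy₁'.and (Filter.Eventually.and ?_ ?_)
    · filter_upwards [isOpen_interior.mem_nhds hy₂] with z hz using ⟨i, hi, hz⟩
    · rw [Filter.eventually_all_finset]
      intro i hi
      rw [Filter.eventually_all_finset]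
      intro j hj
      by_cases hyi : y ∈ C i
      · by_cases hyj : y ∈ C j
        · filter_upwards [germs_eventuallyEq F (t i) (t j) (hCV i hyi) (hCV j hyj)
            (hy₃ i hi j hj hyi hyj)] with z hz _ _ using hz
        · filter_upwards [cl j hj hyj] with z hz _ hz' using absurd hz' hz
      · filter_upwards [cl i hi hyi] with z hz hz' using absurd hz' hz
  -- On `W` the germ does not depend on the index chosen.
  let s' : ∀ y : Y, Stalk F y := fun y =>
    if h : ∃ i ∈ I, y ∈ C i then germs F (t h.choose) y else 0
  have hs' : ∀ y ∈ W, ∀ i ∈ I, y ∈ C i → s' y = germs F (t i) y := fun y hy i hi hyi => by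
    have h : ∃ i ∈ I, y ∈ C i := ⟨i, hi, hyi⟩
    exact (dif_pos h).trans (hy.2.2 _ h.choose_spec.1 _ hi h.choose_spec.2 hyi)
  have hKW : K ⊆ W := fun y hy => by
    refine ⟨Set.mem_iInter₂.2 fun i _ => ?_, ?_, fun i _ j _ hyi hyj => ?_⟩
    · have := hyU i
      rwa [hKx i.2, ← hKx hy] at this
    · simpa using hI hy
    · rw [ht i y hyi hy, ht j y hyj hy]
  refine ⟨W, s', hWo, hKW, isSec_of_eventually_of_isOpen hWo fun y hy => ?_, fun y hy => ?_⟩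
  · obtain ⟨i, hi, hyi⟩ := hy.2.1
    refine ⟨V i, hCV i (interior_subset hyi), t i, ?_⟩
    filter_upwards [hWo.mem_nhds hy, isOpen_interior.mem_nhds hyi] with z hz hz'
    exact (hs' z hz i hi (interior_subset hz')).symm
  · obtain ⟨i, hi, hyi⟩ := (hKW hy).2.1
    rw [hs' y (hKW hy) i hi (interior_subset hyi), ht i y (interior_subset hyi) hy]

variable (f F x) in
/-- A section over the fibre of `x` with compact support. -/
def IsCompactSec (s : ∀ y : Y, Stalk F y) : Prop :=
  IsSec F (f ⁻¹' {x}) s ∧ ∃ K : Set Y, IsCompact K ∧ K ⊆ f ⁻¹' {x} ∧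
    ∀ y, f y = x → y ∉ K → s y = 0

/-- Supports are relatively closed, so properness is inherited from any proper set containing the
support. -/
lemma ProperOn.mem_properSections {U : Opens X} {C : Set Y} (hC : ProperOn f C U)
    (t : F.obj.obj (op ((Opens.map f).obj U))) (ht : ∀ y, f y ∈ U → y ∉ C → germs F t y = 0) :
    t ∈ properSections f F U := by
  have : ProperOn f (supp F t) U := hC.of_closed
    (fun y hy => by
      by_contra hn
      exact (mem_supp_iff_germs F t y).1 hy (ht y (mapsTo_supp f F t hy) hn))
    (fun y hy hc => mem_supp_of_mem_closure F t hy hc)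
  exact (isProperMap_restrict_iff f.hom.continuous _).2 this.2

lemma properOn_supp {U : Opens X} {t : F.obj.obj (op ((Opens.map f).obj U))}
    (ht : t ∈ properSections f F U) : ProperOn f (supp F t) U :=
  ⟨mapsTo_supp f F t, (isProperMap_restrict_iff f.hom.continuous _).1 ht⟩

lemma isCompactSec_germs {U : Opens X} (hx : x ∈ U) {t : F.obj.obj (op ((Opens.map f).obj U))}
    (ht : t ∈ properSections f F U) : IsCompactSec f F x (germs F t) := by
  refine ⟨isSec_germs t fun y hy => ?_, _, (properOn_supp ht).isCompact_inter_fiber hx,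
    Set.inter_subset_right, fun y hy hn => ?_⟩
  · change f y ∈ U
    rwa [show f y = x from hy]
  · by_contra h
    exact hn ⟨(mem_supp_iff_germs F t y).2 h, hy⟩

open scoped Classical in
/-- A section with compact support over a fibre extends to a section with proper support over
a neighbourhood of the base point. -/
lemma IsCompactSec.exists_properSections (hsep : IsSeparatedMap f) (hlp : IsLocallyProper f)
    (hs : IsCompactSec f F x s) :
    ∃ (U : Opens X) (_ : x ∈ U), ∃ t ∈ properSections f F U, ∀ y, f y = x → germs F t y = s y := by
  obtain ⟨hs, K, hK, hKx, hs0⟩ := hs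
  obtain ⟨U, hU, hxU, C, hC, hKC, -⟩ :=
    hlp.exists_properOn_of_isCompact hK hKx isOpen_univ (Set.subset_univ _)
  obtain ⟨O, s', hO, hKO, hs', e⟩ := (hs.mono Set.inter_subset_right).exists_extension hsep hlp
    (hC.isCompact_inter_fiber hxU) Set.inter_subset_right
  have hz : IsOpen {y | y ∈ O ∧ s' y = 0} := hs'.isOpen_eq hO IsSec.zero
  -- These are the points of `C` that obstruct extending `s'` by zero: points outside the interior
  -- of `C` where `s'` is not known to vanish, and points where `s'` is not a section. They form a
  -- relatively closed subset of `C` that misses the fibre of `x`, so a smaller neighbourhood `U'`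
  -- avoids their image.
  have hB : ProperOn f (C ∩ ((interior C)ᶜ ∩ {y | y ∈ O ∧ s' y = 0}ᶜ ∪ Oᶜ)) U :=
    hC.of_closed Set.inter_subset_left fun y hy hc =>
      ⟨hC.mem_of_mem_closure hlp.1 hsep hy (closure_mono Set.inter_subset_left hc),
        ((isOpen_interior.isClosed_compl.inter hz.isClosed_compl).union
          hO.isClosed_compl).closure_subset (closure_mono Set.inter_subset_right hc)⟩
  obtain ⟨U', hU'U, hU', hxU', hBU'⟩ := hB.exists_isOpen hU hxU (by
    rintro y ⟨hyC, ⟨hyi, hyz⟩ | hyO⟩ rfl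
    swap
    · exact hyO (hKO ⟨hyC, rfl⟩)
    refine hyz ⟨hKO ⟨hyC, rfl⟩, ?_⟩
    rw [e y ⟨hyC, rfl⟩]
    exact hs0 y rfl fun h => hyi (hKC h))
  let U'' : Opens X := ⟨U', hU'⟩
  -- Over `U'` every point of `C` outside its interior lies in the open zero locus of `s'`, so the
  -- cut-off is still a section.
  let r : ∀ y : Y, Stalk F y := fun y => if y ∈ C then s' y else 0
  have hr : IsSec F ((Opens.map f).obj U'') r := by
    refine isSec_of_eventually_of_isOpen ((Opens.map f).obj U'').isOpen fun y hy => ?_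
    have hy : f y ∈ U' := hy
    by_cases hyz : y ∈ O ∧ s' y = 0
    · refine ⟨⊤, trivial, 0, ?_⟩
      filter_upwards [hz.mem_nhds hyz] with z hz
      rw [germs_zero]
      by_cases h : z ∈ C
      · exact ((if_pos h).trans hz.2).symm
      · exact (if_neg h).symm
    · by_cases hyC : y ∈ C
      · have hyi : y ∈ interior C := by
          by_contra h
          exact hBU' y ⟨hyC, Or.inl ⟨h, hyz⟩⟩ hy
        have hyO : y ∈ O := by
          by_contra hn
          exact hBU' y ⟨hyC, Or.inr hn⟩ hy
        obtain ⟨V, hV, t, e⟩ := hs' y hyO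
        rw [hO.nhdsWithin_eq hyO] at e
        refine ⟨V, hV, t, ?_⟩
        filter_upwards [e, isOpen_interior.mem_nhds hyi] with z h₁ h₂
        exact h₁.trans (if_pos (interior_subset h₂)).symm
      · refine ⟨⊤, trivial, 0, ?_⟩
        have : y ∉ closure C := fun hc => hyC (hC.mem_of_mem_closure hlp.1 hsep (hU'U hy) hc)
        filter_upwards [isClosed_closure.isOpen_compl.mem_nhds this] with z hz
        rw [germs_zero]
        exact (if_neg fun h => hz (subset_closure h)).symm
  obtain ⟨t, ht⟩ := hr.exists_germs_eq
  refine ⟨U'', hxU', t, (hC.inter hU'U).mem_properSections t fun y hy hn => ?_, fun y hy => ?_⟩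
  · rw [ht y hy]
    exact if_neg fun h => hn ⟨h, hy⟩
  · rw [ht y (show f y ∈ U' by rwa [hy])]
    by_cases h : y ∈ C
    · exact (if_pos h).trans (e y ⟨h, hy⟩)
    · refine (if_neg h).trans (hs0 y hy fun hK => h (interior_subset (hKC hK))).symm

/-- The support is proper over `U` and misses the fibre, so a neighbourhood of `x` avoids its image.
-/
lemma exists_germs_eq_zero_of_fiber {U : Opens X} (hx : x ∈ U)
    {t : F.obj.obj (op ((Opens.map f).obj U))} (ht : t ∈ properSections f F U)
    (h0 : ∀ y, f y = x → germs F t y = 0) :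
    ∃ (U' : Opens X) (_ : x ∈ U') (i : U' ⟶ U), F.obj.map ((Opens.map f).map i).op t = 0 := by
  obtain ⟨U', hU'U, hU', hxU', h⟩ := (properOn_supp ht).exists_isOpen U.isOpen hx
    (fun y hy e => (mem_supp_iff_germs F t y).1 hy (h0 y e))
  refine ⟨⟨U', hU'⟩, hxU', homOfLE hU'U, germs_ext F _ _ fun y hy => ?_⟩
  rw [germs_map F _ _ hy, germs_zero]
  by_contra hn
  exact h y ((mem_supp_iff_germs F t y).2 hn) hy

end Extension

end ProperImage

namespace ProperImage

/-! ### Short exact sequences on stalks and on sections over subsets -/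

section Stalks

variable {Y : TopCat.{u}}

/-- The stalk at a point as a functor on sheaves. -/
abbrev stalkSh (y : Y) : Sh Y ⥤ AddCommGrpCat.{u} :=
  TopCat.Sheaf.forget AddCommGrpCat.{u} Y ⋙ TopCat.Presheaf.stalkFunctor AddCommGrpCat.{u} y

lemma shortExact_stalk {S : ShortComplex (Sh Y)} (hS : S.ShortExact) (y : Y) :
    (S.map (stalkSh y)).ShortExact :=
  hS.map_of_exact (stalkSh y)

lemma stalkMap_injective {S : ShortComplex (Sh Y)} (hS : S.ShortExact) (y : Y) :
    Function.Injective (stalkMap S.f y) :=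
  (AddCommGrpCat.mono_iff_injective _).1 (shortExact_stalk hS y).mono_f

lemma stalkMap_surjective {S : ShortComplex (Sh Y)} (hS : S.ShortExact) (y : Y) :
    Function.Surjective (stalkMap S.g y) :=
  (AddCommGrpCat.epi_iff_surjective _).1 (shortExact_stalk hS y).epi_g

lemma stalkMap_exact {S : ShortComplex (Sh Y)} (hS : S.ShortExact) (y : Y) (a : Stalk S.X₂ y)
    (ha : stalkMap S.g y a = 0) : ∃ b : Stalk S.X₁ y, stalkMap S.f y b = a :=
  (ShortComplex.ab_exact_iff _).1 (shortExact_stalk hS y).exact a ha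

lemma stalkMap_comp_apply {S : ShortComplex (Sh Y)} (y : Y) (b : Stalk S.X₁ y) :
    stalkMap S.g y (stalkMap S.f y b) = 0 :=
  ConcreteCategory.congr_hom (S.map (stalkSh y)).zero b

/-- A section over a subset which is killed by `S.g` lifts to `S.X₁`. -/
lemma IsSec.exists_lift_of_exact {S : ShortComplex (Sh Y)} (hS : S.ShortExact) {K : Set Y}
    {s : ∀ y : Y, Stalk S.X₂ y} (hs : IsSec S.X₂ K s) (h0 : ∀ y ∈ K, stalkMap S.g y (s y) = 0) :
    ∃ r : ∀ y : Y, Stalk S.X₁ y, IsSec S.X₁ K r ∧ ∀ y ∈ K, stalkMap S.f y (r y) = s y := by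
  classical
  have : ∀ y, ∃ b : Stalk S.X₁ y, y ∈ K → stalkMap S.f y b = s y := fun y => by
    by_cases hy : y ∈ K
    · obtain ⟨b, hb⟩ := stalkMap_exact hS y (s y) (h0 y hy)
      exact ⟨b, fun _ => hb⟩
    · exact ⟨0, fun h => absurd h hy⟩
  choose r hr using this
  refine ⟨r, fun y hy => ?_, hr⟩
  obtain ⟨V, hV, t, e⟩ := hs y hy
  have e0 : germs S.X₂ t y = stalkMap S.f y (r y) :=
    (e.self_of_nhdsWithin hy).trans (hr y hy).symm
  -- Near `y` the image of a local section through `r y` agrees with `s`; injectivity on stalks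
  -- forces that section to agree with the pointwise chosen preimages.
  obtain ⟨V', hV', t', et'⟩ := exists_germs_eq_stalk S.X₁ (r y)
  refine ⟨V', hV', t', ?_⟩
  have := germs_eventuallyEq S.X₂ t (S.f.hom.app (op V') t') hV hV' (by
    rw [e0, germs_hom, et'])
  filter_upwards [e, mem_nhdsWithin_of_mem_nhds this, self_mem_nhdsWithin] with z h₁ h₂ h₃
  apply stalkMap_injective hS z
  rw [hr z h₃, ← h₁, h₂, germs_hom]

end Stalks

/-! ### Softness along the fibres and exactness of the proper direct image -/

section Soft

variable {Y X : TopCat.{u}} {f : Y ⟶ X}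

variable (f) in
/-- A sheaf on `Y` is soft along the fibres of `f` if every section over a compact subset of a
fibre extends to a section with compact support over the fibre. -/
def Soft (F : Sh Y) : Prop :=
  ∀ (x : X) (K : Set Y) (s : ∀ y : Y, Stalk F y), IsCompact K → K ⊆ f ⁻¹' {x} → IsSec F K s →
    ∃ s' : ∀ y : Y, Stalk F y, IsCompactSec f F x s' ∧ ∀ y ∈ K, s' y = s y

/-- Compact subsets of a fibre are closed in it, so sections over two of them that agree on the
overlap glue. -/
lemma isSec_ite_union {F : Sh Y} (hsep : IsSeparatedMap f) {x : X} {K₁ K₂ : Set Y}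
    (hK₁ : IsCompact K₁) (hx₁ : K₁ ⊆ f ⁻¹' {x}) (hK₂ : IsCompact K₂) (hx₂ : K₂ ⊆ f ⁻¹' {x})
    {s₁ s₂ : ∀ y : Y, Stalk F y} (h₁ : IsSec F K₁ s₁) (h₂ : IsSec F K₂ s₂)
    (e : ∀ y ∈ K₁, y ∈ K₂ → s₁ y = s₂ y) :
    ∃ s : ∀ y : Y, Stalk F y, IsSec F (K₁ ∪ K₂) s ∧ (∀ y ∈ K₁, s y = s₁ y) ∧
      ∀ y ∈ K₂, s y = s₂ y := by
  classical
  let s : ∀ y : Y, Stalk F y := fun y => if y ∈ K₁ then s₁ y else s₂ y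
  have es₁ : ∀ y ∈ K₁, s y = s₁ y := fun y hy => if_pos hy
  have es₂ : ∀ y ∈ K₂, s y = s₂ y := fun y hy => by
    by_cases hy' : y ∈ K₁
    · rw [es₁ y hy', e y hy' hy]
    · exact if_neg hy'
  exact ⟨s, (h₁.congr fun y hy => (es₁ y hy).symm).union (h₂.congr fun y hy => (es₂ y hy).symm)
    (fun y hy hc => mem_of_mem_closure_of_isCompact hsep hK₁ hx₁ (hx₂ hy) hc)
    (fun y hy hc => mem_of_mem_closure_of_isCompact hsep hK₂ hx₂ (hx₁ hy) hc), es₁, es₂⟩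

variable {S : ShortComplex (Sh Y)}

/-- Lifts exist near each point. Two lifts differ on an overlap by a section of the soft sheaf
`S.X₁`, and extending this difference allows one of them to be corrected; compactness reduces to
finitely many such gluings. -/
lemma Soft.exists_lift_of_isCompact (hsep : IsSeparatedMap f) (hlp : IsLocallyProper f)
    (hS : S.ShortExact) (h₁ : Soft f S.X₁) {x : X} {K : Set Y} (hK : IsCompact K)
    (hKx : K ⊆ f ⁻¹' {x}) {s : ∀ y : Y, Stalk S.X₃ y} (hs : IsSec S.X₃ K s) :
    ∃ r : ∀ y : Y, Stalk S.X₂ y, IsSec S.X₂ K r ∧ ∀ y ∈ K, stalkMap S.g y (r y) = s y := by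
  -- The sets `T` met in the compactness induction need not be compact, whereas softness applies
  -- only to compact sets. The induction predicate therefore asks for a lift over some compact `K'`
  -- between `T ∩ K` and `K`.
  suffices h : ∃ K' : Set Y, IsCompact K' ∧ K' ⊆ K ∧ K ∩ K ⊆ K' ∧
      ∃ r : ∀ y : Y, Stalk S.X₂ y, IsSec S.X₂ K' r ∧ ∀ y ∈ K', stalkMap S.g y (r y) = s y by
    obtain ⟨K', -, -, hKK', r, hr, e⟩ := h
    rw [Set.inter_self] at hKK'
    exact ⟨r, hr.mono hKK', fun y hy => e y (hKK' hy)⟩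
  refine hK.induction_on (p := fun T => ∃ K' : Set Y, IsCompact K' ∧ K' ⊆ K ∧ T ∩ K ⊆ K' ∧
      ∃ r : ∀ y : Y, Stalk S.X₂ y, IsSec S.X₂ K' r ∧ ∀ y ∈ K', stalkMap S.g y (r y) = s y)
    ?_ ?_ ?_ ?_
  · exact ⟨∅, isCompact_empty, Set.empty_subset _, by simp, fun _ => 0, IsSec.zero, by simp⟩
  · rintro T T' hT ⟨K', h₁, h₂, h₃, h₄⟩
    exact ⟨K', h₁, h₂, (Set.inter_subset_inter_left _ hT).trans h₃, h₄⟩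
  · rintro T₁ T₂ ⟨K₁, hK₁, hKK₁, hT₁, r₁, hr₁, e₁⟩ ⟨K₂, hK₂, hKK₂, hT₂, r₂, hr₂, e₂⟩
    have hx₁ := hKK₁.trans hKx
    have hx₂ := hKK₂.trans hKx
    obtain ⟨d, hd, ed⟩ := ((hr₁.mono Set.inter_subset_left).sub
      (hr₂.mono (K' := K₁ ∩ K₂) Set.inter_subset_right)).exists_lift_of_exact hS (by
        rintro y ⟨hy₁, hy₂⟩
        rw [map_sub, e₁ y hy₁, e₂ y hy₂, sub_self])
    obtain ⟨d', hd', ed'⟩ := h₁ x _ d (isCompact_inter_of_fiber hsep hK₁ hx₁ hK₂ hx₂)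
      (Set.inter_subset_left.trans hx₁) hd
    obtain ⟨r, hr, er₁, er₂⟩ := isSec_ite_union hsep hK₁ hx₁ hK₂ hx₂ hr₁
      (hr₂.add ((hd'.1.hom S.f).mono hx₂)) (fun y hy₁ hy₂ => by
        rw [ed' y ⟨hy₁, hy₂⟩, ed y ⟨hy₁, hy₂⟩]
        abel)
    refine ⟨K₁ ∪ K₂, hK₁.union hK₂, Set.union_subset hKK₁ hKK₂, ?_, r, hr, ?_⟩
    · rw [Set.union_inter_distrib_right]
      exact Set.union_subset_union hT₁ hT₂
    · rintro y (hy | hy)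
      · rw [er₁ y hy, e₁ y hy]
      · rw [er₂ y hy, map_add, e₂ y hy, stalkMap_comp_apply, add_zero]
  · intro y hy
    obtain ⟨V, hV, t, e⟩ := hs y hy
    obtain ⟨a, ha⟩ := stalkMap_surjective hS y (s y)
    obtain ⟨V', hV', t', et'⟩ := exists_germs_eq_stalk S.X₂ a
    have := germs_eventuallyEq S.X₃ t (S.g.hom.app (op V') t') hV hV' (by
      rw [e.self_of_nhdsWithin hy, germs_hom, et', ← ha])
    rw [eventually_nhdsWithin_iff] at e
    obtain ⟨U, hU, hyU, C, hC, hCy, hCO⟩ := hlp.exists_properOn y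
      (Filter.inter_mem (Filter.inter_mem e this) (V'.isOpen.mem_nhds hV'))
    have hxU : x ∈ U := by rwa [hKx hy] at hyU
    refine ⟨C, mem_nhdsWithin_of_mem_nhds hCy, (C ∩ f ⁻¹' {x}) ∩ K,
      isCompact_inter_of_fiber hsep (hC.isCompact_inter_fiber hxU) Set.inter_subset_right hK hKx,
      Set.inter_subset_right, fun z hz => ⟨⟨hz.1, hKx hz.2⟩, hz.2⟩, germs S.X₂ t',
      isSec_germs t' fun z hz => (hCO hz.1.1).2, fun z hz => ?_⟩
    rw [← (hCO hz.1.1).1.1 hz.2, (hCO hz.1.1).1.2, germs_hom]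

/-- A lift over a compact neighbourhood of the support lies in `S.X₁` on the part of that
neighbourhood outside the interior, where `s` vanishes. Extending this part by softness and
subtracting it makes the lift vanish there, so that it extends by zero. -/
lemma Soft.exists_isCompactSec_lift (hsep : IsSeparatedMap f) (hlp : IsLocallyProper f)
    (hS : S.ShortExact) (h₁ : Soft f S.X₁) {x : X} {s : ∀ y : Y, Stalk S.X₃ y}
    (hs : IsCompactSec f S.X₃ x s) :
    ∃ r : ∀ y : Y, Stalk S.X₂ y, IsCompactSec f S.X₂ x r ∧
      ∀ y, f y = x → stalkMap S.g y (r y) = s y := by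
  classical
  obtain ⟨hs, K, hK, hKx, hs0⟩ := hs
  obtain ⟨U, hU, hxU, C, hC, hKC, -⟩ :=
    hlp.exists_properOn_of_isCompact hK hKx isOpen_univ (Set.subset_univ _)
  have hCx := hC.isCompact_inter_fiber hxU
  obtain ⟨r, hr, er⟩ := h₁.exists_lift_of_isCompact hsep hlp hS hCx Set.inter_subset_right
    (hs.mono Set.inter_subset_right)
  have hB : IsCompact ((C ∩ f ⁻¹' {x}) ∩ (interior C)ᶜ) :=
    hCx.inter_right isOpen_interior.isClosed_compl
  obtain ⟨d, hd, ed⟩ := (hr.mono (Set.inter_subset_left (t := (interior C)ᶜ))).exists_lift_of_exact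
    hS (by
      rintro y ⟨hy, hyi⟩
      rw [er y hy]
      exact hs0 y hy.2 fun h => hyi (hKC h))
  obtain ⟨d', hd', ed'⟩ := h₁ x _ d hB (Set.inter_subset_left.trans Set.inter_subset_right) hd
  let r' : ∀ y : Y, Stalk S.X₂ y := fun y => if y ∈ C then r y - stalkMap S.f y (d' y) else 0
  have hr'C : ∀ y ∈ C, r' y = r y - stalkMap S.f y (d' y) := fun y hy => if_pos hy
  have hr'0 : ∀ y ∉ C, r' y = 0 := fun y hy => if_neg hy
  refine ⟨r', ⟨?_, _, hCx, Set.inter_subset_right, fun y hy hn =>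
    hr'0 y fun h => hn ⟨h, hy⟩⟩, fun y hy => ?_⟩
  · have : f ⁻¹' {x} = (C ∩ f ⁻¹' {x}) ∪ (f ⁻¹' {x} ∩ (interior C)ᶜ) := by
      ext y
      by_cases hy : y ∈ interior C
      · simp [hy, interior_subset hy]
      · simp [hy]
    rw [this]
    refine IsSec.union ((hr.sub ((hd'.1.hom S.f).mono Set.inter_subset_right)).congr
      fun y hy => (hr'C y hy.1).symm) (IsSec.zero.congr fun y hy => ?_) ?_ ?_
    · by_cases h : y ∈ C
      · rw [hr'C y h, ed' y ⟨⟨h, hy.1⟩, hy.2⟩, ed y ⟨⟨h, hy.1⟩, hy.2⟩, sub_self]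
      · rw [hr'0 y h]
    · exact fun y hy hc => mem_of_mem_closure_of_isCompact hsep hCx Set.inter_subset_right hy.1 hc
    · exact fun y hy hc => ⟨hy.2, isOpen_interior.isClosed_compl.closure_subset
        (closure_mono Set.inter_subset_right hc)⟩
  · by_cases h : y ∈ C
    · rw [hr'C y h, map_sub, er y ⟨h, hy⟩, stalkMap_comp_apply, sub_zero]
    · rw [hr'0 y h, map_zero]
      exact (hs0 y hy fun hK => h (interior_subset (hKC hK))).symm

/-- Lift the section to `S.X₂`, extend it there, and project back. -/
lemma Soft.of_shortExact (hsep : IsSeparatedMap f) (hlp : IsLocallyProper f)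
    (hS : S.ShortExact) (h₁ : Soft f S.X₁) (h₂ : Soft f S.X₂) : Soft f S.X₃ := by
  intro x K s hK hKx hs
  obtain ⟨r, hr, er⟩ := h₁.exists_lift_of_isCompact hsep hlp hS hK hKx hs
  obtain ⟨r', ⟨hr', K', hK', hKx', h0⟩, er'⟩ := h₂ x K r hK hKx hr
  refine ⟨_, ⟨hr'.hom S.g, K', hK', hKx', fun y hy hn => ?_⟩, fun y hy => ?_⟩
  · rw [h0 y hy hn, map_zero]
  · rw [er' y hy]
    exact er y hy

/-- The proper direct image preserves short exact sequences whose first term is soft. -/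
lemma Soft.epi_properImage_map (hsep : IsSeparatedMap f) (hlp : IsLocallyProper f)
    (hS : S.ShortExact) (h₁ : Soft f S.X₁) : Epi ((properImage f).map S.g) := by
  rw [← TopCat.Sheaf.isLocallySurjective_iff_epi, TopCat.Presheaf.isLocallySurjective_iff]
  intro U t x hx
  obtain ⟨r, hr, er⟩ := h₁.exists_isCompactSec_lift hsep hlp hS (isCompactSec_germs hx t.2)
  obtain ⟨U₁, hxU₁, t₁, ht₁, e₁⟩ := hr.exists_properSections hsep hlp
  let i : U ⊓ U₁ ⟶ U := Opens.infLELeft U U₁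
  let i₁ : U ⊓ U₁ ⟶ U₁ := Opens.infLERight U U₁
  -- The difference between `t` and the image of the extended lift has proper support and vanishes
  -- on the fibre of `x`, hence it vanishes over a smaller neighbourhood.
  have hd : S.X₃.obj.map ((Opens.map f).map i).op t.1 -
      S.g.hom.app _ (S.X₂.obj.map ((Opens.map f).map i₁).op t₁) ∈
        properSections f S.X₃ (U ⊓ U₁) :=
    AddSubgroup.sub_mem _ (mem_properSections_map f i t.2)
      (mem_properSections_hom f S.g (mem_properSections_map f i₁ ht₁))
  obtain ⟨U₂, hxU₂, i₂, e₂⟩ := exists_germs_eq_zero_of_fiber (x := x) (U := U ⊓ U₁) ⟨hx, hxU₁⟩ hd (fun y hy => by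
    have hy' : y ∈ (Opens.map f).obj (U ⊓ U₁) := by
      change f y ∈ U ⊓ U₁
      rw [hy]
      exact ⟨hx, hxU₁⟩
    rw [sub_eq_add_neg, germs_add, germs_neg, germs_map _ _ _ hy', germs_hom, germs_map _ _ _ hy',
      e₁ y hy, ← er y hy, add_neg_cancel])
  refine ⟨U₂, (i₂ ≫ i).le, ⟨⟨_, mem_properSections_map f (i₂ ≫ i₁) ht₁⟩, ?_⟩, hxU₂⟩
  apply Subtype.ext
  refine germs_ext S.X₃ _ _ fun y hy => ?_
  have hy' : y ∈ (Opens.map f).obj (U ⊓ U₁) := i₂.le hy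
  have e := congrArg (fun t => germs S.X₃ t y) e₂
  simp only [sub_eq_add_neg, map_add, map_neg, germs_add, germs_neg, germs_zero] at e
  rw [germs_map _ _ _ hy, germs_map _ _ _ hy, germs_map _ _ _ hy', germs_hom,
    germs_map _ _ _ hy', add_neg_eq_zero] at e
  refine (germs_hom S.g _ y).trans (Eq.trans ?_ (germs_map S.X₃ ((Opens.map f).map
    (homOfLE (i₂ ≫ i).le)) t.1 hy).symm)
  rw [e]
  exact congrArg (stalkMap S.g y) (germs_map S.X₂ ((Opens.map f).map (i₂ ≫ i₁)) t₁ hy)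

lemma mono_of_app_injective {F G : Sh X} (φ : F ⟶ G)
    (h : ∀ U : Opens X, Function.Injective (φ.hom.app (op U))) : Mono φ := by
  have : ∀ x, Mono ((TopCat.Presheaf.stalkFunctor AddCommGrpCat.{u} x).map φ.hom) := fun x =>
    (AddCommGrpCat.mono_iff_injective _).2
      (TopCat.Presheaf.stalkFunctor_map_injective_of_app_injective h x)
  exact TopCat.Presheaf.mono_of_stalk_mono φ

/-- A complex of sheaves is exact if it is exact locally on sections. -/
lemma exact_of_sections_exact {S : ShortComplex (Sh X)}
    (h : ∀ (U : Opens X) (t : S.X₂.obj.obj (op U)), S.g.hom.app (op U) t = 0 →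
      ∃ r, S.f.hom.app (op U) r = t) : S.Exact := by
  rw [TopCat.Sheaf.exact_iff_stalkFunctor_map_exact]
  intro x
  rw [ShortComplex.ab_exact_iff]
  intro a ha
  obtain ⟨V, hV, t, rfl⟩ := exists_germs_eq_stalk S.X₂ (y := x) a
  have e : germs S.X₃ (S.g.hom.app (op V) t) x = 0 := (germs_hom S.g t x).trans ha
  obtain ⟨W, hW, i, e'⟩ := (notMem_supp_iff S.X₃ (S.g.hom.app (op V) t) hV).1
    (fun h => (mem_supp_iff_germs _ _ _).1 h e)
  obtain ⟨r, hr⟩ := h W (S.X₂.obj.map i.op t)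
    ((ConcreteCategory.congr_hom (S.g.hom.naturality i.op) t).trans e')
  refine ⟨germs S.X₁ r x, (germs_hom S.f r x).symm.trans ?_⟩
  rw [hr]
  exact germs_map S.X₂ i t hW

lemma injective_app_of_mono {F G : Sh Y} (φ : F ⟶ G) [Mono φ] (U : Opens Y) :
    Function.Injective (φ.hom.app (op U)) := by
  refine TopCat.Presheaf.app_injective_of_stalkFunctor_map_injective φ.hom U fun x _ => ?_
  exact (AddCommGrpCat.mono_iff_injective _).1 (TopCat.Presheaf.stalk_mono_of_mono φ x)

/-- On the left, a section of the subsheaf has the same support as its image, so properness of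
support is not lost. Surjectivity on the right is where softness enters. -/
lemma properImage_map_shortExact (hsep : IsSeparatedMap f) (hlp : IsLocallyProper f)
    (hS : S.ShortExact) (h₁ : Soft f S.X₁) : (S.map (properImage f)).ShortExact := by
  have := hS.mono_f
  have inj := injective_app_of_mono S.f
  refine ShortComplex.ShortExact.mk' (exact_of_sections_exact fun U t ht => ?_)
    (mono_of_app_injective _ fun U t t' h => Subtype.ext (inj _ (congrArg Subtype.val h)))
    (h₁.epi_properImage_map hsep hlp hS)
  obtain ⟨r, hr⟩ := TopCat.Sheaf.sections_exact_of_left_exact hS.exact hS.mono_f t.1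
    (congrArg Subtype.val ht)
  refine ⟨⟨r, ?_⟩, Subtype.ext hr⟩
  refine (properOn_supp t.2).mem_properSections r fun y hy hn => ?_
  apply stalkMap_injective hS y
  rw [map_zero, ← germs_hom, hr]
  by_contra h
  exact hn ((mem_supp_iff_germs _ _ _).2 h)

end Soft

end ProperImage

namespace ProperImage

/-! ### Sheaves of families and extension of sections of injective sheaves -/

section Families

variable {Y : TopCat.{u}}

/-- The presheaf of all families of elements of the groups `A y`. -/
def familyPresheaf (A : Y → AddCommGrpCat.{u}) : TopCat.Presheaf AddCommGrpCat.{u} Y where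
  obj U := AddCommGrpCat.of (∀ y : U.unop, A y.1)
  map i := AddCommGrpCat.ofHom
    { toFun s y := s ⟨y.1, i.unop.le y.2⟩
      map_zero' := rfl
      map_add' _ _ := rfl }
  map_id _ := rfl
  map_comp _ _ := rfl

lemma isSheaf_familyPresheaf (A : Y → AddCommGrpCat.{u}) : (familyPresheaf A).IsSheaf := by
  rw [TopCat.Presheaf.isSheaf_iff_isSheafUniqueGluing]
  intro ι U sf hsf
  have hU : ∀ y : (iSup U : Opens Y), ∃ i, y.1 ∈ U i := fun y => Opens.mem_iSup.1 y.2
  choose i hi using hU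
  have compat : ∀ (j k : ι) (y : Y) (hj : y ∈ U j) (hk : y ∈ U k),
      (sf j : ∀ y : U j, A y.1) ⟨y, hj⟩ = (sf k : ∀ y : U k, A y.1) ⟨y, hk⟩ :=
    fun j k y hj hk => congrFun (a := (⟨y, hj, hk⟩ : (U j ⊓ U k : Opens Y))) (hsf j k)
  refine ⟨fun y => (sf (i y) : ∀ z : U (i y), A z.1) ⟨y.1, hi y⟩, fun j => ?_, fun t ht => ?_⟩
  · funext y
    exact compat _ _ _ _ _
  · funext y
    exact congrFun (a := (⟨y.1, hi y⟩ : U (i y))) (ht (i y))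

/-- The sheaf of all families of elements of the groups `A y`. -/
def family (A : Y → AddCommGrpCat.{u}) : Sh Y := ⟨familyPresheaf A, isSheaf_familyPresheaf A⟩

/-- The morphism to a sheaf of families given by homomorphisms on the stalks. -/
def toFamily {F : Sh Y} {A : Y → AddCommGrpCat.{u}} (q : ∀ y, Stalk F y →+ A y) :
    F ⟶ family A := ⟨
  { app U := AddCommGrpCat.ofHom
      { toFun t y := q y.1 (germs F (V := U.unop) t y.1)
        map_zero' := funext fun y => by
          rw [germs_zero, map_zero]
          rfl
        map_add' t t' := funext fun y => by
          rw [germs_add, map_add]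
          rfl }
    naturality U V i := by
      ext t
      funext y
      exact congrArg (q y.1) (germs_map F i.unop t y.2) }⟩

/-- The embedding of a sheaf into the sheaf of families of germs. -/
def toGodement (F : Sh Y) : F ⟶ family (Stalk F) := toFamily fun _ => AddMonoidHom.id _

instance (F : Sh Y) : Mono (toGodement F) :=
  mono_of_app_injective _ fun U t t' h => germs_ext F t t' fun y hy =>
    congrFun (a := (⟨y, hy⟩ : U)) h

/-- Sections of an injective sheaf extend to larger open subsets. -/
lemma exists_map_eq_of_injective (I : Sh Y) [Injective I] {V U : Opens Y} (i : V ⟶ U)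
    (t : I.obj.obj (op V)) : ∃ t' : I.obj.obj (op U), I.obj.map i.op t' = t := by
  classical
  -- Injectivity makes `I` a retract of the sheaf of families of its germs, where sections extend by
  -- zero; `germs I t` already is this extension.
  let ρ : family (Stalk I) ⟶ I := Injective.factorThru (𝟙 I) (toGodement I)
  have hρ : toGodement I ≫ ρ = 𝟙 I := Injective.comp_factorThru _ _
  let s : (family (Stalk I)).obj.obj (op U) := (fun y => germs I t y.1 : ∀ y : U, Stalk I y.1)
  refine ⟨ρ.hom.app (op U) s, ?_⟩
  refine (ConcreteCategory.congr_hom (ρ.hom.naturality i.op) s).symm.trans ?_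
  exact ConcreteCategory.congr_hom (NatTrans.congr_app (congrArg (fun φ => φ.hom) hρ) (op V)) t

end Families

/-! ### Injective sheaves are soft -/

section Soft

variable {Y X : TopCat.{u}} {f : Y ⟶ X}

/-- Flabby implies soft: a section over a compact set is extended to an open set, cut off by a
proper neighbourhood, and the result extended to all of `Y`. -/
lemma soft_of_exists_map_eq (hsep : IsSeparatedMap f) (hlp : IsLocallyProper f) (F : Sh Y)
    (hF : ∀ {V : Opens Y} (t : F.obj.obj (op V)),
      ∃ t' : F.obj.obj (op ⊤), F.obj.map (homOfLE le_top).op t' = t) : Soft f F := by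
  classical
  intro x K s hK hKx hs
  obtain ⟨O, s', hO, hKO, hs', e⟩ := hs.exists_extension hsep hlp hK hKx
  obtain ⟨U, hU, hxU, C, hC, hKC, hCO⟩ := hlp.exists_properOn_of_isCompact hK hKx hO hKO
  -- The frontier of `C` is left out so that the cut-off by zero is a section over an open set.
  -- Frontier points over `U` belong to `C`, so arbitrary values there do not spoil compactness of
  -- the support on the fibre.
  let W : Opens Y := ⟨interior C ∪ (closure C)ᶜ,
    isOpen_interior.union isClosed_closure.isOpen_compl⟩
  have hW : IsSec F W (fun y => if y ∈ C then s' y else 0) := by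
    refine IsSec.union (K := interior C) (K' := (closure C)ᶜ)
      ((hs'.mono (interior_subset.trans hCO)).congr fun y hy => (if_pos (interior_subset hy)).symm)
      (IsSec.zero.congr fun y hy => (if_neg fun h => hy (subset_closure h)).symm) ?_ ?_
    · exact fun y hy hc => absurd (closure_mono interior_subset hc) hy
    · intro y hy hc
      obtain ⟨z, hz, hz'⟩ := mem_closure_iff.1 hc _ isOpen_interior hy
      exact absurd (subset_closure (interior_subset hz)) hz'
  obtain ⟨t, ht⟩ := hW.exists_germs_eq
  obtain ⟨t', rfl⟩ := hF t
  have ht' : ∀ y ∈ W, germs F t' y = if y ∈ C then s' y else 0 := fun y hy =>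
    (germs_map F (homOfLE le_top) t' hy).symm.trans (ht y hy)
  refine ⟨germs F t', ⟨isSec_germs t' fun y _ => trivial, _, hC.isCompact_inter_fiber hxU,
    Set.inter_subset_right, fun y hy hn => ?_⟩, fun y hy => ?_⟩
  · have hyC : y ∉ C := fun h => hn ⟨h, hy⟩
    rw [ht' y (Or.inr fun hc => hyC (hC.mem_of_mem_closure hlp.1 hsep (by rwa [hy]) hc)),
      if_neg hyC]
  · rw [ht' y (Or.inl (hKC hy)), if_pos (interior_subset (hKC hy)), e y hy]

lemma soft_of_injective (hsep : IsSeparatedMap f) (hlp : IsLocallyProper f) (I : Sh Y)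
    [Injective I] : Soft f I :=
  soft_of_exists_map_eq hsep hlp I fun t => exists_map_eq_of_injective I _ t

end Soft

end ProperImage

namespace ProperImage

open scoped TensorProduct

/-! ### Maps from stalks to families, and a criterion for surjectivity -/

section Families

variable {Y : TopCat.{u}}

/-- The homomorphism on a stalk induced by a morphism to a sheaf of families. -/
def stalkLift {F : Sh Y} {A : Y → AddCommGrpCat.{u}} (φ : F ⟶ family A) (y : Y) :
    Stalk F y →+ A y :=
  AddCommGrpCat.Hom.hom (colimit.desc ((OpenNhds.inclusion y).op ⋙ F.obj)
    { pt := A y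
      ι :=
        { app V := φ.hom.app (op V.unop.1) ≫ AddCommGrpCat.ofHom
            (Pi.evalAddMonoidHom (fun z : V.unop.1 => A z.1) ⟨y, V.unop.2⟩)
          naturality V W i := by
            ext t
            exact congrFun (a := (⟨y, W.unop.2⟩ : W.unop.1)) (ConcreteCategory.congr_hom
              (φ.hom.naturality ((OpenNhds.inclusion y).map i.unop).op) t) } })

lemma stalkLift_germs {F : Sh Y} {A : Y → AddCommGrpCat.{u}} (φ : F ⟶ family A) {V : Opens Y}
    (t : F.obj.obj (op V)) {y : Y} (hy : y ∈ V) :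
    stalkLift φ y (germs F t y) = (φ.hom.app (op V) t : ∀ z : V, A z.1) ⟨y, hy⟩ := by
  rw [germs_of_mem F t hy]
  exact ConcreteCategory.congr_hom (colimit.ι_desc (F := (OpenNhds.inclusion y).op ⋙ F.obj) _
    (op ⟨V, hy⟩)) t

/-- Homomorphisms to the stalks of a sheaf are surjective if the morphism to the sheaf of
families of elements of the cokernels vanishes. -/
lemma surjective_of_toFamily_eq_zero {H : Sh Y} {B : Y → Type u} [∀ y, AddCommGroup (B y)]
    (m : ∀ y, B y →+ Stalk H y)
    (h : toFamily (A := fun y => AddCommGrpCat.of (Stalk H y ⧸ (m y).range))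
      (fun y => QuotientAddGroup.mk' (m y).range) = 0) (y : Y) :
    Function.Surjective (m y) := by
  intro a
  obtain ⟨V, hV, t, rfl⟩ := exists_germs_eq_stalk H a
  have e := congrFun (ConcreteCategory.congr_hom (NatTrans.congr_app
    (congrArg (fun φ => φ.hom) h) (op V)) t) (⟨y, hV⟩ : V)
  exact (QuotientAddGroup.eq_zero_iff _).1 e

end Families

/-! ### Stalks of tensor products -/

section Tensor

variable {Y : TopCat.{u}} (F G : Sh Y)

/-- The tensor product of two sheaves. -/
abbrev tensor : Sh Y := ((tensorSheaf Y).obj F).obj G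

variable {F G} in
/-- The section `s ⊗ t` of the tensor product. -/
def tmul {V : Opens Y} (s : F.obj.obj (op V)) (t : G.obj.obj (op V)) :
    (tensor F G).obj.obj (op V) := (tensorSection F G V).hom (s ⊗ₜ[ℤ] t)

lemma tmul_add_left {V : Opens Y} (s s' : F.obj.obj (op V)) (t : G.obj.obj (op V)) :
    tmul (s + s') t = tmul s t + tmul s' t :=
  (congrArg (tensorSection F G V).hom (TensorProduct.add_tmul s s' t)).trans
    (map_add (tensorSection F G V).hom _ _)

lemma tmul_add_right {V : Opens Y} (s : F.obj.obj (op V)) (t t' : G.obj.obj (op V)) :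
    tmul s (t + t') = tmul s t + tmul s t' :=
  (congrArg (tensorSection F G V).hom (TensorProduct.tmul_add s t t')).trans
    (map_add (tensorSection F G V).hom _ _)

lemma tmul_map {V W : Opens Y} (i : V ⟶ W) (s : F.obj.obj (op W)) (t : G.obj.obj (op W)) :
    (tensor F G).obj.map i.op (tmul s t) = tmul (F.obj.map i.op s) (G.obj.map i.op t) :=
  tensorSection_map F G i s t

lemma germs_tmul_congr {V V' : Opens Y} {s : F.obj.obj (op V)} {t : G.obj.obj (op V)}
    {s' : F.obj.obj (op V')} {t' : G.obj.obj (op V')} {y : Y} (hV : y ∈ V) (hV' : y ∈ V')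
    (hs : germs F s y = germs F s' y) (ht : germs G t y = germs G t' y) :
    germs (tensor F G) (tmul s t) y = germs (tensor F G) (tmul s' t') y := by
  rw [germs_of_mem F s hV, germs_of_mem F s' hV'] at hs
  rw [germs_of_mem G t hV, germs_of_mem G t' hV'] at ht
  obtain ⟨W₁, h₁, i₁, j₁, e₁⟩ := TopCat.Presheaf.germ_eq F.obj y hV hV' s s' hs
  obtain ⟨W₂, h₂, i₂, j₂, e₂⟩ := TopCat.Presheaf.germ_eq G.obj y hV hV' t t' ht
  let W := W₁ ⊓ W₂
  let k₁ : W ⟶ W₁ := Opens.infLELeft W₁ W₂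
  let k₂ : W ⟶ W₂ := Opens.infLERight W₁ W₂
  have hW : y ∈ W := ⟨h₁, h₂⟩
  have e₁' : F.obj.map (k₁ ≫ i₁).op s = F.obj.map (k₁ ≫ j₁).op s' := by
    rw [op_comp, op_comp, F.obj.map_comp, F.obj.map_comp]
    exact congrArg (F.obj.map k₁.op) e₁
  have e₂' : G.obj.map (k₁ ≫ i₁).op t = G.obj.map (k₁ ≫ j₁).op t' := by
    rw [Subsingleton.elim (k₁ ≫ i₁) (k₂ ≫ i₂), Subsingleton.elim (k₁ ≫ j₁) (k₂ ≫ j₂), op_comp,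
      op_comp, G.obj.map_comp, G.obj.map_comp]
    exact congrArg (G.obj.map k₂.op) e₂
  rw [← germs_map _ (k₁ ≫ i₁) _ hW, ← germs_map _ (k₁ ≫ j₁) _ hW, tmul_map, tmul_map, e₁', e₂']

lemma exists_germs_eq_pair {y : Y} (a : Stalk F y) (b : Stalk G y) :
    ∃ (V : Opens Y) (_ : y ∈ V) (s : F.obj.obj (op V)) (t : G.obj.obj (op V)),
      germs F s y = a ∧ germs G t y = b := by
  obtain ⟨V, hV, s, rfl⟩ := exists_germs_eq_stalk F a
  obtain ⟨V', hV', t, rfl⟩ := exists_germs_eq_stalk G b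
  have h : y ∈ V ⊓ V' := ⟨hV, hV'⟩
  exact ⟨V ⊓ V', h, F.obj.map (Opens.infLELeft V V').op s, G.obj.map (Opens.infLERight V V').op t,
    germs_map _ _ _ h, germs_map _ _ _ h⟩

/-- The product `F_y × G_y → (F ⊗ G)_y`. -/
def stalkMul (y : Y) (a : Stalk F y) (b : Stalk G y) : Stalk (tensor F G) y :=
  germs (tensor F G) (tmul (exists_germs_eq_pair F G a b).choose_spec.choose_spec.choose
    (exists_germs_eq_pair F G a b).choose_spec.choose_spec.choose_spec.choose) y

lemma stalkMul_germs {V : Opens Y} (s : F.obj.obj (op V)) (t : G.obj.obj (op V)) {y : Y}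
    (hy : y ∈ V) :
    stalkMul F G y (germs F s y) (germs G t y) = germs (tensor F G) (tmul s t) y :=
  germs_tmul_congr F G (exists_germs_eq_pair F G _ _).choose_spec.choose hy
    (exists_germs_eq_pair F G _ _).choose_spec.choose_spec.choose_spec.choose_spec.1
    (exists_germs_eq_pair F G _ _).choose_spec.choose_spec.choose_spec.choose_spec.2

lemma stalkMul_add_left (y : Y) (a a' : Stalk F y) (b : Stalk G y) :
    stalkMul F G y (a + a') b = stalkMul F G y a b + stalkMul F G y a' b := by
  obtain ⟨V, hV, s, t, rfl, rfl⟩ := exists_germs_eq_pair F G a b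
  obtain ⟨V', hV', s', t', rfl, e⟩ := exists_germs_eq_pair F G a' (germs G t y)
  obtain ⟨W, hW, i, j, e'⟩ := TopCat.Presheaf.germ_eq G.obj y hV hV' t t' (by
    rw [← germs_of_mem, ← germs_of_mem, e])
  rw [← germs_map F i s hW, ← germs_map F j s' hW, ← germs_map G i t hW, ← germs_add,
    stalkMul_germs _ _ _ _ hW, stalkMul_germs _ _ _ _ hW, stalkMul_germs _ _ _ _ hW, ← germs_add,
    tmul_add_left]

lemma stalkMul_add_right (y : Y) (a : Stalk F y) (b b' : Stalk G y) :
    stalkMul F G y a (b + b') = stalkMul F G y a b + stalkMul F G y a b' := by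
  obtain ⟨V, hV, s, t, rfl, rfl⟩ := exists_germs_eq_pair F G a b
  obtain ⟨V', hV', s', t', e, rfl⟩ := exists_germs_eq_pair F G (germs F s y) b'
  obtain ⟨W, hW, i, j, e'⟩ := TopCat.Presheaf.germ_eq F.obj y hV hV' s s' (by
    rw [← germs_of_mem, ← germs_of_mem, e])
  rw [← germs_map F i s hW, ← germs_map G i t hW, ← germs_map G j t' hW, ← germs_add,
    stalkMul_germs _ _ _ _ hW, stalkMul_germs _ _ _ _ hW, stalkMul_germs _ _ _ _ hW, ← germs_add,
    tmul_add_right]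

/-- The homomorphism `F_y ⊗ G_y → (F ⊗ G)_y`. -/
def stalkTensorHom (y : Y) : (Stalk F y ⊗[ℤ] Stalk G y) →+ Stalk (tensor F G) y :=
  TensorProduct.liftAddHom
    (AddMonoidHom.mk' (fun a => AddMonoidHom.mk' (stalkMul F G y a) (stalkMul_add_right F G y a))
      fun a a' => by
        ext b
        exact stalkMul_add_left F G y a a' b)
    (fun r a b => by
      change stalkMul F G y (r • a) b = stalkMul F G y a (r • b)
      let φ : Stalk F y →+ Stalk (tensor F G) y :=
        AddMonoidHom.mk' (fun a => stalkMul F G y a b) fun a a' => stalkMul_add_left F G y a a' b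
      let ψ : Stalk G y →+ Stalk (tensor F G) y :=
        AddMonoidHom.mk' (stalkMul F G y a) (stalkMul_add_right F G y a)
      exact (map_zsmul φ r a).trans (map_zsmul ψ r b).symm)

lemma stalkTensorHom_tmul {V : Opens Y} (s : F.obj.obj (op V)) (t : G.obj.obj (op V)) {y : Y}
    (hy : y ∈ V) :
    stalkTensorHom F G y (germs F s y ⊗ₜ germs G t y) = germs (tensor F G) (tmul s t) y :=
  stalkMul_germs F G s t hy

/-- The sections `s ⊗ t` do not generate the sections of the sheafification, but by its universal
property they detect morphisms. -/
lemma tensor_hom_ext_of_tmul {H : Sh Y} {φ ψ : tensor F G ⟶ H}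
    (h : ∀ (V : Opens Y) (s : F.obj.obj (op V)) (t : G.obj.obj (op V)),
      φ.hom.app (op V) (tmul s t) = ψ.hom.app (op V) (tmul s t)) : φ = ψ := by
  apply ((sheafificationAdjunction (Opens.grothendieckTopology Y)
    AddCommGrpCat.{u}).homEquiv _ _).injective
  refine (Adjunction.homEquiv_unit ..).trans (Eq.trans ?_ (Adjunction.homEquiv_unit ..).symm)
  exact NatTrans.ext (funext fun V => tensorAb_hom_ext fun s t => h V.unop s t)

/-- The morphism from the tensor product to families of elements of `F_y ⊗ G_y`. -/
def tensorToFamily :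
    tensor F G ⟶ family (fun y => AddCommGrpCat.of (Stalk F y ⊗[ℤ] Stalk G y)) :=
  ((sheafificationAdjunction (Opens.grothendieckTopology Y) AddCommGrpCat.{u}).homEquiv _ _).symm
    { app V := AddCommGrpCat.ofHom (AddMonoidHom.pi (fun y : V.unop =>
        (TensorProduct.map (((TopCat.Presheaf.germ F.obj V.unop y.1 y.2).hom).toIntLinearMap)
          (((TopCat.Presheaf.germ G.obj V.unop y.1 y.2).hom).toIntLinearMap)).toAddMonoidHom))
      naturality V W i := by
        apply tensorAb_hom_ext
        intro s t
        funext y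
        exact congrArg₂ (fun a b => a ⊗ₜ[ℤ] b)
          (TopCat.Presheaf.germ_res_apply F.obj i.unop y.1 y.2 s)
          (TopCat.Presheaf.germ_res_apply G.obj i.unop y.1 y.2 t) }

lemma tensorToFamily_app {V : Opens Y} (s : F.obj.obj (op V)) (t : G.obj.obj (op V)) (y : V) :
    ((tensorToFamily F G).hom.app (op V) (tmul s t) : ∀ z : V, Stalk F z.1 ⊗[ℤ] Stalk G z.1) y =
      germs F s y ⊗ₜ germs G t y := by
  have h := Adjunction.homEquiv_unit (adj := sheafificationAdjunction
    (Opens.grothendieckTopology Y) AddCommGrpCat.{u}) (f := tensorToFamily F G)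
  rw [tensorToFamily, Equiv.apply_symm_apply] at h
  have h' := congrFun (ConcreteCategory.congr_hom (NatTrans.congr_app h (op V)) (s ⊗ₜ[ℤ] t)) y
  refine h'.symm.trans ?_
  rw [germs_of_mem F s y.2, germs_of_mem G t y.2]
  rfl

lemma stalkLift_stalkTensorHom (y : Y) (z : Stalk F y ⊗[ℤ] Stalk G y) :
    stalkLift (tensorToFamily F G) y (stalkTensorHom F G y z) = z := by
  induction z using TensorProduct.induction_on with
  | zero => rw [map_zero, map_zero]
  | add z z' h h' => rw [map_add, map_add, h, h']
  | tmul a b =>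
    obtain ⟨V, hV, s, t, rfl, rfl⟩ := exists_germs_eq_pair F G a b
    rw [stalkTensorHom_tmul _ _ _ _ hV, stalkLift_germs _ _ hV]
    exact tensorToFamily_app F G s t ⟨y, hV⟩

/-- Comparison with the sheaf of families of elements of the groups F_y ⊗ G_y gives a left inverse.
The morphism to families of elements of the cokernels kills every `s ⊗ t`, hence is zero, which
gives surjectivity. -/
lemma stalkTensorHom_bijective (y : Y) : Function.Bijective (stalkTensorHom F G y) := by
  refine ⟨Function.LeftInverse.injective (stalkLift_stalkTensorHom F G y), ?_⟩
  refine surjective_of_toFamily_eq_zero (stalkTensorHom F G) ?_ y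
  refine tensor_hom_ext_of_tmul F G fun V s t => funext fun z => ?_
  exact (QuotientAddGroup.eq_zero_iff _).2 ⟨_, stalkTensorHom_tmul F G s t z.2⟩

end Tensor

/-! ### Stalks of inverse images -/

section Pullback

variable {Y X : TopCat.{u}} (f : Y ⟶ X) (G : Sh X)

/-- The homomorphism `G_{f y} → (f^* G)_y`. -/
def stalkPullbackHom (y : Y) : Stalk G (f y) →+ Stalk ((inverseImage f).obj G) y :=
  ((TopCat.Presheaf.stalkFunctor AddCommGrpCat.{u} (f y)).map
    ((TopCat.Sheaf.pullbackPushforwardAdjunction AddCommGrpCat.{u} f).unit.app G).hom ≫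
      TopCat.Presheaf.stalkPushforward AddCommGrpCat.{u} f ((inverseImage f).obj G).obj y).hom

lemma stalkPullbackHom_germs {U : Opens X} (t : G.obj.obj (op U)) {y : Y} (hy : f y ∈ U) :
    stalkPullbackHom f G y (germs G t (f y)) =
      germs ((inverseImage f).obj G) ((pullbackSection f G U).hom t) y := by
  rw [germs_of_mem G t hy, germs_of_mem _ _ (V := (Opens.map f).obj U) hy]
  refine (congrArg (TopCat.Presheaf.stalkPushforward AddCommGrpCat.{u} f
    ((inverseImage f).obj G).obj y).hom (TopCat.Presheaf.stalkFunctor_map_germ_apply U (f y) hy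
      ((TopCat.Sheaf.pullbackPushforwardAdjunction AddCommGrpCat.{u} f).unit.app G).hom t)).trans ?_
  exact ConcreteCategory.congr_hom (TopCat.Presheaf.stalkPushforward_germ AddCommGrpCat.{u} f
    ((inverseImage f).obj G).obj U y hy) _

lemma inverseImage_hom_ext {H : Sh Y} {φ ψ : (inverseImage f).obj G ⟶ H}
    (h : ∀ (U : Opens X) (t : G.obj.obj (op U)),
      φ.hom.app (op ((Opens.map f).obj U)) ((pullbackSection f G U).hom t) =
        ψ.hom.app (op ((Opens.map f).obj U)) ((pullbackSection f G U).hom t)) : φ = ψ := by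
  apply ((TopCat.Sheaf.pullbackPushforwardAdjunction AddCommGrpCat.{u} f).homEquiv _ _).injective
  refine (Adjunction.homEquiv_unit ..).trans (Eq.trans ?_ (Adjunction.homEquiv_unit ..).symm)
  apply InducedCategory.hom_ext
  refine NatTrans.ext (funext fun U => ?_)
  ext t
  exact h U.unop t

/-- The morphism from `G` to families of elements of `G_{f y}`. -/
def toPushforwardFamily :
    G ⟶ (TopCat.Sheaf.pushforward AddCommGrpCat.{u} f).obj (family (fun y => Stalk G (f y))) := ⟨
  { app U := AddCommGrpCat.ofHom
      { toFun t y := germs G (V := U.unop) t (f y.1)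
        map_zero' := funext fun y => germs_zero G _
        map_add' t t' := funext fun y => germs_add G (V := U.unop) t t' _ }
    naturality U V i := by
      ext t
      funext y
      exact germs_map G i.unop t y.2 }⟩

/-- The morphism from the inverse image to families of elements of `G_{f y}`. -/
def inverseImageToFamily : (inverseImage f).obj G ⟶ family (fun y => Stalk G (f y)) :=
  ((TopCat.Sheaf.pullbackPushforwardAdjunction AddCommGrpCat.{u} f).homEquiv _ _).symm
    (toPushforwardFamily f G)

lemma inverseImageToFamily_app {U : Opens X} (t : G.obj.obj (op U)) (y : (Opens.map f).obj U) :
    ((inverseImageToFamily f G).hom.app (op ((Opens.map f).obj U))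
      ((pullbackSection f G U).hom t) : ∀ z : (Opens.map f).obj U, Stalk G (f z.1)) y =
      germs G t (f y.1) := by
  have h := (Equiv.apply_symm_apply _ _).symm.trans (Adjunction.homEquiv_unit
    (adj := TopCat.Sheaf.pullbackPushforwardAdjunction AddCommGrpCat.{u} f)
    (f := inverseImageToFamily f G))
  exact (congrFun (ConcreteCategory.congr_hom (NatTrans.congr_app
    (congrArg (fun φ => φ.hom) h) (op U)) t) y).symm

/-- The same two comparisons with sheaves of families as for tensor products, with pulled back
sections in place of the sections `s ⊗ t`. -/
lemma stalkPullbackHom_bijective (y : Y) : Function.Bijective (stalkPullbackHom f G y) := by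
  constructor
  · refine Function.LeftInverse.injective (g := stalkLift (inverseImageToFamily f G) y) fun a => ?_
    obtain ⟨U, hU, t, rfl⟩ := exists_germs_eq_stalk G a
    rw [stalkPullbackHom_germs f G t hU, stalkLift_germs _ _ (V := (Opens.map f).obj U) hU]
    exact inverseImageToFamily_app f G t ⟨y, hU⟩
  · refine surjective_of_toFamily_eq_zero (B := fun y => Stalk G (f y))
      (stalkPullbackHom f G) ?_ y
    refine inverseImage_hom_ext f G fun U t => funext fun z => ?_
    exact (QuotientAddGroup.eq_zero_iff _).2 ⟨_, stalkPullbackHom_germs f G t z.2⟩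

end Pullback

end ProperImage

namespace ProperImage

open scoped TensorProduct

/-! ### Tensors with a flat module that vanish on a compact set -/

section FlatTensor

variable {Γ M : Type*} [AddCommGroup Γ] [AddCommGroup M] [Module.Flat ℤ M]

/-- Flatness of `M` keeps the sequence from the kernel to `Γ` to `N` exact after tensoring. -/
lemma exists_rTensor_ker_eq {N : Type*} [AddCommGroup N] (r : Γ →ₗ[ℤ] N) (z : Γ ⊗[ℤ] M)
    (hz : r.rTensor M z = 0) :
    ∃ w : (LinearMap.ker r) ⊗[ℤ] M, (LinearMap.ker r).subtype.rTensor M w = z :=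
  (Module.Flat.rTensor_exact M (f := (LinearMap.ker r).subtype) (g := r)
    (LinearMap.exact_subtype_ker_map r) z).1 hz

/-- The intersection is the kernel of the map from Γ to (Γ / S) × (Γ / S'), and tensoring commutes
with binary products. -/
lemma exists_rTensor_inf_eq {S S' : Submodule ℤ Γ} {z : Γ ⊗[ℤ] M}
    (hz : ∃ w : S ⊗[ℤ] M, S.subtype.rTensor M w = z)
    (hz' : ∃ w : S' ⊗[ℤ] M, S'.subtype.rTensor M w = z) :
    ∃ w : (S ⊓ S' : Submodule ℤ Γ) ⊗[ℤ] M, (S ⊓ S').subtype.rTensor M w = z := by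
  have key : ∀ T : Submodule ℤ Γ, (∃ w : T ⊗[ℤ] M, T.subtype.rTensor M w = z) →
      T.mkQ.rTensor M z = 0 := by
    rintro T ⟨w, rfl⟩
    rw [← LinearMap.comp_apply, ← LinearMap.rTensor_comp]
    have : T.mkQ ∘ₗ T.subtype = 0 := by
      ext a
      simp
    rw [this, LinearMap.rTensor_zero, LinearMap.zero_apply]
  let r : Γ →ₗ[ℤ] (Γ ⧸ S) × (Γ ⧸ S') := S.mkQ.prod S'.mkQ
  have hr : LinearMap.ker r = S ⊓ S' := by
    simp [r, LinearMap.ker_prod]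
  rw [← hr]
  refine exists_rTensor_ker_eq r z ?_
  apply (TensorProduct.prodLeft ℤ ℤ (Γ ⧸ S) (Γ ⧸ S') M).injective
  have : ∀ z : Γ ⊗[ℤ] M, TensorProduct.prodLeft ℤ ℤ (Γ ⧸ S) (Γ ⧸ S') M (r.rTensor M z) =
      (S.mkQ.rTensor M z, S'.mkQ.rTensor M z) := by
    intro z
    induction z using TensorProduct.induction_on with
    | zero => simp only [map_zero]; rfl
    | tmul a b => simp [r]
    | add z z' h h' => rw [map_add, map_add, h, h', map_add, map_add]; rfl
  rw [this, key S hz, key S' hz', map_zero]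
  rfl

/-- A tensor which vanishes at the points of a compact set comes from elements which vanish at
the points of this set, provided the vanishing of an element at a point is a local property. -/
lemma exists_rTensor_vanishing_eq {Y : Type*} [TopologicalSpace Y] {N : Y → Type*}
    [∀ y, AddCommGroup (N y)] (r : ∀ y, Γ →ₗ[ℤ] N y) {B : Set Y} (hB : IsCompact B)
    (hr : ∀ y ∈ B, ∀ c : Γ, r y c = 0 → ∀ᶠ y' in 𝓝[B] y, r y' c = 0) {z : Γ ⊗[ℤ] M}
    (hz : ∀ y ∈ B, (r y).rTensor M z = 0) :
    ∃ S : Submodule ℤ Γ, (∀ c ∈ S, ∀ y ∈ B, r y c = 0) ∧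
      ∃ w : S ⊗[ℤ] M, S.subtype.rTensor M w = z := by
  suffices h : ∃ S : Submodule ℤ Γ, (∀ c ∈ S, ∀ y ∈ B ∩ B, r y c = 0) ∧
      ∃ w : S ⊗[ℤ] M, S.subtype.rTensor M w = z by
    rwa [Set.inter_self] at h
  -- Over the empty set all of `Γ` will do, and unions of sets correspond to intersections of
  -- submodules. Near one point, the tensor comes from the kernel of evaluation and involves
  -- finitely many elements, each of which keeps vanishing nearby.
  refine hB.induction_on (p := fun T => ∃ S : Submodule ℤ Γ, (∀ c ∈ S, ∀ y ∈ T ∩ B, r y c = 0) ∧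
      ∃ w : S ⊗[ℤ] M, S.subtype.rTensor M w = z) ?_ ?_ ?_ ?_
  · refine ⟨⊤, by simp, TensorProduct.map (Submodule.topEquiv (R := ℤ) (M := Γ)).symm.toLinearMap LinearMap.id z, ?_⟩
    rw [LinearMap.rTensor, ← LinearMap.comp_apply, ← TensorProduct.map_comp]
    exact LinearMap.congr_fun (TensorProduct.map_id (R := ℤ) (M := Γ) (N := M)) z
  · rintro T T' hT ⟨S, h, hw⟩
    exact ⟨S, fun c hc y hy => h c hc y ⟨hT hy.1, hy.2⟩, hw⟩
  · rintro T T' ⟨S, h, hw⟩ ⟨S', h', hw'⟩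
    refine ⟨S ⊓ S', ?_, exists_rTensor_inf_eq hw hw'⟩
    rintro c ⟨hc, hc'⟩ y ⟨hy | hy, hyB⟩
    · exact h c hc y ⟨hy, hyB⟩
    · exact h' c hc' y ⟨hy, hyB⟩
  · intro y hy
    obtain ⟨w, hw⟩ := exists_rTensor_ker_eq (r y) z (hz y hy)
    suffices h : ∀ w : (LinearMap.ker (r y)) ⊗[ℤ] M, ∃ T ∈ 𝓝[B] y, ∃ S : Submodule ℤ Γ,
        (∀ c ∈ S, ∀ y ∈ T ∩ B, r y c = 0) ∧ ∃ w' : S ⊗[ℤ] M, S.subtype.rTensor M w' =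
          (LinearMap.ker (r y)).subtype.rTensor M w by
      obtain ⟨T, hT, S, h, w', hw'⟩ := h w
      exact ⟨T, hT, S, h, w', hw'.trans hw⟩
    clear w hw hz
    intro w
    induction w using TensorProduct.induction_on with
    | zero => exact ⟨Set.univ, Filter.univ_mem, ⊥, by simp, 0, by simp⟩
    | tmul a b =>
      refine ⟨_, hr y hy a.1 a.2, Submodule.span ℤ {a.1}, ?_,
        ⟨a.1, Submodule.mem_span_singleton_self _⟩ ⊗ₜ b, by simp⟩
      intro c hc y' hy'
      obtain ⟨n, rfl⟩ := Submodule.mem_span_singleton.1 hc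
      rw [map_smul, show r y' a.1 = 0 from hy'.1, smul_zero]
    | add w w' h h' =>
      obtain ⟨T, hT, S, h, v, hv⟩ := h
      obtain ⟨T', hT', S', h', v', hv'⟩ := h'
      have hle : S ⊔ S' ≤ ⨅ y' ∈ T ∩ T' ∩ B, LinearMap.ker (r y') := by
        refine sup_le ?_ ?_
        · intro c hc
          simp only [Submodule.mem_iInf, LinearMap.mem_ker]
          exact fun y' hy' => h c hc y' ⟨hy'.1.1, hy'.2⟩
        · intro c hc
          simp only [Submodule.mem_iInf, LinearMap.mem_ker]
          exact fun y' hy' => h' c hc y' ⟨hy'.1.2, hy'.2⟩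
      refine ⟨T ∩ T', Filter.inter_mem hT hT', S ⊔ S', fun c hc y' hy' => ?_,
        (Submodule.inclusion le_sup_left).rTensor M v +
          (Submodule.inclusion le_sup_right).rTensor M v', ?_⟩
      · have := hle hc
        simp only [Submodule.mem_iInf, LinearMap.mem_ker] at this
        exact this y' hy'
      · rw [map_add, map_add, ← hv, ← hv', ← LinearMap.comp_apply, ← LinearMap.comp_apply,
          ← LinearMap.rTensor_comp, ← LinearMap.rTensor_comp, Submodule.subtype_comp_inclusion,
          Submodule.subtype_comp_inclusion]

end FlatTensor

/-! ### Stalks of the proper direct image as compactly supported sections on fibres -/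

section FiberMaps

variable {Y X : TopCat.{u}} (f : Y ⟶ X)

open scoped Classical in
/-- Pullback of germs of `G` at `x` to the points of the fibre of `x`. -/
def pullbackGerm (G : Sh X) (x : X) : Stalk G x →+ (∀ y : Y, Stalk ((inverseImage f).obj G) y) :=
  stalkLift (A := fun x => AddCommGrpCat.of (∀ y : Y, Stalk ((inverseImage f).obj G) y)) ⟨
    { app U := AddCommGrpCat.ofHom
        { toFun t x y := if f y = x.1 then
            germs ((inverseImage f).obj G) ((pullbackSection f G U.unop).hom t) y else 0
          map_zero' := by
            funext x y
            rw [map_zero, germs_zero, ite_self]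
            rfl
          map_add' t t' := by
            funext x y
            exact (congrArg (fun a => if f y = x.1 then a else 0) ((congrArg (fun t =>
              germs ((inverseImage f).obj G) t y) (map_add (pullbackSection f G U.unop).hom t t')).trans
                (germs_add _ _ _ y))).trans ite_add_zero }
      naturality U V i := by
        ext t
        funext x y
        by_cases h : f y = x.1
        · refine (if_pos h).trans (Eq.trans ?_ (if_pos h).symm)
          have hy : y ∈ (Opens.map f).obj V.unop := by
            change f y ∈ V.unop
            rw [h]
            exact x.2
          refine Eq.trans ?_ (germs_map ((inverseImage f).obj G) ((Opens.map f).map i.unop)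
            ((pullbackSection f G U.unop).hom t) hy)
          exact congrArg (fun t => germs ((inverseImage f).obj G) t y)
            (ConcreteCategory.congr_hom (((TopCat.Sheaf.pullbackPushforwardAdjunction
              AddCommGrpCat.{u} f).unit.app G).hom.naturality i) t)
        · exact (if_neg h).trans (if_neg h).symm }⟩ x

lemma pullbackGerm_germs (G : Sh X) {U : Opens X} (t : G.obj.obj (op U)) {x : X} (hx : x ∈ U)
    {y : Y} (hy : f y = x) : pullbackGerm f G x (germs G t x) y =
      germs ((inverseImage f).obj G) ((pullbackSection f G U).hom t) y :=
  (congrFun (stalkLift_germs _ t hx) y).trans (if_pos hy)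

lemma pullbackGerm_bijective (G : Sh X) {x : X} {y : Y} (hy : f y = x) :
    Function.Bijective fun m => pullbackGerm f G x m y := by
  subst hy
  convert stalkPullbackHom_bijective f G y using 1
  funext m
  obtain ⟨U, hU, t, rfl⟩ := exists_germs_eq_stalk G m
  rw [pullbackGerm_germs f G t hU rfl, stalkPullbackHom_germs f G t hU]

open scoped Classical in
/-- The family of germs at the points of the fibre of `x` of a germ of `f_! F` at `x`. -/
def fiberGerms (F : Sh Y) (x : X) : Stalk ((properImage f).obj F) x →+ (∀ y : Y, Stalk F y) :=
  stalkLift (F := (properImage f).obj F) (A := fun x => AddCommGrpCat.of (∀ y : Y, Stalk F y)) ⟨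
    { app U := AddCommGrpCat.ofHom
        { toFun t x y := if f y = x.1 then germs F
            (t : properSections f F U.unop).1 y else 0
          map_zero' := by
            funext x y
            exact (congrArg (fun a => if f y = x.1 then a else 0) (germs_zero F y)).trans (ite_self _)
          map_add' t t' := by
            funext x y
            exact (congrArg (fun a => if f y = x.1 then a else 0)
              (germs_add F (V := (Opens.map f).obj U.unop) _ _ y)).trans ite_add_zero }
      naturality U V i := by
        ext t
        funext x y
        by_cases h : f y = x.1
        · refine (if_pos h).trans (Eq.trans ?_ (if_pos h).symm)
          have hy : y ∈ (Opens.map f).obj V.unop := by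
            change f y ∈ V.unop
            rw [h]
            exact x.2
          exact germs_map F ((Opens.map f).map i.unop) _ hy
        · exact (if_neg h).trans (if_neg h).symm }⟩ x

lemma fiberGerms_germs (F : Sh Y) {U : Opens X} (t : properSections f F U) {x : X} (hx : x ∈ U)
    {y : Y} (hy : f y = x) :
    fiberGerms f F x (germs ((properImage f).obj F) (V := U) t x) y = germs F t.1 y :=
  (congrFun (stalkLift_germs (F := (properImage f).obj F) (V := U) _ t hx) y).trans (if_pos hy)

variable {f}

lemma isCompactSec_fiberGerms (F : Sh Y) {x : X} (a : Stalk ((properImage f).obj F) x) :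
    IsCompactSec f F x (fiberGerms f F x a) := by
  obtain ⟨U, hU, t, rfl⟩ := exists_germs_eq_stalk ((properImage f).obj F) a
  obtain ⟨h, K, hK, hKx, h0⟩ := isCompactSec_germs hU (F := F) (t := (t : properSections f F U).1)
    (t : properSections f F U).2
  refine ⟨h.congr fun y hy => (fiberGerms_germs f F t hU hy).symm, K, hK, hKx, fun y hy hn => ?_⟩
  exact (fiberGerms_germs f F t hU hy).trans (h0 y hy hn)

/-- Together with `IsCompactSec.exists_fiberGerms_eq` this identifies the stalk of f_(!) F at `x`
with the compactly supported sections over the fibre. -/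
lemma fiberGerms_eq_zero (F : Sh Y) {x : X} {a : Stalk ((properImage f).obj F) x}
    (h : ∀ y, f y = x → fiberGerms f F x a y = 0) : a = 0 := by
  obtain ⟨U, hU, t, rfl⟩ := exists_germs_eq_stalk ((properImage f).obj F) a
  obtain ⟨U', hU', i, e⟩ := exists_germs_eq_zero_of_fiber hU (t : properSections f F U).2
    fun y hy => (fiberGerms_germs f F t hU hy).symm.trans (h y hy)
  refine (germs_map ((properImage f).obj F) i t hU').symm.trans ?_
  rw [show ((properImage f).obj F).obj.map i.op t = 0 from Subtype.ext e, germs_zero]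

lemma IsCompactSec.exists_fiberGerms_eq (hsep : IsSeparatedMap f) (hlp : IsLocallyProper f)
    {F : Sh Y} {x : X} {s : ∀ y : Y, Stalk F y} (hs : IsCompactSec f F x s) :
    ∃ a, ∀ y, f y = x → fiberGerms f F x a y = s y := by
  obtain ⟨U, hU, t, ht, e⟩ := hs.exists_properSections hsep hlp
  exact ⟨germs ((properImage f).obj F) (V := U) (⟨t, ht⟩ : properSections f F U) x, fun y hy =>
    (fiberGerms_germs f F ⟨t, ht⟩ hU hy).trans (e y hy)⟩

end FiberMaps

end ProperImage

namespace ProperImage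

open scoped TensorProduct

/-- A sheaf is flat if its stalks are flat. -/
def IsFlat {X : TopCat.{u}} (G : Sh X) : Prop := ∀ x : X, Module.Flat ℤ (Stalk G x)

/-! ### Sections over a fibre of a soft sheaf tensored with a flat one -/

section Fiber

variable {Y X : TopCat.{u}} {f : Y ⟶ X} {F : Sh Y} {G : Sh X} {x : X}

variable (f F x) in
/-- The sections over the fibre of `x` with compact support. -/
def compactSections : Submodule ℤ (∀ y : Y, Stalk F y) :=
  AddSubgroup.toIntSubmodule
    { carrier := {s | IsCompactSec f F x s}
      zero_mem' := ⟨IsSec.zero, ∅, isCompact_empty, Set.empty_subset _, fun _ _ _ => rfl⟩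
      add_mem' := by
        rintro s s' ⟨h, K, hK, hKx, h0⟩ ⟨h', K', hK', hKx', h0'⟩
        refine ⟨h.add h', K ∪ K', hK.union hK', Set.union_subset hKx hKx', fun y hy hn => ?_⟩
        change s y + s' y = 0
        rw [h0 y hy fun h => hn (Or.inl h), h0' y hy fun h => hn (Or.inr h), add_zero]
      neg_mem' := by
        rintro s ⟨h, K, hK, hKx, h0⟩
        refine ⟨h.neg, K, hK, hKx, fun y hy hn => ?_⟩
        change - s y = 0
        rw [h0 y hy hn, neg_zero] }

variable (f F G x) in
/-- The homomorphism `F_y ⊗ G_x → (F ⊗ f^* G)_y`. -/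
def fiberTensor (y : Y) :
    (Stalk F y ⊗[ℤ] Stalk G x) →+ Stalk (tensor F ((inverseImage f).obj G)) y :=
  (stalkTensorHom F ((inverseImage f).obj G) y).comp
    (TensorProduct.map LinearMap.id
      ((Pi.evalAddMonoidHom (fun y : Y => Stalk ((inverseImage f).obj G) y) y).comp
        (pullbackGerm f G x)).toIntLinearMap).toAddMonoidHom

lemma fiberTensor_tmul {V : Opens Y} {U : Opens X} (hV : V ≤ (Opens.map f).obj U)
    (s : F.obj.obj (op V)) (t : G.obj.obj (op U)) (hx : x ∈ U) {y : Y} (hy : f y = x)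
    (hyV : y ∈ V) : fiberTensor f F G x y (germs F s y ⊗ₜ germs G t x) =
      germs (tensor F ((inverseImage f).obj G)) (tmul s (((inverseImage f).obj G).obj.map
        (homOfLE hV).op ((pullbackSection f G U).hom t))) y := by
  rw [← stalkTensorHom_tmul _ _ _ _ hyV, germs_map _ _ _ hyV, ← pullbackGerm_germs f G t hx hy]
  rfl

lemma fiberTensor_bijective {y : Y} (hy : f y = x) :
    Function.Bijective (fiberTensor f F G x y) := by
  refine (stalkTensorHom_bijective F ((inverseImage f).obj G) y).comp ?_
  exact (TensorProduct.congr (LinearEquiv.refl ℤ (Stalk F y)) (LinearEquiv.ofBijective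
    ((Pi.evalAddMonoidHom (fun y : Y => Stalk ((inverseImage f).obj G) y) y).comp
        (pullbackGerm f G x)).toIntLinearMap (pullbackGerm_bijective f G hy))).bijective

variable (f F x) in
/-- The value at a point of a section over the fibre with compact support. -/
def evalCompact (y : Y) : compactSections f F x →ₗ[ℤ] Stalk F y :=
  (LinearMap.proj y).comp (compactSections f F x).subtype

/-- For a pure tensor of `s` with the germ of `t`, a local representative of `s` multiplied by the
pullback of `t` is a local representative of the family. -/
lemma isCompactSec_fiberTensor (z : (compactSections f F x) ⊗[ℤ] Stalk G x) :
    IsCompactSec f (tensor F ((inverseImage f).obj G)) x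
      (fun y => fiberTensor f F G x y ((evalCompact f F x y).rTensor _ z)) := by
  change _ ∈ compactSections f (tensor F ((inverseImage f).obj G)) x
  induction z using TensorProduct.induction_on with
  | zero =>
    convert (compactSections f (tensor F ((inverseImage f).obj G)) x).zero_mem using 1
    funext y
    rw [map_zero, map_zero]
    rfl
  | add z z' h h' =>
    convert (compactSections f (tensor F ((inverseImage f).obj G)) x).add_mem h h' using 1
    funext y
    rw [map_add, map_add]
    rfl
  | tmul s m =>
    obtain ⟨U, hU, t, rfl⟩ := exists_germs_eq_stalk G m
    obtain ⟨s, hs, K, hK, hKx, h0⟩ := s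
    refine ⟨fun y hy => ?_, K, hK, hKx, fun y hy hn => ?_⟩
    · obtain ⟨V, hV, s', e⟩ := hs y hy
      have hy' : y ∈ (Opens.map f).obj U := by
        change f y ∈ U
        rwa [show f y = x from hy]
      let W := V ⊓ (Opens.map f).obj U
      refine ⟨W, ⟨hV, hy'⟩, tmul (F.obj.map (Opens.infLELeft V _).op s')
        (((inverseImage f).obj G).obj.map (homOfLE inf_le_right).op
          ((pullbackSection f G U).hom t)), ?_⟩
      filter_upwards [e, self_mem_nhdsWithin,
        mem_nhdsWithin_of_mem_nhds (W.isOpen.mem_nhds ⟨hV, hy'⟩)] with z h₁ h₂ h₃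
      refine (fiberTensor_tmul inf_le_right _ t hU h₂ h₃).symm.trans ?_
      rw [germs_map _ _ _ h₃, h₁]
      rfl
    · change fiberTensor f F G x y (s y ⊗ₜ _) = 0
      rw [h0 y hy hn, TensorProduct.zero_tmul, map_zero]

lemma eventually_evalCompact_eq_zero {B : Set Y} (hB : B ⊆ f ⁻¹' {x}) {y : Y} (hy : y ∈ B)
    (c : compactSections f F x) (hc : evalCompact f F x y c = 0) :
    ∀ᶠ y' in 𝓝[B] y, evalCompact f F x y' c = 0 :=
  (c.2.1.mono hB).eventuallyEq IsSec.zero hy hc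

/-- A tensor of compactly supported sections which vanishes on a compact subset of the fibre
comes from sections which vanish on this subset. -/
lemma exists_vanishing (hG : Module.Flat ℤ (Stalk G x)) {B : Set Y} (hB : IsCompact B)
    (hBx : B ⊆ f ⁻¹' {x}) {z : (compactSections f F x) ⊗[ℤ] Stalk G x}
    (hz : ∀ y ∈ B, fiberTensor f F G x y ((evalCompact f F x y).rTensor _ z) = 0) :
    ∃ S : Submodule ℤ (compactSections f F x), (∀ c ∈ S, ∀ y ∈ B, c.1 y = 0) ∧
      ∃ w : S ⊗[ℤ] Stalk G x, S.subtype.rTensor _ w = z :=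
  exists_rTensor_vanishing_eq (evalCompact f F x) hB
    (fun _ hy c hc => eventually_evalCompact_eq_zero hBx hy c hc)
    fun y hy => (fiberTensor_bijective (hBx hy)).1 ((hz y hy).trans (map_zero _).symm)

/-- If the sections in `S` can be modified to become compactly supported sections subject to
prescribed conditions on the values, then so can tensors of such sections. -/
lemma exists_tensor_modification {S : Submodule ℤ (compactSections f F x)} {ι : Type*}
    (p : ι → Y) (a : ι → ℤ)
    (h : ∀ c ∈ S, ∃ c' : compactSections f F x, ∀ i, c'.1 (p i) = a i • c.1 (p i))
    (w : S ⊗[ℤ] Stalk G x) :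
    ∃ z' : (compactSections f F x) ⊗[ℤ] Stalk G x, ∀ i,
      fiberTensor f F G x (p i) ((evalCompact f F x (p i)).rTensor _ z') =
        a i • fiberTensor f F G x (p i)
          ((evalCompact f F x (p i)).rTensor _ (S.subtype.rTensor _ w)) := by
  induction w using TensorProduct.induction_on with
  | zero => exact ⟨0, fun i => by simp⟩
  | tmul c m =>
    obtain ⟨c', hc'⟩ := h c.1 c.2
    refine ⟨c' ⊗ₜ m, fun i => ?_⟩
    change fiberTensor f F G x (p i) (c'.1 (p i) ⊗ₜ m) =
      a i • fiberTensor f F G x (p i) (c.1.1 (p i) ⊗ₜ m)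
    rw [hc' i, ← map_zsmul, TensorProduct.smul_tmul']
  | add w w' h h' =>
    obtain ⟨z, hz⟩ := h
    obtain ⟨z', hz'⟩ := h'
    exact ⟨z + z', fun i => by simp only [map_add, hz, hz', smul_add]⟩

/-- At a point, `σ` is a tensor because softness makes evaluation of compactly supported sections
surjective onto the stalk. Agreement at a point spreads, and compactness leaves the gluing of
expressions valid on two compact sets. -/
lemma Soft.exists_tensor_eq_of_isCompact (hsep : IsSeparatedMap f) (hlp : IsLocallyProper f)
    (hF : Soft f F) (hG : Module.Flat ℤ (Stalk G x)) {K : Set Y} (hK : IsCompact K)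
    (hKx : K ⊆ f ⁻¹' {x}) {σ : ∀ y : Y, Stalk (tensor F ((inverseImage f).obj G)) y}
    (hσ : IsSec (tensor F ((inverseImage f).obj G)) K σ) :
    ∃ z : (compactSections f F x) ⊗[ℤ] Stalk G x, ∀ y ∈ K,
      fiberTensor f F G x y ((evalCompact f F x y).rTensor _ z) = σ y := by
  classical
  suffices h : ∃ K' : Set Y, IsCompact K' ∧ K' ⊆ K ∧ K ∩ K ⊆ K' ∧
      ∃ z : (compactSections f F x) ⊗[ℤ] Stalk G x, ∀ y ∈ K',
        fiberTensor f F G x y ((evalCompact f F x y).rTensor _ z) = σ y by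
    obtain ⟨K', -, -, hKK', z, e⟩ := h
    rw [Set.inter_self] at hKK'
    exact ⟨z, fun y hy => e y (hKK' hy)⟩
  refine hK.induction_on (p := fun T => ∃ K' : Set Y, IsCompact K' ∧ K' ⊆ K ∧ T ∩ K ⊆ K' ∧
      ∃ z : (compactSections f F x) ⊗[ℤ] Stalk G x, ∀ y ∈ K',
        fiberTensor f F G x y ((evalCompact f F x y).rTensor _ z) = σ y) ?_ ?_ ?_ ?_
  · exact ⟨∅, isCompact_empty, Set.empty_subset _, by simp, 0, by simp⟩
  · rintro T T' hT ⟨K', h₁, h₂, h₃, h₄⟩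
    exact ⟨K', h₁, h₂, (Set.inter_subset_inter_left _ hT).trans h₃, h₄⟩
  · rintro T₁ T₂ ⟨K₁, hK₁, hKK₁, hT₁, z₁, e₁⟩ ⟨K₂, hK₂, hKK₂, hT₂, z₂, e₂⟩
    have hx₁ := hKK₁.trans hKx
    have hx₂ := hKK₂.trans hKx
    -- Only pointwise vanishing of `z₁ - z₂` on the overlap is known; by flatness it comes from
    -- sections that vanish on the overlap, and those can be modified one at a time.
    obtain ⟨S, hS, w, hw⟩ := exists_vanishing hG (z := z₁ - z₂)
      (isCompact_inter_of_fiber hsep hK₁ hx₁ hK₂ hx₂) (Set.inter_subset_left.trans hx₁) (by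
        rintro y ⟨hy₁, hy₂⟩
        rw [map_sub, map_sub, e₁ y hy₁, e₂ y hy₂, sub_self])
    -- A section vanishing on the overlap is replaced by one that is zero on `K₁` and unchanged on
    -- `K₂`, extended by softness. Then `z₁ - z'` equals `z₁` on `K₁` and agrees pointwise with `z₂`
    -- on `K₂`.
    obtain ⟨z', hz'⟩ := exists_tensor_modification (S := S) (ι := (K₁ ∪ K₂ : Set Y))
      (fun y => y.1) (fun y => if y.1 ∈ K₁ then 0 else 1) (fun c hc => by
        obtain ⟨s, hs, es₁, es₂⟩ := isSec_ite_union hsep hK₁ hx₁ hK₂ hx₂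
          (IsSec.zero (F := F)) (c.2.1.mono hx₂) (fun y hy₁ hy₂ => (hS c hc y ⟨hy₁, hy₂⟩).symm)
        obtain ⟨s', hs', es'⟩ := hF x _ s (hK₁.union hK₂) (Set.union_subset hx₁ hx₂) hs
        refine ⟨⟨s', hs'⟩, fun y => (es' _ y.2).trans ?_⟩
        by_cases hy : y.1 ∈ K₁
        · rw [es₁ _ hy, if_pos hy, zero_smul]
        · rw [es₂ _ (y.2.resolve_left hy), if_neg hy, one_smul]) w
    refine ⟨K₁ ∪ K₂, hK₁.union hK₂, Set.union_subset hKK₁ hKK₂, ?_, z₁ - z', fun y hy => ?_⟩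
    · rw [Set.union_inter_distrib_right]
      exact Set.union_subset_union hT₁ hT₂
    · rw [map_sub, map_sub, hz' ⟨y, hy⟩, hw]
      by_cases hy₁ : y ∈ K₁
      · rw [if_pos hy₁, zero_smul, sub_zero, e₁ y hy₁]
      · rw [if_neg hy₁, one_smul, map_sub, map_sub, sub_sub_cancel, e₂ y (hy.resolve_left hy₁)]
  · intro y hy
    obtain ⟨w, hw⟩ := (fiberTensor_bijective (F := F) (G := G) (hKx hy)).2 (σ y)
    -- Softness applied to the compact set `{y}`.
    have hsurj : Function.Surjective (evalCompact f F x y) := fun a => by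
      obtain ⟨V, hV, t, rfl⟩ := exists_germs_eq_stalk F a
      obtain ⟨s', hs', e⟩ := hF x {y} (germs F t) isCompact_singleton (by simpa using hKx hy)
        (isSec_germs t (by simpa using hV))
      exact ⟨⟨s', hs'⟩, e y rfl⟩
    obtain ⟨z, rfl⟩ := LinearMap.rTensor_surjective _ hsurj w
    have e := ((isCompactSec_fiberTensor z).1.mono hKx).eventuallyEq hσ hy hw
    rw [eventually_nhdsWithin_iff] at e
    obtain ⟨U, hU, hyU, C, hC, hCy, hCO⟩ := hlp.exists_properOn y e
    have hxU : x ∈ U := by rwa [hKx hy] at hyU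
    exact ⟨C, mem_nhdsWithin_of_mem_nhds hCy, (C ∩ f ⁻¹' {x}) ∩ K,
      isCompact_inter_of_fiber hsep (hC.isCompact_inter_fiber hxU) Set.inter_subset_right hK hKx,
      Set.inter_subset_right, fun z hz => ⟨⟨hz.1, hKx hz.2⟩, hz.2⟩, z, fun y' hy' =>
        hCO hy'.1.1 hy'.2⟩

/-- The tensor product of a soft sheaf with the inverse image of a flat sheaf is soft. -/
lemma Soft.tensor (hsep : IsSeparatedMap f) (hlp : IsLocallyProper f) (hF : Soft f F)
    (hG : IsFlat G) : Soft f (tensor F ((inverseImage f).obj G)) := by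
  intro x K s hK hKx hs
  obtain ⟨z, hz⟩ := hF.exists_tensor_eq_of_isCompact hsep hlp (hG x) hK hKx hs
  exact ⟨_, isCompactSec_fiberTensor z, hz⟩

/-- An expression over a compact neighbourhood of the support vanishes where that neighbourhood is
left, so by flatness it can be written with sections vanishing there; these are then extended by
zero. -/
lemma Soft.exists_tensor_eq (hsep : IsSeparatedMap f) (hlp : IsLocallyProper f)
    (hF : Soft f F) (hG : Module.Flat ℤ (Stalk G x))
    {σ : ∀ y : Y, Stalk (ProperImage.tensor F ((inverseImage f).obj G)) y}
    (hσ : IsCompactSec f (ProperImage.tensor F ((inverseImage f).obj G)) x σ) :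
    ∃ z : (compactSections f F x) ⊗[ℤ] Stalk G x, ∀ y, f y = x →
      fiberTensor f F G x y ((evalCompact f F x y).rTensor _ z) = σ y := by
  classical
  obtain ⟨hσ, K, hK, hKx, h0⟩ := hσ
  obtain ⟨U, hU, hxU, C, hC, hKC, -⟩ :=
    hlp.exists_properOn_of_isCompact hK hKx isOpen_univ (Set.subset_univ _)
  have hCx := hC.isCompact_inter_fiber hxU
  obtain ⟨z, hz⟩ := hF.exists_tensor_eq_of_isCompact hsep hlp hG hCx Set.inter_subset_right
    (hσ.mono Set.inter_subset_right)
  have hB : IsCompact ((C ∩ f ⁻¹' {x}) ∩ (interior C)ᶜ) :=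
    hCx.inter_right isOpen_interior.isClosed_compl
  obtain ⟨S, hS, w, rfl⟩ := exists_vanishing hG hB
    (Set.inter_subset_left.trans Set.inter_subset_right) (z := z) (by
      rintro y ⟨hy, hyi⟩
      rw [hz y hy]
      exact h0 y hy.2 fun h => hyi (hKC h))
  -- The elements of `S` vanish at the points of the fibre in `C` outside its interior, so
  -- multiplying them by the indicator of `C` yields sections again.
  obtain ⟨z', hz'⟩ := exists_tensor_modification (S := S) (ι := f ⁻¹' {x})
    (fun y => y.1) (fun y => if y.1 ∈ C then 1 else 0) (fun c hc => by
      let s : ∀ y : Y, Stalk F y := fun y => if y ∈ C then c.1 y else 0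
      have hsC : ∀ y ∈ C, s y = c.1 y := fun y hy => if_pos hy
      have hs0 : ∀ y ∉ C, s y = 0 := fun y hy => if_neg hy
      refine ⟨⟨s, ?_, _, hCx, Set.inter_subset_right, fun y hy hn => hs0 y fun h => hn ⟨h, hy⟩⟩,
        fun y => ?_⟩
      · have : f ⁻¹' {x} = (C ∩ f ⁻¹' {x}) ∪ (f ⁻¹' {x} ∩ (interior C)ᶜ) := by
          ext y
          by_cases hy : y ∈ interior C
          · simp [hy, interior_subset hy]
          · simp [hy]
        rw [this]
        refine IsSec.union ((c.2.1.mono Set.inter_subset_right).congr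
          fun y hy => (hsC y hy.1).symm) (IsSec.zero.congr fun y hy => ?_) ?_ ?_
        · by_cases h : y ∈ C
          · rw [hsC y h, hS c hc y ⟨⟨h, hy.1⟩, hy.2⟩]
          · rw [hs0 y h]
        · exact fun y hy hc =>
            mem_of_mem_closure_of_isCompact hsep hCx Set.inter_subset_right hy.1 hc
        · exact fun y hy hc => ⟨hy.2, isOpen_interior.isClosed_compl.closure_subset
            (closure_mono Set.inter_subset_right hc)⟩
      · by_cases hy : y.1 ∈ C
        · rw [if_pos hy, one_smul]
          exact hsC _ hy
        · rw [if_neg hy, zero_smul]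
          exact hs0 _ hy) w
  refine ⟨z', fun y hy => (hz' ⟨y, hy⟩).trans ?_⟩
  by_cases hyC : y ∈ C
  · rw [if_pos hyC, one_smul, hz y ⟨hyC, hy⟩]
  · rw [if_neg hyC, zero_smul]
    exact (h0 y hy fun h => hyC (interior_subset (hKC h))).symm

end Fiber

/-! ### The projection formula for a soft and a flat sheaf -/

section Projection

variable {Y X : TopCat.{u}} (f : Y ⟶ X) (F : Sh Y) (G : Sh X)

lemma projection_app_tmul {U : Opens X} (s : properSections f F U) (t : G.obj.obj (op U)) :
    ((projection f F G).hom.app (op U) (tmul (F := (properImage f).obj F) s t) :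
      properSections f (tensor F ((inverseImage f).obj G)) U).1 =
        tmul s.1 ((pullbackSection f G U).hom t) := by
  have h := (Equiv.apply_symm_apply _ _).symm.trans (Adjunction.homEquiv_unit
    (adj := sheafificationAdjunction (Opens.grothendieckTopology X) AddCommGrpCat.{u})
    (f := projection f F G))
  exact congrArg Subtype.val (ConcreteCategory.congr_hom (NatTrans.congr_app h (op U))
    (s ⊗ₜ[ℤ] t)).symm

/-- The value at a point of the fibre of a germ of `f_! F`. -/
def evalFiber (x : X) (y : Y) : Stalk ((properImage f).obj F) x →ₗ[ℤ] Stalk F y :=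
  ((Pi.evalAddMonoidHom (fun y : Y => Stalk F y) y).comp (fiberGerms f F x)).toIntLinearMap

/-- On the fibre, the projection morphism becomes pointwise evaluation of tensors, so its
bijectivity on stalks can be decided by values at points. -/
lemma evalFiber_projection {x : X} {y : Y} (hy : f y = x)
    (z : Stalk ((properImage f).obj F) x ⊗[ℤ] Stalk G x) :
    evalFiber f (tensor F ((inverseImage f).obj G)) x y (stalkMap (projection f F G) x
      (stalkTensorHom ((properImage f).obj F) G x z)) =
      fiberTensor f F G x y ((evalFiber f F x y).rTensor _ z) := by
  induction z using TensorProduct.induction_on with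
  | zero => simp only [map_zero]
  | add z z' h h' => simp only [map_add, h, h']
  | tmul a b =>
    obtain ⟨U, hU, s, t, rfl, rfl⟩ := exists_germs_eq_pair ((properImage f).obj F) G a b
    have hyU : y ∈ (Opens.map f).obj U := by
      change f y ∈ U
      rwa [hy]
    rw [stalkTensorHom_tmul _ _ _ _ hU, ← germs_hom]
    refine (fiberGerms_germs f _ _ hU hy).trans ?_
    refine (congrArg (fun r => germs (tensor F ((inverseImage f).obj G)) r y)
      (projection_app_tmul f F G s t)).trans ?_
    refine Eq.trans ?_ (congrArg (fun a => fiberTensor f F G x y (a ⊗ₜ germs G t x))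
      (fiberGerms_germs f F s hU hy).symm)
    refine Eq.trans ?_ (fiberTensor_tmul le_rfl (s : properSections f F U).1 t hU hy hyU).symm
    exact congrArg (fun r => germs (tensor F ((inverseImage f).obj G))
      (tmul (s : properSections f F U).1 r) y) (ConcreteCategory.congr_hom
        (((inverseImage f).obj G).obj.map_id _) ((pullbackSection f G U).hom t)).symm

variable {f F G}

/-- A tensor involves finitely many germs, whose supports on the fibre lie in one compact `B`. By
flatness it comes from germs that also vanish on `B`, and such germs are zero. The argument runs in
the stalk rather than in `compactSections`, whose elements have arbitrary values off the fibre. -/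
lemma stalkMap_projection_injective {x : X} (hG : Module.Flat ℤ (Stalk G x))
    {z : Stalk ((properImage f).obj F) x ⊗[ℤ] Stalk G x}
    (hz : ∀ y, f y = x → fiberTensor f F G x y ((evalFiber f F x y).rTensor _ z) = 0) : z = 0 := by
  obtain ⟨S, ⟨B, hB, hBx, hSB⟩, w, rfl⟩ : ∃ S : Submodule ℤ (Stalk ((properImage f).obj F) x),
      (∃ B : Set Y, IsCompact B ∧ B ⊆ f ⁻¹' {x} ∧ ∀ c ∈ S, ∀ y, f y = x → y ∉ B →
        evalFiber f F x y c = 0) ∧ ∃ w : S ⊗[ℤ] Stalk G x, S.subtype.rTensor _ w = z := by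
    clear hz
    induction z using TensorProduct.induction_on with
    | zero => exact ⟨⊥, ⟨∅, isCompact_empty, Set.empty_subset _, by simp⟩, 0, map_zero _⟩
    | tmul a b =>
      obtain ⟨-, K, hK, hKx, h0⟩ := isCompactSec_fiberGerms F a
      refine ⟨Submodule.span ℤ {a}, ⟨K, hK, hKx, fun c hc y hy hn => ?_⟩,
        ⟨a, Submodule.mem_span_singleton_self _⟩ ⊗ₜ b, rfl⟩
      obtain ⟨n, rfl⟩ := Submodule.mem_span_singleton.1 hc
      rw [map_smul, show evalFiber f F x y a = 0 from h0 y hy hn, smul_zero]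
    | add z z' h h' =>
      obtain ⟨S, ⟨B, hB, hBx, h⟩, w, rfl⟩ := h
      obtain ⟨S', ⟨B', hB', hBx', h'⟩, w', rfl⟩ := h'
      refine ⟨S ⊔ S', ⟨B ∪ B', hB.union hB', Set.union_subset hBx hBx', fun c hc y hy hn => ?_⟩,
        (Submodule.inclusion le_sup_left).rTensor _ w +
          (Submodule.inclusion le_sup_right).rTensor _ w', ?_⟩
      · have hle : S ⊔ S' ≤ LinearMap.ker (evalFiber f F x y) :=
          sup_le (fun c hc => h c hc y hy fun hB => hn (Or.inl hB))
            (fun c hc => h' c hc y hy fun hB => hn (Or.inr hB))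
        exact hle hc
      · rw [map_add, ← LinearMap.comp_apply, ← LinearMap.comp_apply,
          ← LinearMap.rTensor_comp, ← LinearMap.rTensor_comp, Submodule.subtype_comp_inclusion,
          Submodule.subtype_comp_inclusion]
  -- Applied inside `S`, so that elements of `T` vanish both on `B` and on the rest of the fibre.
  obtain ⟨T, hT, v, rfl⟩ := exists_rTensor_vanishing_eq (z := w)
    (fun y => (evalFiber f F x y).comp S.subtype) hB
    (fun y hy c hc => ((isCompactSec_fiberGerms F c.1).1.mono hBx).eventuallyEq IsSec.zero hy hc)
    (fun y hy => (fiberTensor_bijective (F := F) (G := G) (hBx hy)).1 (by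
      refine Eq.trans ?_ ((hz y (hBx hy)).trans (map_zero _).symm)
      rw [LinearMap.rTensor_comp]
      rfl))
  have hT0 : T.subtype = 0 := by
    ext c
    refine congrArg Subtype.val (?_ : c.1 = 0)
    refine Subtype.ext (fiberGerms_eq_zero F fun y hy => ?_)
    by_cases hyB : y ∈ B
    · exact hT c.1 c.2 y hyB
    · exact hSB c.1.1 c.1.2 y hy hyB
  rw [hT0, LinearMap.rTensor_zero, LinearMap.zero_apply, map_zero]

/-- The projection formula for a soft and a flat sheaf. -/
lemma isIso_projection (hsep : IsSeparatedMap f) (hlp : IsLocallyProper f) (hF : Soft f F)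
    (hG : IsFlat G) : IsIso (projection f F G) := by
  have : ∀ x : X, IsIso ((TopCat.Presheaf.stalkFunctor AddCommGrpCat.{u} x).map
      (projection f F G).hom) := fun x => by
    refine (ConcreteCategory.isIso_iff_bijective _).2 (⟨?_, fun b => ?_⟩ :
      Function.Bijective (stalkMap (projection f F G) x))
    · refine (injective_iff_map_eq_zero (stalkMap (projection f F G) x)).2 fun a ha => ?_
      obtain ⟨z, rfl⟩ := (stalkTensorHom_bijective ((properImage f).obj F) G x).2 a
      rw [stalkMap_projection_injective (hG x) (z := z) fun y hy => ?_, map_zero]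
      rw [← evalFiber_projection f F G hy, ha, map_zero]
    · obtain ⟨z, hz⟩ := hF.exists_tensor_eq hsep hlp (hG x) (isCompactSec_fiberGerms _ b)
      -- Every compactly supported section over the fibre is the family of a germ of f_(!) F, so the
      -- tensor can be moved to the stalk.
      obtain ⟨w, hw⟩ : ∃ w : Stalk ((properImage f).obj F) x ⊗[ℤ] Stalk G x, ∀ y, f y = x →
          (evalFiber f F x y).rTensor _ w = (evalCompact f F x y).rTensor _ z := by
        clear hz
        induction z using TensorProduct.induction_on with
        | zero => exact ⟨0, fun y _ => by simp only [map_zero]⟩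
        | tmul c m =>
          obtain ⟨a, ha⟩ := c.2.exists_fiberGerms_eq hsep hlp
          exact ⟨a ⊗ₜ m, fun y hy => congrArg (fun a => a ⊗ₜ[ℤ] m) (ha y hy)⟩
        | add z z' h h' =>
          obtain ⟨w, h⟩ := h
          obtain ⟨w', h'⟩ := h'
          exact ⟨w + w', fun y hy => by rw [map_add, map_add, h y hy, h' y hy]⟩
      refine ⟨stalkTensorHom ((properImage f).obj F) G x w, ?_⟩
      rw [← sub_eq_zero]
      refine fiberGerms_eq_zero _ fun y hy => ?_
      change evalFiber f _ x y _ = 0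
      rw [map_sub, evalFiber_projection f F G hy, hw y hy, hz y hy]
      exact sub_self _
  exact TopCat.Presheaf.isIso_of_stalkFunctor_map_iso (projection f F G)

end Projection

end ProperImage

namespace ProperImage

open scoped TensorProduct

/-! ### Additivity of maps on stalks, and exactness tested on stalks -/

section StalkMap

variable {X : TopCat.{u}}

lemma stalkMap_id (F : Sh X) (x : X) (a : Stalk F x) : stalkMap (𝟙 F) x a = a :=
  ConcreteCategory.congr_hom ((stalkSh x).map_id F) a

lemma stalkMap_comp {F G H : Sh X} (φ : F ⟶ G) (ψ : G ⟶ H) (x : X) (a : Stalk F x) :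
    stalkMap (φ ≫ ψ) x a = stalkMap ψ x (stalkMap φ x a) :=
  ConcreteCategory.congr_hom ((stalkSh x).map_comp φ ψ) a

lemma stalkMap_add {F G : Sh X} (φ ψ : F ⟶ G) (x : X) (a : Stalk F x) :
    stalkMap (φ + ψ) x a = stalkMap φ x a + stalkMap ψ x a := by
  obtain ⟨V, hV, t, rfl⟩ := exists_germs_eq_stalk F a
  rw [← germs_hom, ← germs_hom, ← germs_hom, ← germs_add]
  rfl

lemma stalkMap_zero {F G : Sh X} (x : X) (a : Stalk F x) :
    stalkMap (0 : F ⟶ G) x a = 0 := by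
  have := stalkMap_add (0 : F ⟶ G) 0 x a
  rwa [add_zero, left_eq_add] at this

lemma stalkMap_sum {F G : Sh X} {J : Type*} (s : Finset J) (φ : J → (F ⟶ G)) (x : X)
    (a : Stalk F x) : stalkMap (∑ j ∈ s, φ j) x a = ∑ j ∈ s, stalkMap (φ j) x a := by
  classical
  induction s using Finset.induction_on with
  | empty => rw [Finset.sum_empty, Finset.sum_empty, stalkMap_zero]
  | insert j s hj h => rw [Finset.sum_insert hj, Finset.sum_insert hj, stalkMap_add, h]

lemma stalkMap_injective_of_mono {F G : Sh X} (φ : F ⟶ G) [Mono φ] (x : X) :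
    Function.Injective (stalkMap φ x) :=
  (AddCommGrpCat.mono_iff_injective _).1 (TopCat.Presheaf.stalk_mono_of_mono φ x)

lemma shortExact_of_stalkMap {S : ShortComplex (Sh X)}
    (h₁ : ∀ x, Function.Injective (stalkMap S.f x)) (h₂ : ∀ x, Function.Surjective (stalkMap S.g x))
    (h : ∀ x a, stalkMap S.g x a = 0 → ∃ b, stalkMap S.f x b = a) : S.ShortExact := by
  refine ShortComplex.ShortExact.mk' ?_ ?_ ?_
  · rw [TopCat.Sheaf.exact_iff_stalkFunctor_map_exact]
    exact fun x => (ShortComplex.ab_exact_iff _).2 (h x)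
  · have : ∀ x, Mono ((TopCat.Presheaf.stalkFunctor AddCommGrpCat.{u} x).map S.f.hom) := fun x =>
      (AddCommGrpCat.mono_iff_injective _).2 (h₁ x)
    exact TopCat.Presheaf.mono_of_stalk_mono S.f
  · rw [← TopCat.Sheaf.isLocallySurjective_iff_epi,
      TopCat.Presheaf.locally_surjective_iff_surjective_on_stalks]
    exact h₂

end StalkMap

/-! ### Flatness as torsion-freeness, and softness of finite sums -/

section Decomposition

variable {Y X : TopCat.{u}} {f : Y ⟶ X}

/-- A module over the principal ideal domain ℤ is flat exactly when it is torsion-free. -/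
lemma isFlat_iff (G : Sh X) :
    IsFlat G ↔ ∀ (x : X) (n : ℤ) (a : Stalk G x), n • a = 0 → n = 0 ∨ a = 0 := by
  constructor
  · intro h x n a ha
    have := h x
    have : Module.IsTorsionFree ℤ (Stalk G x) := inferInstance
    exact Module.isTorsionFree_iff_smul_eq_zero.1 this n a ha
  · intro h x
    have : Module.IsTorsionFree ℤ (Stalk G x) :=
      Module.isTorsionFree_iff_smul_eq_zero.2 fun n a ha => h x n a ha
    infer_instance

/-- Torsion-freeness passes to subgroups. This is why flat resolutions of length one exist. -/
lemma IsFlat.of_mono {F G : Sh X} (φ : F ⟶ G) [Mono φ] (hG : IsFlat G) : IsFlat F := by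
  rw [isFlat_iff] at hG ⊢
  intro x n a ha
  refine (hG x n (stalkMap φ x a) (by rw [← map_zsmul, ha, map_zero])).imp id fun h => ?_
  exact stalkMap_injective_of_mono φ x (h.trans (map_zero _).symm)

lemma IsCompactSec.hom {F G : Sh Y} {x : X} {s : ∀ y : Y, Stalk F y} (hs : IsCompactSec f F x s)
    (φ : F ⟶ G) : IsCompactSec f G x (fun y => stalkMap φ y (s y)) := by
  obtain ⟨h, K, hK, hKx, h0⟩ := hs
  exact ⟨h.hom φ, K, hK, hKx, fun y hy hn =>
    (congrArg (stalkMap φ y) (h0 y hy hn)).trans (map_zero _)⟩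

/-- A decomposition of the identity exhibits `A` as a retract of a finite sum of soft sheaves; the
extensions of the components are added. Terms of total complexes come in this form. -/
lemma soft_of_sum_eq_id {A : Sh Y} {J : Type*} (s : Finset J) {B : J → Sh Y}
    (r : ∀ j, A ⟶ B j) (i : ∀ j, B j ⟶ A) (h : ∑ j ∈ s, r j ≫ i j = 𝟙 A)
    (hB : ∀ j ∈ s, Soft f (B j)) : Soft f A := by
  intro x K σ hK hKx hσ
  have : ∀ j, ∃ c, IsCompactSec f A x c ∧ (j ∈ s → ∀ y ∈ K,
      c y = stalkMap (r j ≫ i j) y (σ y)) := fun j => by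
    by_cases hj : j ∈ s
    · obtain ⟨c, hc, e⟩ := hB j hj x K _ hK hKx (hσ.hom (r j))
      exact ⟨_, hc.hom (i j), fun _ y hy => by rw [stalkMap_comp, e y hy]⟩
    · exact ⟨_, (compactSections f A x).zero_mem, fun h => absurd h hj⟩
  choose c hc e using this
  refine ⟨∑ j ∈ s, c j, (compactSections f A x).sum_mem fun j _ => hc j, fun y hy => ?_⟩
  rw [Finset.sum_apply]
  refine (Finset.sum_congr rfl fun j hj => e j hj y hy).trans ?_
  rw [← stalkMap_sum, h, stalkMap_id]

end Decomposition

/-! ### Exactness of the tensor product with a flat sheaf -/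

section TensorExact

variable {X : TopCat.{u}}

lemma tensorSheaf_map_app_tmul {F F' : Sh X} (φ : F ⟶ F') (G : Sh X) {V : Opens X}
    (s : F.obj.obj (op V)) (t : G.obj.obj (op V)) :
    (((tensorSheaf X).map φ).app G).hom.app (op V) (tmul s t) =
      tmul (F := F') (φ.hom.app (op V) s) t :=
  (ConcreteCategory.congr_hom (NatTrans.congr_app
    ((sheafificationAdjunction (Opens.grothendieckTopology X) AddCommGrpCat.{u}).unit.naturality
      (((tensorPresheaf X).map φ.hom).app G.obj)) (op V)) (s ⊗ₜ[ℤ] t)).symm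

lemma tensorSheaf_obj_map_tmul (F : Sh X) {G G' : Sh X} (ψ : G ⟶ G') {V : Opens X}
    (s : F.obj.obj (op V)) (t : G.obj.obj (op V)) :
    (((tensorSheaf X).obj F).map ψ).hom.app (op V) (tmul s t) =
      tmul (G := G') s (ψ.hom.app (op V) t) :=
  (ConcreteCategory.congr_hom (NatTrans.congr_app
    ((sheafificationAdjunction (Opens.grothendieckTopology X) AddCommGrpCat.{u}).unit.naturality
      (((tensorPresheaf X).obj F.obj).map ψ.hom)) (op V)) (s ⊗ₜ[ℤ] t)).symm

lemma stalkMap_tensorSheaf_map {F F' : Sh X} (φ : F ⟶ F') (G : Sh X) (x : X)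
    (z : Stalk F x ⊗[ℤ] Stalk G x) :
    stalkMap (((tensorSheaf X).map φ).app G) x (stalkTensorHom F G x z) =
      stalkTensorHom F' G x ((stalkMap φ x).toIntLinearMap.rTensor (Stalk G x) z) := by
  induction z using TensorProduct.induction_on with
  | zero => simp only [map_zero]
  | add z z' h h' => simp only [map_add, h, h']
  | tmul a b =>
    obtain ⟨V, hV, s, t, rfl, rfl⟩ := exists_germs_eq_pair F G a b
    rw [stalkTensorHom_tmul _ _ _ _ hV, ← germs_hom, tensorSheaf_map_app_tmul,
      ← stalkTensorHom_tmul _ _ _ _ hV, germs_hom]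
    rfl

lemma stalkMap_tensorSheaf_obj_map (F : Sh X) {G G' : Sh X} (ψ : G ⟶ G') (x : X)
    (z : Stalk F x ⊗[ℤ] Stalk G x) :
    stalkMap (((tensorSheaf X).obj F).map ψ) x (stalkTensorHom F G x z) =
      stalkTensorHom F G' x ((stalkMap ψ x).toIntLinearMap.lTensor (Stalk F x) z) := by
  induction z using TensorProduct.induction_on with
  | zero => simp only [map_zero]
  | add z z' h h' => simp only [map_add, h, h']
  | tmul a b =>
    obtain ⟨V, hV, s, t, rfl, rfl⟩ := exists_germs_eq_pair F G a b
    rw [stalkTensorHom_tmul _ _ _ _ hV, ← germs_hom, tensorSheaf_obj_map_tmul,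
      ← stalkTensorHom_tmul _ _ _ _ hV, germs_hom]
    rfl

instance (G : Sh X) : ((tensorSheaf X).flip.obj G).Additive where
  map_add {F F' φ ψ} := by
    change ((tensorSheaf X).map (φ + ψ)).app G = _
    rw [Functor.map_add]
    rfl

/-- Exactness is tested on stalks, where the functor is the tensor product with the flat module
`F_x`. -/
lemma preservesHomology_tensorSheaf_obj {F : Sh X} (hF : IsFlat F) :
    ((tensorSheaf X).obj F).PreservesHomology := by
  refine ((Functor.exact_tfae ((tensorSheaf X).obj F)).out 0 2).1 fun S hS => ?_
  refine shortExact_of_stalkMap (fun x => ?_) (fun x => ?_) (fun x a ha => ?_)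
  · have := hF x
    have inj := Module.Flat.lTensor_preserves_injective_linearMap (M := Stalk F x)
      (stalkMap S.f x).toIntLinearMap (stalkMap_injective hS x)
    refine (injective_iff_map_eq_zero (stalkMap (((tensorSheaf X).obj F).map S.f) x)).2 fun a ha => ?_
    obtain ⟨z, rfl⟩ := (stalkTensorHom_bijective F S.X₁ x).2 a
    rw [stalkMap_tensorSheaf_obj_map] at ha
    rw [inj (((stalkTensorHom_bijective F S.X₂ x).1 (ha.trans (map_zero _).symm)).trans
      (map_zero _).symm), map_zero]
  · intro a
    obtain ⟨z, rfl⟩ := (stalkTensorHom_bijective F S.X₃ x).2 a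
    obtain ⟨w, rfl⟩ := LinearMap.lTensor_surjective (Stalk F x)
      (g := (stalkMap S.g x).toIntLinearMap) (stalkMap_surjective hS x) z
    exact ⟨_, stalkMap_tensorSheaf_obj_map F S.g x w⟩
  · obtain ⟨z, rfl⟩ := (stalkTensorHom_bijective F S.X₂ x).2 a
    have ha' := (stalkMap_tensorSheaf_obj_map F S.g x z).symm.trans ha
    have ex : Function.Exact (stalkMap S.f x).toIntLinearMap (stalkMap S.g x).toIntLinearMap :=
      fun b => ⟨stalkMap_exact hS x b, by
        rintro ⟨c, rfl⟩
        exact stalkMap_comp_apply x c⟩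
    obtain ⟨w, rfl⟩ := (lTensor_exact (Stalk F x) ex (stalkMap_surjective hS x) z).1
      ((stalkTensorHom_bijective F S.X₃ x).1 (ha'.trans (map_zero _).symm))
    exact ⟨_, stalkMap_tensorSheaf_obj_map F S.f x w⟩

lemma preservesHomology_tensorSheaf_flip_obj {G : Sh X} (hG : IsFlat G) :
    ((tensorSheaf X).flip.obj G).PreservesHomology := by
  refine ((Functor.exact_tfae ((tensorSheaf X).flip.obj G)).out 0 2).1 fun S hS => ?_
  refine shortExact_of_stalkMap (fun x => ?_) (fun x => ?_) (fun x a ha => ?_)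
  · have := hG x
    have inj := Module.Flat.rTensor_preserves_injective_linearMap (M := Stalk G x)
      (stalkMap S.f x).toIntLinearMap (stalkMap_injective hS x)
    refine (injective_iff_map_eq_zero (stalkMap (((tensorSheaf X).map S.f).app G) x)).2
      fun a ha => ?_
    obtain ⟨z, rfl⟩ := (stalkTensorHom_bijective S.X₁ G x).2 a
    rw [stalkMap_tensorSheaf_map] at ha
    rw [inj (((stalkTensorHom_bijective S.X₂ G x).1 (ha.trans (map_zero _).symm)).trans
      (map_zero _).symm), map_zero]
  · intro a
    obtain ⟨z, rfl⟩ := (stalkTensorHom_bijective S.X₃ G x).2 a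
    obtain ⟨w, rfl⟩ := LinearMap.rTensor_surjective (Stalk G x)
      (g := (stalkMap S.g x).toIntLinearMap) (stalkMap_surjective hS x) z
    exact ⟨_, stalkMap_tensorSheaf_map S.g G x w⟩
  · obtain ⟨z, rfl⟩ := (stalkTensorHom_bijective S.X₂ G x).2 a
    have ha' := (stalkMap_tensorSheaf_map S.g G x z).symm.trans ha
    have ex : Function.Exact (stalkMap S.f x).toIntLinearMap (stalkMap S.g x).toIntLinearMap :=
      fun b => ⟨stalkMap_exact hS x b, by
        rintro ⟨c, rfl⟩
        exact stalkMap_comp_apply x c⟩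
    obtain ⟨w, rfl⟩ := (rTensor_exact (Stalk G x) ex (stalkMap_surjective hS x) z).1
      ((stalkTensorHom_bijective S.X₃ G x).1 (ha'.trans (map_zero _).symm))
    exact ⟨_, stalkMap_tensorSheaf_map S.f G x w⟩

lemma IsFlat.inverseImage {Y : TopCat.{u}} (f : Y ⟶ X) {G : Sh X} (hG : IsFlat G) :
    IsFlat ((inverseImage f).obj G) := by
  rw [isFlat_iff] at hG ⊢
  intro y n a ha
  obtain ⟨b, rfl⟩ := (stalkPullbackHom_bijective f G y).2 a
  rw [← map_zsmul] at ha
  refine (hG (f y) n b ((stalkPullbackHom_bijective f G y).1 (ha.trans (map_zero _).symm))).imp id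
    fun h => ?_
  rw [h, map_zero]

end TensorExact

end ProperImage

namespace ProperImage

/-! ### The augmentation ideal as a functorial torsion-free cover -/

section Augmentation

/-- The augmentation ideal of the group ring of an abelian group, as an abelian group. -/
def augmentation (M : Type u) [AddCommGroup M] : Submodule ℤ (M →₀ ℤ) :=
  LinearMap.ker (Finsupp.linearCombination ℤ (fun _ : M => (1 : ℤ)))

lemma mapDomain_mem_augmentation {M N : Type u} [AddCommGroup M] [AddCommGroup N] (φ : M →+ N)
    (z : augmentation M) : Finsupp.lmapDomain ℤ ℤ φ z.1 ∈ augmentation N := by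
  refine LinearMap.mem_ker.2 ?_
  rw [Finsupp.lmapDomain_apply, Finsupp.linearCombination_mapDomain]
  exact LinearMap.mem_ker.1 z.2

/-- The augmentation ideal as a functor. -/
def augmentationFunctor : AddCommGrpCat.{u} ⥤ AddCommGrpCat.{u} where
  obj M := AddCommGrpCat.of (augmentation M)
  map {M N} φ := AddCommGrpCat.ofHom
    (((Finsupp.lmapDomain ℤ ℤ φ.hom).comp (augmentation M).subtype).codRestrict (augmentation N)
      (mapDomain_mem_augmentation φ.hom)).toAddMonoidHom
  map_id _ := ConcreteCategory.hom_ext _ _ fun _ => Subtype.ext Finsupp.mapDomain_id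
  map_comp {M _ _} φ ψ := ConcreteCategory.hom_ext _ _ fun z => Subtype.ext
    (LinearMap.congr_fun (Finsupp.lmapDomain_comp ℤ ℤ φ.hom ψ.hom) (z : augmentation M).1)

/-- The reason for using the augmentation ideal: the full group ring ℤ[M] does not send zero
morphisms to zero, so it would not carry complexes to complexes. -/
instance : augmentationFunctor.{u}.PreservesZeroMorphisms where
  map_zero M N := by
    refine ConcreteCategory.hom_ext _ _ fun (z : augmentation M) => Subtype.ext ?_
    have hz : Finsupp.linearCombination ℤ (fun _ : M => (1 : ℤ)) z.1 = 0 := z.2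
    -- The zero map moves all coefficients to the basis element at `0`, and their sum is the
    -- augmentation of `z`.
    have : Finsupp.mapDomain (fun _ : M => (0 : N)) z.1 =
        Finsupp.single 0 (Finsupp.linearCombination ℤ (fun _ : M => (1 : ℤ)) z.1) := by
      rw [Finsupp.mapDomain, Finsupp.linearCombination_apply, Finsupp.single_sum]
      simp
    exact this.trans (by rw [hz, Finsupp.single_zero]; rfl)

/-- The morphism from the augmentation ideal to the group. -/
def augmentationMap : augmentationFunctor.{u} ⟶ 𝟭 AddCommGrpCat.{u} where
  app M := AddCommGrpCat.ofHom
    ((Finsupp.linearCombination ℤ (id : M → M)).comp (augmentation M).subtype).toAddMonoidHom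
  naturality M N φ := by
    refine ConcreteCategory.hom_ext _ _ fun (z : augmentation M) => ?_
    change Finsupp.linearCombination ℤ id (Finsupp.mapDomain φ z.1) =
      φ.hom (Finsupp.linearCombination ℤ id z.1)
    rw [Finsupp.linearCombination_mapDomain, Finsupp.linearCombination_apply,
      Finsupp.linearCombination_apply, Finsupp.sum, Finsupp.sum, map_sum]
    exact Finset.sum_congr rfl fun m _ => (map_zsmul φ.hom _ _).symm

lemma augmentationMap_surjective (M : AddCommGrpCat.{u}) :
    Function.Surjective (augmentationMap.app M) := fun m => by
  -- The element [m] - [0] has augmentation zero and is sent to `m`.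
  refine ⟨(⟨Finsupp.single m 1 - Finsupp.single 0 1, ?_⟩ : augmentation M), ?_⟩
  · exact LinearMap.mem_ker.2 (by simp)
  · change Finsupp.linearCombination ℤ id (Finsupp.single m 1 - Finsupp.single 0 1) = m
    simp

end Augmentation

/-! ### The functorial flat cover of a sheaf -/

section FlatCover

variable (X : TopCat.{u})

/-- The flat sheaf covering a sheaf: the sheafification of the augmentation ideals of the groups
of sections. -/
def flatCover : Sh X ⥤ Sh X :=
  TopCat.Sheaf.forget _ X ⋙ (Functor.whiskeringRight _ _ _).obj augmentationFunctor ⋙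
    presheafToSheaf (Opens.grothendieckTopology X) AddCommGrpCat.{u}

instance : (flatCover X).PreservesZeroMorphisms where
  map_zero F G := by
    have : Functor.whiskerRight (0 : F.obj ⟶ G.obj) augmentationFunctor = 0 :=
      NatTrans.ext (funext fun U => augmentationFunctor.map_zero _ _)
    refine (congrArg (presheafToSheaf (Opens.grothendieckTopology X) AddCommGrpCat.{u}).map
      this).trans ?_
    exact (presheafToSheaf (Opens.grothendieckTopology X) AddCommGrpCat.{u}).map_zero _ _

/-- The morphism from the flat sheaf covering a sheaf. -/
def flatCoverMap : flatCover X ⟶ 𝟭 (Sh X) :=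
  Functor.whiskerLeft (TopCat.Sheaf.forget _ X) (Functor.whiskerRight
    ((Functor.whiskeringRight (Opens X)ᵒᵖ _ _).map augmentationMap)
      (presheafToSheaf (Opens.grothendieckTopology X) AddCommGrpCat.{u})) ≫
    (sheafificationAdjunction (Opens.grothendieckTopology X) AddCommGrpCat.{u}).counit

variable {X}

/-- Preceded by the unit of sheafification, the cover is the presheaf morphism `augmentationMap`,
already surjective on sections. -/
lemma flatCoverMap_app_surjective (F : Sh X) (U : Opens X) :
    Function.Surjective (((flatCoverMap X).app F).hom.app (op U)) := fun s => by
  obtain ⟨z, hz⟩ := augmentationMap_surjective _ s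
  let adj := sheafificationAdjunction (Opens.grothendieckTopology X) AddCommGrpCat.{u}
  have h : adj.unit.app (F.obj ⋙ augmentationFunctor) ≫ ((flatCoverMap X).app F).hom =
      Functor.whiskerLeft F.obj augmentationMap := by
    have h₁ := adj.unit.naturality (X := F.obj ⋙ augmentationFunctor) (Y := F.obj)
      (Functor.whiskerLeft F.obj augmentationMap)
    have h₂ := adj.right_triangle_components F
    refine (Category.assoc _ _ _).symm.trans ((congrArg (fun φ => φ ≫ (adj.counit.app F).hom)
      h₁.symm).trans ((Category.assoc _ _ _).trans ?_))
    exact (congrArg (fun φ => Functor.whiskerLeft F.obj augmentationMap ≫ φ) h₂).trans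
      (Category.comp_id _)
  exact ⟨(adj.unit.app (F.obj ⋙ augmentationFunctor)).app (op U) z,
    (ConcreteCategory.congr_hom (NatTrans.congr_app h (op U)) z).trans hz⟩

instance (F : Sh X) : Epi ((flatCoverMap X).app F) := by
  rw [← TopCat.Sheaf.isLocallySurjective_iff_epi, TopCat.Presheaf.isLocallySurjective_iff]
  intro U t x hx
  obtain ⟨r, hr⟩ := flatCoverMap_app_surjective F U t
  refine ⟨U, le_rfl, ⟨r, hr.trans ?_⟩, hx⟩
  exact (ConcreteCategory.congr_hom (F.obj.map_id _) t).symm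

/-- Sheafification does not change stalks, and the presheaf takes values in subgroups of free
abelian groups, so torsion in a stalk already vanishes on a smaller open set. -/
lemma isFlat_flatCover (F : Sh X) : IsFlat ((flatCover X).obj F) := by
  rw [isFlat_iff]
  intro x n a ha
  rw [or_iff_not_imp_left]
  intro hn
  let P : TopCat.Presheaf AddCommGrpCat.{u} X := F.obj ⋙ augmentationFunctor
  let φ := (TopCat.Presheaf.stalkFunctor AddCommGrpCat.{u} x).map
    (CategoryTheory.toSheafify (Opens.grothendieckTopology X) P)
  have : IsIso φ := TopCat.Presheaf.stalkFunctor_map_unit_toSheafify_isIso x AddCommGrpCat.{u} P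
  have hφ : Function.Bijective φ := (ConcreteCategory.isIso_iff_bijective φ).1 this
  obtain ⟨b, rfl⟩ := hφ.2 a
  have hb : n • b = 0 := hφ.1 ((map_zsmul φ.hom n b).trans (ha.trans (map_zero φ.hom).symm))
  obtain ⟨V, hV, z, rfl⟩ := TopCat.Presheaf.exists_germ_eq P b
  obtain ⟨W, hW, i, j, e⟩ := TopCat.Presheaf.germ_eq P x hV hV (n • z) 0
    ((map_zsmul (TopCat.Presheaf.germ P V x hV).hom n z).trans
      (hb.trans (map_zero (TopCat.Presheaf.germ P V x hV).hom).symm))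
  have e' : n • P.map i.op z = 0 :=
    ((map_zsmul (P.map i.op).hom n z).symm.trans e).trans (map_zero (P.map j.op).hom)
  have e'' : P.map i.op z = 0 := by
    refine Subtype.ext (Finsupp.ext fun m => ?_)
    have := DFunLike.congr_fun (congrArg Subtype.val e') m
    exact (mul_eq_zero.1 this).resolve_left hn
  have : TopCat.Presheaf.germ P V x hV z = 0 := by
    rw [← TopCat.Presheaf.germ_res_apply P i x hW, e'', map_zero]
  rw [this]
  exact map_zero φ.hom

end FlatCover

end ProperImage

namespace ProperImage

open HomologicalComplex

/-! ### Four lemmas for homology of short exact sequences of complexes -/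

section FiveLemma

variable {C : Type*} [Category* C] [Abelian C] {S₁ S₂ : ShortComplex (CochainComplex C ℤ)}

/-- The four lemma on the part H^{n-1}(X₃), H^n(X₁), H^n(X₂), H^n(X₃) of the long exact sequence.
Only one degree of `τ₁` enters, which permits an induction degree by degree. -/
lemma mono_homologyMap_τ₂ (φ : S₁ ⟶ S₂) (hS₁ : S₁.ShortExact) (hS₂ : S₂.ShortExact) (n : ℤ)
    (h₁ : Mono (homologyMap φ.τ₁ n)) (h₃ : QuasiIso φ.τ₃) : Mono (homologyMap φ.τ₂ n) := by
  have h₃' : ∀ i, IsIso (homologyMap φ.τ₃ i) := fun i =>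
    (quasiIsoAt_iff_isIso_homologyMap _ _).1 inferInstance
  have hn : (ComplexShape.up ℤ).Rel (n - 1) n := by simp
  apply Abelian.mono_of_epi_of_mono_of_mono
    ((ComposableArrows.δ₀Functor ⋙ ComposableArrows.δ₀Functor).map
      (HomologySequence.mapComposableArrows₅ φ hS₁ hS₂ (n - 1) n hn))
  · exact (HomologySequence.composableArrows₅_exact hS₁ _ _ hn).δ₀.δ₀
  · exact (HomologySequence.composableArrows₅_exact hS₂ _ _ hn).δ₀.δ₀
  · exact inferInstanceAs (Epi (homologyMap φ.τ₃ (n - 1)))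
  · exact h₁
  · exact inferInstanceAs (Mono (homologyMap φ.τ₃ n))

/-- The dual four lemma on H^n(X₁), H^n(X₂), H^n(X₃), H^{n+1}(X₁); the last term requires
injectivity one degree higher. -/
lemma epi_homologyMap_τ₂ (φ : S₁ ⟶ S₂) (hS₁ : S₁.ShortExact) (hS₂ : S₂.ShortExact) (n : ℤ)
    (h₁ : Epi (homologyMap φ.τ₁ n)) (h₁' : Mono (homologyMap φ.τ₁ (n + 1)))
    (h₃ : QuasiIso φ.τ₃) : Epi (homologyMap φ.τ₂ n) := by
  have h₃' : ∀ i, IsIso (homologyMap φ.τ₃ i) := fun i =>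
    (quasiIsoAt_iff_isIso_homologyMap _ _).1 inferInstance
  have hn : (ComplexShape.up ℤ).Rel n (n + 1) := by simp
  apply Abelian.epi_of_epi_of_epi_of_mono
    ((ComposableArrows.δlastFunctor ⋙ ComposableArrows.δlastFunctor).map
      (HomologySequence.mapComposableArrows₅ φ hS₁ hS₂ n (n + 1) hn))
  · exact (HomologySequence.composableArrows₅_exact hS₁ _ _ hn).δlast.δlast
  · exact (HomologySequence.composableArrows₅_exact hS₂ _ _ hn).δlast.δlast
  · exact h₁
  · exact inferInstanceAs (Epi (homologyMap φ.τ₃ n))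
  · exact h₁'

end FiveLemma

/-! ### Total complexes: splittings, summands, and columns in one degree -/

section Total

variable {A₁ A₂ D : Type*} [Category* A₁] [Category* A₂] [Category* D] [Abelian A₁] [Abelian A₂]
  [Abelian D] (T : A₁ ⥤ A₂ ⥤ D) [T.Additive] [∀ A, (T.obj A).Additive]

lemma isZero_obj_obj_of_isZero {A : A₁} (hA : IsZero A) (B : A₂) : IsZero ((T.obj A).obj B) := by
  rw [IsZero.iff_id_eq_zero, ← NatTrans.id_app, ← T.map_id, hA.eq_of_src (𝟙 A) 0, T.map_zero]
  rfl

variable [∀ (K : CochainComplex A₁ ℤ) (L : CochainComplex A₂ ℤ),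
    HasMapBifunctor K L T (ComplexShape.up ℤ)]

lemma mapBifunctorMap_comp_left {K K' K'' : CochainComplex A₁ ℤ} (φ : K ⟶ K') (ψ : K' ⟶ K'')
    (L : CochainComplex A₂ ℤ) :
    mapBifunctorMap (φ ≫ ψ) (𝟙 L) T (.up ℤ) =
      mapBifunctorMap φ (𝟙 L) T (.up ℤ) ≫ mapBifunctorMap ψ (𝟙 L) T (.up ℤ) :=
  ((T.map₂CochainComplex).flip.obj L).map_comp φ ψ

lemma mapBifunctorMap_zero_left {K K' : CochainComplex A₁ ℤ} (L : CochainComplex A₂ ℤ) :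
    mapBifunctorMap (0 : K ⟶ K') (𝟙 L) T (.up ℤ) = 0 := by
  ext n : 1
  apply mapBifunctor.hom_ext
  intro p q h
  rw [ι_mapBifunctorMap]
  simp

/-- The short complex of total complexes attached to a short complex of complexes. -/
abbrev totalShortComplex (S : ShortComplex (CochainComplex A₁ ℤ)) (L : CochainComplex A₂ ℤ) :
    ShortComplex (CochainComplex D ℤ) :=
  ShortComplex.mk (mapBifunctorMap S.f (𝟙 L) T (.up ℤ)) (mapBifunctorMap S.g (𝟙 L) T (.up ℤ)) (by
    rw [← mapBifunctorMap_comp_left, S.zero, mapBifunctorMap_zero_left])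

/-- The morphism of short complexes of total complexes induced by a morphism. -/
abbrev totalShortComplexMap (S : ShortComplex (CochainComplex A₁ ℤ)) {L L' : CochainComplex A₂ ℤ}
    (φ : L ⟶ L') : totalShortComplex T S L ⟶ totalShortComplex T S L' where
  τ₁ := mapBifunctorMap (𝟙 S.X₁) φ T (.up ℤ)
  τ₂ := mapBifunctorMap (𝟙 S.X₂) φ T (.up ℤ)
  τ₃ := mapBifunctorMap (𝟙 S.X₃) φ T (.up ℤ)
  comm₁₂ := ((T.map₂CochainComplex).map S.f).naturality φ
  comm₂₃ := ((T.map₂CochainComplex).map S.g).naturality φ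

/-- The morphism in degree `n` of total complexes attached to a family of morphisms which need
not commute with the differentials. -/
def totalGradedMap {K K' : CochainComplex A₁ ℤ} (r : ∀ p, K.X p ⟶ K'.X p)
    (L : CochainComplex A₂ ℤ) (n : ℤ) :
    (mapBifunctor K L T (.up ℤ)).X n ⟶ (mapBifunctor K' L T (.up ℤ)).X n :=
  mapBifunctorDesc fun p q h => (T.map (r p)).app (L.X q) ≫ ιMapBifunctor K' L T (.up ℤ) p q n h

lemma ι_totalGradedMap {K K' : CochainComplex A₁ ℤ} (r : ∀ p, K.X p ⟶ K'.X p)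
    (L : CochainComplex A₂ ℤ) (p q n : ℤ) (h : p + q = n) :
    ιMapBifunctor K L T (.up ℤ) p q n h ≫ totalGradedMap T r L n =
      (T.map (r p)).app (L.X q) ≫ ιMapBifunctor K' L T (.up ℤ) p q n h :=
  ι_mapBifunctorDesc ..

lemma totalGradedMap_comp {K K' K'' : CochainComplex A₁ ℤ} (r : ∀ p, K.X p ⟶ K'.X p)
    (r' : ∀ p, K'.X p ⟶ K''.X p) (L : CochainComplex A₂ ℤ) (n : ℤ) :
    totalGradedMap T r L n ≫ totalGradedMap T r' L n =
      totalGradedMap T (fun p => r p ≫ r' p) L n := by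
  apply mapBifunctor.hom_ext
  intro p q h
  rw [← Category.assoc, ι_totalGradedMap, Category.assoc, ι_totalGradedMap, ι_totalGradedMap,
    T.map_comp, NatTrans.comp_app, Category.assoc]

lemma totalGradedMap_add {K K' : CochainComplex A₁ ℤ} (r r' : ∀ p, K.X p ⟶ K'.X p)
    (L : CochainComplex A₂ ℤ) (n : ℤ) :
    totalGradedMap T r L n + totalGradedMap T r' L n =
      totalGradedMap T (fun p => r p + r' p) L n := by
  apply mapBifunctor.hom_ext
  intro p q h
  rw [Preadditive.comp_add, ι_totalGradedMap, ι_totalGradedMap, ι_totalGradedMap,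
    T.map_add, NatTrans.app_add, Preadditive.add_comp]

lemma totalGradedMap_id (K : CochainComplex A₁ ℤ) (L : CochainComplex A₂ ℤ) (n : ℤ) :
    totalGradedMap T (fun p => 𝟙 (K.X p)) L n = 𝟙 _ := by
  apply mapBifunctor.hom_ext
  intro p q h
  rw [ι_totalGradedMap, T.map_id, NatTrans.id_app, Category.id_comp]
  exact (Category.comp_id _).symm

lemma mapBifunctorMap_f_eq {K K' : CochainComplex A₁ ℤ} (φ : K ⟶ K')
    (L : CochainComplex A₂ ℤ) (n : ℤ) :
    (mapBifunctorMap φ (𝟙 L) T (.up ℤ)).f n = totalGradedMap T φ.f L n := by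
  apply mapBifunctor.hom_ext
  intro p q h
  rw [ι_mapBifunctorMap, id_f, CategoryTheory.Functor.map_id, Category.id_comp, ι_totalGradedMap]

/-- A degreewise splitting induces a degreewise splitting of the total complexes. -/
def splittingTotal (S : ShortComplex (CochainComplex A₁ ℤ))
    (σ : ∀ n, (S.map (HomologicalComplex.eval _ _ n)).Splitting)
    (L : CochainComplex A₂ ℤ) (n : ℤ) :
    ((totalShortComplex T S L).map (HomologicalComplex.eval _ _ n)).Splitting where
  r := totalGradedMap T (K := S.X₂) (K' := S.X₁) (fun p => (σ p).r) L n
  s := totalGradedMap T (K := S.X₃) (K' := S.X₂) (fun p => (σ p).s) L n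
  f_r := (congrArg (fun m => m ≫ _) (mapBifunctorMap_f_eq T S.f L n)).trans
    ((totalGradedMap_comp ..).trans ((congrArg (fun r => totalGradedMap T r L n)
      (funext fun p => (σ p).f_r)).trans (totalGradedMap_id ..)))
  s_g := (congrArg (fun m => _ ≫ m) (mapBifunctorMap_f_eq T S.g L n)).trans
    ((totalGradedMap_comp ..).trans ((congrArg (fun r => totalGradedMap T r L n)
      (funext fun p => (σ p).s_g)).trans (totalGradedMap_id ..)))
  id := (congrArg₂ (fun m m' => _ ≫ m + m' ≫ _) (mapBifunctorMap_f_eq T S.f L n)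
      (mapBifunctorMap_f_eq T S.g L n)).trans
    ((congrArg₂ (fun m m' => m + m') (totalGradedMap_comp ..) (totalGradedMap_comp ..)).trans
      ((totalGradedMap_add ..).trans ((congrArg (fun r => totalGradedMap T r L n)
        (funext fun p => (σ p).id)).trans (totalGradedMap_id ..))))

/-- The degreewise splittings survive any additive bifunctor, so no flatness is needed. -/
lemma shortExact_totalShortComplex (S : ShortComplex (CochainComplex A₁ ℤ))
    (σ : ∀ n, (S.map (HomologicalComplex.eval _ _ n)).Splitting) (L : CochainComplex A₂ ℤ) :
    (totalShortComplex T S L).ShortExact :=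
  shortExact_of_degreewise_shortExact _ fun n => (splittingTotal T S σ L n).shortExact

/-- The projection of a total complex to a summand. -/
def totalProj (K : CochainComplex A₁ ℤ) (L : CochainComplex A₂ ℤ) (p q n : ℤ) (h : p + q = n) :
    (mapBifunctor K L T (.up ℤ)).X n ⟶ (T.obj (K.X p)).obj (L.X q) :=
  mapBifunctorDesc fun p' q' (h' : p' + q' = n) =>
    if hp : p' = p then eqToHom (by
      subst hp
      obtain rfl : q' = q := by lia
      rfl) else 0

lemma ι_totalProj (K : CochainComplex A₁ ℤ) (L : CochainComplex A₂ ℤ) (p q n : ℤ)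
    (h : p + q = n) : ιMapBifunctor K L T (.up ℤ) p q n h ≫ totalProj T K L p q n h = 𝟙 _ := by
  rw [totalProj, ι_mapBifunctorDesc, dif_pos rfl, eqToHom_refl]

lemma ι_totalProj_of_ne (K : CochainComplex A₁ ℤ) (L : CochainComplex A₂ ℤ) (p q p' q' n : ℤ)
    (h : p + q = n) (h' : p' + q' = n) (hp : p' ≠ p) :
    ιMapBifunctor K L T (.up ℤ) p' q' n h' ≫ totalProj T K L p q n h = 0 := by
  rw [totalProj, ι_mapBifunctorDesc, dif_neg hp]

/-- A total complex whose first factor is concentrated in a single degree. -/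
def totalConcentratedIso (K : CochainComplex A₁ ℤ) (a : ℤ) (hK : ∀ p, p ≠ a → IsZero (K.X p))
    (L : CochainComplex A₂ ℤ) :
    (((T.obj (K.X a)).mapHomologicalComplex _).obj L)⟦-a⟧ ≅ mapBifunctor K L T (.up ℤ) :=
  HomologicalComplex.Hom.isoOfComponents (fun n =>
    { hom := ιMapBifunctor K L T (.up ℤ) a (n + -a) n (show a + (n + -a) = n by lia)
      inv := totalProj T K L a (n + -a) n (by lia)
      hom_inv_id := ι_totalProj ..
      inv_hom_id := by
        apply mapBifunctor.hom_ext
        intro p q (h : p + q = n)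
        by_cases hp : p = a
        · subst hp
          obtain rfl : q = n + -p := by lia
          exact (Category.assoc ..).symm.trans ((congrArg (fun m => m ≫ _) (ι_totalProj ..)).trans
            ((Category.id_comp _).trans (Category.comp_id _).symm))
        · exact (isZero_obj_obj_of_isZero T (hK p hp) _).eq_of_src _ _ }) (by
    rintro n _ rfl
    have hd : K.d a (a + 1) = 0 := (hK (a + 1) (by lia)).eq_of_tgt _ _
    have h₁ : a + (n + -a) = n := by ring
    have h₂ : a + 1 + (n + -a) = n + 1 := by ring
    have h₃ : a + (n + -a + 1) = n + 1 := by ring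
    have h₄ : n + 1 + -a = n + -a + 1 := by ring
    have h₅ : a + (n + 1 + -a) = n + 1 := by ring
    refine (ι_mapBifunctor_d T K L a (n + -a) n (n + 1) h₁ h₂ h₃).trans ?_
    rw [hd, T.map_zero, zero_app, zero_comp, smul_zero, zero_add]
    have : ∀ (q q' : ℤ) (h : q' = q + 1) (hq : a + q' = n + 1),
      (T.obj (K.X a)).map (L.d (n + -a) (q + 1)) ≫
        ιMapBifunctor K L T (.up ℤ) a (q + 1) (n + 1) (by subst h; exact hq) =
      (T.obj (K.X a)).map (L.d (n + -a) q') ≫ ιMapBifunctor K L T (.up ℤ) a q' (n + 1) hq := by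
      rintro q _ rfl _
      rfl
    refine (congrArg (fun m => ComplexShape.ε₂ (.up ℤ) (.up ℤ) (.up ℤ) (a, n + -a) • m)
      (this (n + -a) (n + 1 + -a) h₄ h₅)).trans ?_
    refine Eq.trans ?_ (Linear.units_smul_comp (r := (-a).negOnePow)
      (f := (T.obj (K.X a)).map (L.d (n + -a) (n + 1 + -a)))
      (g := ιMapBifunctor K L T (.up ℤ) a (n + 1 + -a) (n + 1) h₅)).symm
    -- The shift by `-a` puts the sign of `-a` on the differential and the total complex puts that
    -- of `a`; they coincide.
    rw [Int.negOnePow_neg]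
    rfl)

lemma totalConcentratedIso_naturality (K : CochainComplex A₁ ℤ) (a : ℤ)
    (hK : ∀ p, p ≠ a → IsZero (K.X p)) {L L' : CochainComplex A₂ ℤ} (φ : L ⟶ L') :
    (((T.obj (K.X a)).mapHomologicalComplex _).map φ)⟦-a⟧' ≫
      (totalConcentratedIso T K a hK L').hom =
    (totalConcentratedIso T K a hK L).hom ≫ mapBifunctorMap (𝟙 K) φ T (.up ℤ) := by
  ext n
  refine Eq.trans ?_ (ι_mapBifunctorMap ..).symm
  rw [id_f, T.map_id]
  exact (Category.id_comp _).symm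

/-- Such a total complex is, naturally in `L`, a shift of its only row. -/
lemma quasiIso_mapBifunctorMap_of_concentrated (K : CochainComplex A₁ ℤ) (a : ℤ)
    (hK : ∀ p, p ≠ a → IsZero (K.X p)) {L L' : CochainComplex A₂ ℤ} (φ : L ⟶ L')
    (hφ : QuasiIso (((T.obj (K.X a)).mapHomologicalComplex _).map φ)) :
    QuasiIso (mapBifunctorMap (𝟙 K) φ T (.up ℤ)) := by
  rw [← CochainComplex.quasiIso_shift_iff _ (-a)] at hφ
  refine (quasiIso_iff_of_arrow_mk_iso _ _ (Arrow.isoMk (totalConcentratedIso T K a hK L)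
    (totalConcentratedIso T K a hK L') ?_)).1 hφ
  exact (totalConcentratedIso_naturality T K a hK φ).symm

lemma isZero_mapBifunctor_X (K : CochainComplex A₁ ℤ) (L : CochainComplex A₂ ℤ) (a b n : ℤ)
    (hK : K.IsStrictlyGE a) (hL : L.IsStrictlyGE b) (hn : n < a + b) :
    IsZero ((mapBifunctor K L T (.up ℤ)).X n) := by
  rw [IsZero.iff_id_eq_zero]
  apply mapBifunctor.hom_ext
  intro p q (h : p + q = n)
  refine IsZero.eq_of_src ?_ _ _
  by_cases hp : p < a
  · exact isZero_obj_obj_of_isZero T (K.isZero_of_isStrictlyGE a p hp) _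
  · exact (T.obj (K.X p)).map_isZero (L.isZero_of_isStrictlyGE b q (by lia))

/-- The identity of a term of the total complex of bounded below complexes is the sum of the
projections to the summands. -/
lemma sum_totalProj (K : CochainComplex A₁ ℤ) (L : CochainComplex A₂ ℤ) (a b n : ℤ)
    (hK : K.IsStrictlyGE a) (hL : L.IsStrictlyGE b) :
    ∑ p ∈ Finset.Icc a (n - b), totalProj T K L p (n - p) n (by lia) ≫
      ιMapBifunctor K L T (.up ℤ) p (n - p) n (show p + (n - p) = n by lia) = 𝟙 _ := by
  apply mapBifunctor.hom_ext
  intro p q (h : p + q = n)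
  obtain rfl : q = n - p := by lia
  rw [Preadditive.comp_sum]
  by_cases hp : p ∈ Finset.Icc a (n - b)
  · rw [Finset.sum_eq_single_of_mem p hp]
    · rw [← Category.assoc, ι_totalProj]
      exact (Category.id_comp _).trans (Category.comp_id _).symm
    · intro p' _ hne
      rw [← Category.assoc, ι_totalProj_of_ne _ _ _ _ _ _ _ _ _ _ hne.symm, zero_comp]
  · refine IsZero.eq_of_src ?_ _ _
    by_cases hp' : p < a
    · exact isZero_obj_obj_of_isZero T (K.isZero_of_isStrictlyGE a p hp') _
    · rw [Finset.mem_Icc, not_and] at hp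
      have := hp (by lia)
      exact (T.obj (K.X p)).map_isZero (L.isZero_of_isStrictlyGE b _ (by lia))

end Total

/-! ### Splitting off the bottom term of a bounded below complex -/

section Truncation

variable {C : Type*} [Category* C] [Abelian C]

/-- The projection of a complex vanishing below degree `a` to its term of degree `a`. -/
def toBottom (K : CochainComplex C ℤ) (a : ℤ) (hK : K.IsStrictlyGE a) :
    K ⟶ (HomologicalComplex.single C (.up ℤ) a).obj (K.X a) :=
  mkHomToSingle (𝟙 _) fun i (hi : i + 1 = a) =>
    (K.isZero_of_isStrictlyGE a i (by lia)).eq_of_src _ _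

instance (K : CochainComplex C ℤ) (a : ℤ) (hK : K.IsStrictlyGE a) :
    IsIso ((toBottom K a hK).f a) := by
  have h : (toBottom K a hK).f a = 𝟙 _ ≫ (singleObjXSelf (.up ℤ) a (K.X a)).inv :=
    mkHomToSingle_f _ _
  rw [h]
  infer_instance

/-- The short complex expressing a complex as an extension of its bottom term. -/
abbrev bottomShortComplex (K : CochainComplex C ℤ) (a : ℤ) (hK : K.IsStrictlyGE a) :
    ShortComplex (CochainComplex C ℤ) :=
  ShortComplex.mk (kernel.ι (toBottom K a hK)) (toBottom K a hK) (kernel.condition _)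

lemma shortExact_bottomShortComplex (K : CochainComplex C ℤ) (a : ℤ) (hK : K.IsStrictlyGE a) :
    (bottomShortComplex K a hK).ShortExact where
  exact := ShortComplex.exact_kernel _
  epi_g := by
    have : ∀ i, Epi ((toBottom K a hK).f i) := fun i => by
      by_cases hi : i = a
      · subst hi
        infer_instance
      · exact (HomologicalComplex.isZero_single_obj_X _ _ _ _ hi).epi _
    exact HomologicalComplex.epi_of_epi_f _ this

lemma shortExact_bottomShortComplex_map_eval (K : CochainComplex C ℤ) (a : ℤ)
    (hK : K.IsStrictlyGE a) (n : ℤ) :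
    ((bottomShortComplex K a hK).map (HomologicalComplex.eval _ _ n)).ShortExact :=
  (shortExact_bottomShortComplex K a hK).map_of_exact _

lemma isZero_kernel_toBottom (K : CochainComplex C ℤ) (a : ℤ) (hK : K.IsStrictlyGE a) :
    IsZero ((kernel (toBottom K a hK)).X a) := by
  have h := shortExact_bottomShortComplex_map_eval K a hK a
  have := h.mono_f
  refine IsZero.of_mono_eq_zero ((kernel.ι (toBottom K a hK)).f a) ?_
  rw [← cancel_mono ((toBottom K a hK).f a), zero_comp]
  exact ((bottomShortComplex K a hK).map (HomologicalComplex.eval _ _ a)).zero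

lemma isIso_kernel_ι_toBottom (K : CochainComplex C ℤ) (a : ℤ) (hK : K.IsStrictlyGE a) (n : ℤ)
    (hn : n ≠ a) : IsIso ((kernel.ι (toBottom K a hK)).f n) :=
  (shortExact_bottomShortComplex_map_eval K a hK n).isIso_f_iff.2
    (HomologicalComplex.isZero_single_obj_X (.up ℤ) _ _ _ hn)

/-- A complex is degreewise the direct sum of its bottom term and its truncation. -/
def bottomSplitting (K : CochainComplex C ℤ) (a : ℤ) (hK : K.IsStrictlyGE a) (n : ℤ) :
    ((bottomShortComplex K a hK).map (HomologicalComplex.eval _ _ n)).Splitting :=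
  if hn : n = a then
    ShortComplex.Splitting.ofIsZeroOfIsIso _ (by subst hn; exact isZero_kernel_toBottom K n hK)
      (by subst hn; exact inferInstanceAs (IsIso ((toBottom K n hK).f n)))
  else
    ShortComplex.Splitting.ofIsIsoOfIsZero _ (isIso_kernel_ι_toBottom K a hK n hn)
      (HomologicalComplex.isZero_single_obj_X (.up ℤ) _ _ _ hn)

lemma isStrictlyGE_kernel_toBottom (K : CochainComplex C ℤ) (a : ℤ) (hK : K.IsStrictlyGE a) :
    (kernel (toBottom K a hK)).IsStrictlyGE (a + 1) := by
  rw [CochainComplex.isStrictlyGE_iff]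
  intro i hi
  by_cases h : i = a
  · subst h
    exact isZero_kernel_toBottom K i hK
  · have := isIso_kernel_ι_toBottom K a hK i h
    exact (K.isZero_of_isStrictlyGE a i (by lia)).of_iso (asIso ((kernel.ι (toBottom K a hK)).f i))

end Truncation

/-! ### Rowwise quasi-isomorphisms induce quasi-isomorphisms of total complexes -/

section TotalQuasiIso

variable {A₁ A₂ D : Type*} [Category* A₁] [Category* A₂] [Category* D] [Abelian A₁] [Abelian A₂]
  [Abelian D] (T : A₁ ⥤ A₂ ⥤ D) [T.Additive] [∀ A, (T.obj A).Additive]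
  [∀ (K : CochainComplex A₁ ℤ) (L : CochainComplex A₂ ℤ),
    HasMapBifunctor K L T (ComplexShape.up ℤ)]

lemma quasiIso_row_of_iso {A A' : A₁} (e : A ≅ A') {L L' : CochainComplex A₂ ℤ} (φ : L ⟶ L')
    (h : QuasiIso (((T.obj A).mapHomologicalComplex (.up ℤ)).map φ)) :
    QuasiIso (((T.obj A').mapHomologicalComplex (.up ℤ)).map φ) := by
  refine (quasiIso_iff_of_arrow_mk_iso _ _ (Arrow.isoMk
    ((NatIso.mapHomologicalComplex (T.mapIso e) _).app L)
    ((NatIso.mapHomologicalComplex (T.mapIso e) _).app L') ?_)).1 h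
  exact ((NatIso.mapHomologicalComplex (T.mapIso e) _).hom.naturality φ).symm

lemma quasiIso_row_of_isZero {A : A₁} (hA : IsZero A) {L L' : CochainComplex A₂ ℤ} (φ : L ⟶ L') :
    QuasiIso (((T.obj A).mapHomologicalComplex (.up ℤ)).map φ) := by
  have : IsIso (((T.obj A).mapHomologicalComplex (.up ℤ)).map φ) := by
    have : ∀ n, IsIso ((((T.obj A).mapHomologicalComplex (.up ℤ)).map φ).f n) := fun n =>
      isIso_of_source_target_iso_zero _ (isZero_obj_obj_of_isZero T hA _).isoZero
        (isZero_obj_obj_of_isZero T hA _).isoZero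
    exact HomologicalComplex.Hom.isIso_of_components _
  infer_instance

lemma isZero_homology_mapBifunctor (K : CochainComplex A₁ ℤ) (L : CochainComplex A₂ ℤ) (a b n : ℤ)
    (hK : K.IsStrictlyGE a) (hL : L.IsStrictlyGE b) (hn : n < a + b) :
    IsZero ((mapBifunctor K L T (.up ℤ)).homology n) :=
  (HomologicalComplex.exactAt_iff_isZero_homology _ _).1
    (ShortComplex.exact_of_isZero_X₂ _ (isZero_mapBifunctor_X T K L a b n hK hL hn))

lemma quasiIso_row_kernel_toBottom (a : ℤ) (K : CochainComplex A₁ ℤ)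
    (hK : K.IsStrictlyGE a) {L L' : CochainComplex A₂ ℤ} (φ : L ⟶ L')
    (hφ : ∀ p, QuasiIso (((T.obj (K.X p)).mapHomologicalComplex (.up ℤ)).map φ)) (p : ℤ) :
    QuasiIso
      (((T.obj ((kernel (toBottom K a hK)).X p)).mapHomologicalComplex (.up ℤ)).map φ) := by
  by_cases hp : p = a
  · subst hp
    exact quasiIso_row_of_isZero T (isZero_kernel_toBottom K p hK) φ
  · have := isIso_kernel_ι_toBottom K a hK p hp
    exact quasiIso_row_of_iso T (asIso ((kernel.ι (toBottom K a hK)).f p)).symm φ (hφ p)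

lemma quasiIso_mapBifunctorMap_single (a : ℤ) (K : CochainComplex A₁ ℤ)
    {L L' : CochainComplex A₂ ℤ} (φ : L ⟶ L')
    (hφ : ∀ p, QuasiIso (((T.obj (K.X p)).mapHomologicalComplex (.up ℤ)).map φ)) :
    QuasiIso (mapBifunctorMap (𝟙 ((HomologicalComplex.single A₁ (.up ℤ) a).obj (K.X a))) φ T
      (.up ℤ)) :=
  quasiIso_mapBifunctorMap_of_concentrated T _ a
    (fun _ hp => HomologicalComplex.isZero_single_obj_X (.up ℤ) _ _ _ hp) φ
    (quasiIso_row_of_iso T (HomologicalComplex.singleObjXSelf (.up ℤ) a (K.X a)).symm φ (hφ a))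

/-- Each induction step removes the bottom term of `K`, raising `a` by one. When `n` drops below the
sum of the bounds, the total complexes vanish in degree `n`, so a fixed degree needs finitely many
steps. -/
lemma mono_homologyMap_mapBifunctorMap (m : ℕ) (a b : ℤ) (K : CochainComplex A₁ ℤ)
    (hK : K.IsStrictlyGE a) {L L' : CochainComplex A₂ ℤ} (hL : L.IsStrictlyGE b) (φ : L ⟶ L')
    (hφ : ∀ p, QuasiIso (((T.obj (K.X p)).mapHomologicalComplex (.up ℤ)).map φ))
    (n : ℤ) (hn : n < a + b + m) :
    Mono (homologyMap (mapBifunctorMap (𝟙 K) φ T (.up ℤ)) n) := by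
  induction m generalizing a K with
  | zero => exact (isZero_homology_mapBifunctor T K L a b n hK hL (by simpa using hn)).mono _
  | succ m ih =>
    exact mono_homologyMap_τ₂ (totalShortComplexMap T (bottomShortComplex K a hK) φ)
      (shortExact_totalShortComplex T _ (bottomSplitting K a hK) L)
      (shortExact_totalShortComplex T _ (bottomSplitting K a hK) L') n
      (ih (a + 1) _ (isStrictlyGE_kernel_toBottom K a hK)
        (quasiIso_row_kernel_toBottom T a K hK φ hφ) (by push_cast at hn ⊢; lia))
      (quasiIso_mapBifunctorMap_single T a K φ hφ)

/-- The same induction. The four lemma also asks for injectivity in degree `n + 1` on the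
truncation, which is why the previous lemma comes first and is applied with `m + 1` steps. -/
lemma epi_homologyMap_mapBifunctorMap (m : ℕ) (a b : ℤ) (K : CochainComplex A₁ ℤ)
    (hK : K.IsStrictlyGE a) {L L' : CochainComplex A₂ ℤ} (hL : L.IsStrictlyGE b)
    (hL' : L'.IsStrictlyGE b) (φ : L ⟶ L')
    (hφ : ∀ p, QuasiIso (((T.obj (K.X p)).mapHomologicalComplex (.up ℤ)).map φ))
    (n : ℤ) (hn : n < a + b + m) :
    Epi (homologyMap (mapBifunctorMap (𝟙 K) φ T (.up ℤ)) n) := by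
  induction m generalizing a K with
  | zero => exact (isZero_homology_mapBifunctor T K L' a b n hK hL' (by simpa using hn)).epi _
  | succ m ih =>
    exact epi_homologyMap_τ₂ (totalShortComplexMap T (bottomShortComplex K a hK) φ)
      (shortExact_totalShortComplex T _ (bottomSplitting K a hK) L)
      (shortExact_totalShortComplex T _ (bottomSplitting K a hK) L') n
      (ih (a + 1) _ (isStrictlyGE_kernel_toBottom K a hK)
        (quasiIso_row_kernel_toBottom T a K hK φ hφ) (by push_cast at hn ⊢; lia))
      (mono_homologyMap_mapBifunctorMap T (m + 1) (a + 1) b _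
        (isStrictlyGE_kernel_toBottom K a hK) hL φ
        (quasiIso_row_kernel_toBottom T a K hK φ hφ) (n + 1) (by push_cast at hn ⊢; lia))
      (quasiIso_mapBifunctorMap_single T a K φ hφ)

/-- A morphism of bounded below complexes which induces quasi-isomorphisms on the rows of the
double complexes induces a quasi-isomorphism of total complexes. -/
lemma quasiIso_mapBifunctorMap (a b : ℤ) (K : CochainComplex A₁ ℤ)
    (hK : K.IsStrictlyGE a) {L L' : CochainComplex A₂ ℤ} (hL : L.IsStrictlyGE b)
    (hL' : L'.IsStrictlyGE b) (φ : L ⟶ L')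
    (hφ : ∀ p, QuasiIso (((T.obj (K.X p)).mapHomologicalComplex (.up ℤ)).map φ)) :
    QuasiIso (mapBifunctorMap (𝟙 K) φ T (.up ℤ)) where
  quasiIsoAt n := by
    rw [quasiIsoAt_iff_isIso_homologyMap]
    -- Enough truncation steps to move the remaining total complex beyond degree `n`.
    have hn : n < a + b + (n - (a + b) + 1).toNat := by lia
    have := mono_homologyMap_mapBifunctorMap T _ a b K hK hL φ hφ n hn
    have := epi_homologyMap_mapBifunctorMap T _ a b K hK hL hL' φ hφ n hn
    exact isIso_of_mono_of_epi _

/-- The symmetric version of `quasiIso_mapBifunctorMap`. -/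
lemma quasiIso_mapBifunctorMap' [∀ B, (T.flip.obj B).Additive]
    (a b : ℤ) {K K' : CochainComplex A₁ ℤ}
    (hK : K.IsStrictlyGE a) (hK' : K'.IsStrictlyGE a) {L : CochainComplex A₂ ℤ}
    (hL : L.IsStrictlyGE b) (φ : K ⟶ K')
    (hφ : ∀ q, QuasiIso (((T.flip.obj (L.X q)).mapHomologicalComplex (.up ℤ)).map φ)) :
    QuasiIso (mapBifunctorMap φ (𝟙 L) T (.up ℤ)) := by
  have : T.flip.Additive := ⟨by
    intro B B' φ ψ
    ext A
    exact (T.obj A).map_add⟩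
  -- The flip isomorphism exchanges rows and columns, reducing to the previous case.
  refine (quasiIso_iff_of_arrow_mk_iso _ _ (Arrow.isoMk (mapBifunctorFlipIso K L T (.up ℤ))
    (mapBifunctorFlipIso K' L T (.up ℤ)) ?_)).1
      (quasiIso_mapBifunctorMap T.flip b a L hL hK hK' φ hφ)
  exact (mapBifunctorFlipIso_hom_naturality ..).symm

end TotalQuasiIso

/-! ### Total complexes as a functor of two bounded below complexes -/

section TotalPlus

variable {A : Type*} [Category* A] [Preadditive A] (T : A ⥤ A ⥤ A) [T.Additive]
  [∀ F, (T.obj F).Additive]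
  [∀ K M : CochainComplex A ℤ, HasMapBifunctor K M T (ComplexShape.up ℤ)]

lemma totalPlus_map_hom {K K' L L' : CochainComplex.Plus A} (φ : K ⟶ K') (ψ : L ⟶ L') :
    ((totalPlus T).map (Prod.mkHom φ ψ)).hom = mapBifunctorMap φ.hom ψ.hom T (.up ℤ) := by
  ext n : 1
  apply mapBifunctor.hom_ext
  intro p q h
  refine Eq.trans ?_ (ι_mapBifunctorMap ..).symm
  refine (ι_mapBifunctorMap_assoc φ.hom (𝟙 L.obj) T (.up ℤ) p q n h
    ((mapBifunctorMap (𝟙 K'.obj) ψ.hom T (.up ℤ)).f n)).trans ?_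
  rw [ι_mapBifunctorMap, id_f, id_f, CategoryTheory.Functor.map_id, CategoryTheory.Functor.map_id,
    Category.id_comp, NatTrans.id_app, Category.id_comp]
  rfl

end TotalPlus

/-! ### Tensoring with termwise flat complexes preserves quasi-isomorphisms -/

section TensorComplex

variable {X : TopCat.{u}}

/-- A bounded below complex of sheaves all of whose terms are flat. -/
def IsTermFlat (K : CochainComplex.Plus (Sh X)) : Prop := ∀ n, IsFlat (K.obj.X n)

lemma tensorComplex_map_right_mem {K L L' : CochainComplex.Plus (Sh X)} (hK : IsTermFlat K)
    (φ : L ⟶ L') (hφ : qis X φ) : qis X ((tensorComplex X).map (Prod.mkHom (𝟙 K) φ)) := by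
  change QuasiIso ((tensorComplex X).map _).hom
  rw [totalPlus_map_hom]
  obtain ⟨a, ha⟩ := K.property
  obtain ⟨b, hb⟩ := L.property
  obtain ⟨b', hb'⟩ := L'.property
  refine quasiIso_mapBifunctorMap (tensorSheaf X) a (min b b') K.obj ha
    (L.obj.isStrictlyGE_of_ge (min b b') b (min_le_left _ _))
    (L'.obj.isStrictlyGE_of_ge (min b b') b' (min_le_right _ _)) φ.hom fun p => ?_
  have : QuasiIso φ.hom := hφ
  have := preservesHomology_tensorSheaf_obj (hK p)
  exact HomologicalComplex.quasiIso_map_of_preservesHomology φ.hom ((tensorSheaf X).obj (K.obj.X p))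

lemma tensorComplex_map_left_mem {K K' L : CochainComplex.Plus (Sh X)} (hL : IsTermFlat L)
    (φ : K ⟶ K') (hφ : qis X φ) : qis X ((tensorComplex X).map (Prod.mkHom φ (𝟙 L))) := by
  change QuasiIso ((tensorComplex X).map _).hom
  rw [totalPlus_map_hom]
  obtain ⟨a, ha⟩ := K.property
  obtain ⟨a', ha'⟩ := K'.property
  obtain ⟨b, hb⟩ := L.property
  refine quasiIso_mapBifunctorMap' (tensorSheaf X) (min a a') b
    (K.obj.isStrictlyGE_of_ge (min a a') a (min_le_left _ _))
    (K'.obj.isStrictlyGE_of_ge (min a a') a' (min_le_right _ _)) hb φ.hom fun p => ?_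
  have : QuasiIso φ.hom := hφ
  have := preservesHomology_tensorSheaf_flip_obj (hL p)
  exact HomologicalComplex.quasiIso_map_of_preservesHomology φ.hom
    ((tensorSheaf X).flip.obj (L.obj.X p))

end TensorComplex

end ProperImage

namespace ProperImage

open HomologicalComplex

/-! ### Functorial flat resolutions of bounded below complexes -/

section FlatResolution

variable {X : TopCat.{u}}

/-- The termwise flat cover of a complex. -/
def flatCoverComplexMap (K : CochainComplex (Sh X) ℤ) :
    ((flatCover X).mapHomologicalComplex _).obj K ⟶ K where
  f i := (flatCoverMap X).app (K.X i)
  comm' _ _ _ := ((flatCoverMap X).naturality _).symm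

lemma flatCoverComplexMap_naturality {K L : CochainComplex (Sh X) ℤ} (φ : K ⟶ L) :
    ((flatCover X).mapHomologicalComplex _).map φ ≫ flatCoverComplexMap L =
      flatCoverComplexMap K ≫ φ := by
  ext i : 1
  exact (flatCoverMap X).naturality (φ.f i)

instance (K : CochainComplex (Sh X) ℤ) : Epi (flatCoverComplexMap K) :=
  HomologicalComplex.epi_of_epi_f _ fun i =>
    inferInstanceAs (Epi ((flatCoverMap X).app (K.X i)))

/-- The short complex given by the termwise flat cover of a complex and its kernel. -/
abbrev flatShortComplex (K : CochainComplex (Sh X) ℤ) : ShortComplex (CochainComplex (Sh X) ℤ) :=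
  ShortComplex.mk (kernel.ι (flatCoverComplexMap K)) (flatCoverComplexMap K) (kernel.condition _)

lemma shortExact_flatShortComplex (K : CochainComplex (Sh X) ℤ) :
    (flatShortComplex K).ShortExact where
  exact := ShortComplex.exact_kernel _

/-- The functoriality of `flatShortComplex`. -/
abbrev flatShortComplexMap {K L : CochainComplex (Sh X) ℤ} (φ : K ⟶ L) :
    flatShortComplex K ⟶ flatShortComplex L where
  τ₁ := kernel.map _ _ (((flatCover X).mapHomologicalComplex _).map φ) φ
    (flatCoverComplexMap_naturality φ).symm
  τ₂ := ((flatCover X).mapHomologicalComplex _).map φ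
  τ₃ := φ
  comm₁₂ := by simp
  comm₂₃ := flatCoverComplexMap_naturality φ

lemma flatShortComplexMap_id (K : CochainComplex (Sh X) ℤ) :
    flatShortComplexMap (𝟙 K) = 𝟙 _ := by
  ext1
  · rw [← cancel_mono (kernel.ι (flatCoverComplexMap K))]
    simp
  · exact ((flatCover X).mapHomologicalComplex (.up ℤ)).map_id K
  · rfl

lemma flatShortComplexMap_comp {K L M : CochainComplex (Sh X) ℤ} (φ : K ⟶ L) (ψ : L ⟶ M) :
    flatShortComplexMap (φ ≫ ψ) = flatShortComplexMap φ ≫ flatShortComplexMap ψ := by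
  ext1
  · rw [← cancel_mono (kernel.ι (flatCoverComplexMap M))]
    simp
  · exact ((flatCover X).mapHomologicalComplex (.up ℤ)).map_comp φ ψ
  · rfl

variable (X) in
/-- The functorial resolution of a complex by a complex with flat terms. -/
def flatResolution : CochainComplex (Sh X) ℤ ⥤ CochainComplex (Sh X) ℤ where
  obj K := CochainComplex.mappingCone (flatShortComplex K).f
  map φ := CochainComplex.mappingCone.map _ _ _ _ (flatShortComplexMap φ).comm₁₂.symm
  map_id K := by
    refine Eq.trans ?_ (CochainComplex.mappingCone.map_id _)
    congr 1
    · exact congrArg (fun φ => φ.τ₁) (flatShortComplexMap_id K)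
    · exact congrArg (fun φ => φ.τ₂) (flatShortComplexMap_id K)
  map_comp φ ψ := by
    refine Eq.trans ?_ (CochainComplex.mappingCone.map_comp ..)
    congr 1
    · exact congrArg (fun φ => φ.τ₁) (flatShortComplexMap_comp φ ψ)
    · exact congrArg (fun φ => φ.τ₂) (flatShortComplexMap_comp φ ψ)

variable (X) in
/-- The augmentation of the flat resolution. -/
def flatResolutionMap : flatResolution X ⟶ 𝟭 _ where
  app K := CochainComplex.mappingCone.descShortComplex (flatShortComplex K)
  naturality _ _ φ :=
    CochainComplex.mappingCone.map_descShortComplex _ _ (flatShortComplexMap φ)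

/-- The cone of the inclusion of the kernel of an epimorphism is quasi-isomorphic to the target of
the epimorphism. -/
instance (K : CochainComplex (Sh X) ℤ) : QuasiIso ((flatResolutionMap X).app K) :=
  CochainComplex.mappingCone.quasiIso_descShortComplex (shortExact_flatShortComplex K)

instance (K : CochainComplex (Sh X) ℤ) (i : ℤ) : Mono ((flatShortComplex K).f.f i) :=
  inferInstanceAs (Mono ((HomologicalComplex.eval _ _ i).map (kernel.ι (flatCoverComplexMap K))))

/-- An element of a stalk of `A` is determined by its components in the torsion-free stalks of `B₁`
and `B₂`. -/
lemma isFlat_of_add_eq_id {A B₁ B₂ : Sh X} (r₁ : A ⟶ B₁) (i₁ : B₁ ⟶ A) (r₂ : A ⟶ B₂) (i₂ : B₂ ⟶ A)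
    (h : r₁ ≫ i₁ + r₂ ≫ i₂ = 𝟙 A) (h₁ : IsFlat B₁) (h₂ : IsFlat B₂) : IsFlat A := by
  have hinj : ∀ x (a : Stalk A x), stalkMap r₁ x a = 0 → stalkMap r₂ x a = 0 → a = 0 := by
    intro x a ha₁ ha₂
    rw [← stalkMap_id A x a, ← h, stalkMap_add, stalkMap_comp, stalkMap_comp, ha₁, ha₂, map_zero,
      map_zero, add_zero]
  rw [isFlat_iff] at h₁ h₂ ⊢
  intro x n a ha
  rw [or_iff_not_imp_left]
  intro hn
  exact hinj x a
    ((h₁ x n _ (by rw [← map_zsmul, ha, map_zero])).resolve_left hn)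
    ((h₂ x n _ (by rw [← map_zsmul, ha, map_zero])).resolve_left hn)

lemma isFlat_flatResolution (K : CochainComplex (Sh X) ℤ) (i : ℤ) :
    IsFlat (((flatResolution X).obj K).X i) := by
  have h := CochainComplex.mappingCone.id_X (flatShortComplex K).f i (i + 1) rfl
  refine isFlat_of_add_eq_id _ _ _ _ h
    (IsFlat.of_mono ((flatShortComplex K).f.f (i + 1)) (isFlat_flatCover _)) (isFlat_flatCover _)

/-- In degree `i` the cone contains the degree `i + 1` term of the kernel, so the bound drops by
exactly one. A longer resolution would not obviously stay bounded below. -/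
lemma isStrictlyGE_flatResolution (K : CochainComplex (Sh X) ℤ) (a : ℤ) (hK : K.IsStrictlyGE a) :
    ((flatResolution X).obj K).IsStrictlyGE (a - 1) := by
  have h : ∀ i, i < a → IsZero ((((flatCover X).mapHomologicalComplex (.up ℤ)).obj K).X i) :=
    fun i hi => (flatCover X).map_isZero (K.isZero_of_isStrictlyGE a i hi)
  rw [CochainComplex.isStrictlyGE_iff]
  intro i hi
  refine (CochainComplex.mappingCone.isZero_X_iff _ _).2 ⟨?_, h i (by lia)⟩
  exact (h (i + 1) (by lia)).of_mono ((flatShortComplex K).f.f (i + 1))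

variable (X) in
/-- The flat resolution on bounded below complexes. -/
def flatResolutionPlus : CochainComplex.Plus (Sh X) ⥤ CochainComplex.Plus (Sh X) :=
  ObjectProperty.lift _ (CochainComplex.Plus.ι (Sh X) ⋙ flatResolution X) fun K =>
    K.property.imp' (fun a => a - 1) fun a ha => isStrictlyGE_flatResolution K.obj a ha

variable (X) in
/-- The augmentation of the flat resolution on bounded below complexes. -/
def flatResolutionPlusMap : flatResolutionPlus X ⟶ 𝟭 _ where
  app K := ObjectProperty.homMk ((flatResolutionMap X).app K.obj)
  naturality _ _ φ := by
    ext : 1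
    exact (flatResolutionMap X).naturality φ.hom

lemma qis_flatResolutionPlusMap (K : CochainComplex.Plus (Sh X)) :
    qis X ((flatResolutionPlusMap X).app K) :=
  inferInstanceAs (QuasiIso ((flatResolutionMap X).app K.obj))

lemma isTermFlat_flatResolutionPlus (K : CochainComplex.Plus (Sh X)) :
    IsTermFlat ((flatResolutionPlus X).obj K) := fun n => isFlat_flatResolution K.obj n

lemma IsTermFlat.inverseImage {Y : TopCat.{u}} (f : Y ⟶ X) {K : CochainComplex.Plus (Sh X)}
    (hK : IsTermFlat K) : IsTermFlat ((ProperImage.inverseImage f).mapCochainComplexPlus.obj K) :=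
  fun n => (hK n).inverseImage f

end FlatResolution

end ProperImage

namespace ProperImage

/-! ### The bounded below derived category from complexes of injectives -/

section InjectiveLocalization

variable (C : Type*) [Category* C] [Abelian C] [EnoughInjectives C] [HasDerivedCategory C]

/-- Bounded below complexes of injectives are K-injective, so morphisms into them in the derived
category are homotopy classes of morphisms of complexes. -/
instance : ((InjectiveObject.ι C).mapHomotopyCategoryPlus ⋙
    (DerivedCategory.Plus.Qh : _ ⥤ DerivedCategory.Plus C)).Full where
  map_surjective {K L} φ := by
    obtain ⟨φ, rfl⟩ := (DerivedCategory.Plus.Qh_map_bijective_of_isKInjective _ _ (by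
      obtain ⟨L, rfl⟩ := HomotopyCategory.Plus.quotient_obj_surjective L
      exact inferInstanceAs (CochainComplex.IsKInjective
        (((InjectiveObject.ι C).mapHomologicalComplex (.up ℤ)).obj L.obj)))).2 φ
    obtain ⟨φ, rfl⟩ := (InjectiveObject.ι C).mapHomotopyCategoryPlus.map_surjective φ
    exact ⟨φ, rfl⟩

instance : ((InjectiveObject.ι C).mapHomotopyCategoryPlus ⋙
    (DerivedCategory.Plus.Qh : _ ⥤ DerivedCategory.Plus C)).Faithful where
  map_injective {K L} φ ψ h := by
    refine (InjectiveObject.ι C).mapHomotopyCategoryPlus.map_injective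
      ((DerivedCategory.Plus.Qh_map_bijective_of_isKInjective _ _ ?_).1 h)
    obtain ⟨L, rfl⟩ := HomotopyCategory.Plus.quotient_obj_surjective L
    exact inferInstanceAs (CochainComplex.IsKInjective
      (((InjectiveObject.ι C).mapHomologicalComplex (.up ℤ)).obj L.obj))

instance : ((InjectiveObject.ι C).mapHomotopyCategoryPlus ⋙
    (DerivedCategory.Plus.Qh : _ ⥤ DerivedCategory.Plus C)).EssSurj where
  mem_essImage X := by
    obtain ⟨n, hn⟩ := X.property
    have : X.IsGE n := (X.isGE_ι_obj_iff n).1 hn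
    obtain ⟨L, -, ⟨e⟩⟩ := DerivedCategory.Plus.exists_injective_nonempty_iso X n
    exact ⟨(HomotopyCategory.Plus.quotient _).obj L, ⟨e⟩⟩

instance : ((InjectiveObject.ι C).mapHomotopyCategoryPlus ⋙
    (DerivedCategory.Plus.Qh : _ ⥤ DerivedCategory.Plus C)).IsEquivalence where

/-- The bounded below derived category is a localization of the category of bounded below
complexes of injective objects. -/
instance : ((InjectiveObject.ι C).mapCochainComplexPlus ⋙ DerivedCategory.Plus.Q).IsLocalization
    ((CochainComplex.Plus.quasiIso C).inverseImage (InjectiveObject.ι C).mapCochainComplexPlus) :=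
  inferInstanceAs ((HomotopyCategory.Plus.quotient (InjectiveObject C) ⋙
    (InjectiveObject.ι C).mapHomotopyCategoryPlus ⋙
    (DerivedCategory.Plus.Qh : _ ⥤ DerivedCategory.Plus C)).IsLocalization _)

end InjectiveLocalization

/-! ### Acyclic complexes and their cycles -/

section Homology

variable {C : Type*} [Category* C] [Abelian C]

lemma quasiIso_f_of_acyclic {S : ShortComplex (CochainComplex C ℤ)} (hS : S.ShortExact)
    (h : S.X₃.Acyclic) : QuasiIso S.f where
  quasiIsoAt n := by
    rw [quasiIsoAt_iff_isIso_homologyMap]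
    have h' : ∀ n, IsZero (S.X₃.homology n) := fun n =>
      (HomologicalComplex.exactAt_iff_isZero_homology _ _).1 (h n)
    have : Mono (HomologicalComplex.homologyMap S.f n) :=
      (hS.homology_exact₁ (n - 1) n (by simp)).mono_g ((h' _).eq_of_src _ _)
    have : Epi (HomologicalComplex.homologyMap S.f n) :=
      (hS.homology_exact₂ n).epi_f ((h' _).eq_of_tgt _ _)
    exact isIso_of_mono_of_epi _

/-- The short complex `Z^n ⟶ K^n ⟶ Z^{n+1}` of a complex `K` with cycles `Z`. -/
abbrev cyclesShortComplex (K : CochainComplex C ℤ) (n : ℤ) : ShortComplex C :=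
  ShortComplex.mk (kernel.ι (K.d n (n + 1)))
    (kernel.lift (K.d (n + 1) (n + 1 + 1)) (K.d n (n + 1)) (K.d_comp_d _ _ _)) (by
      rw [← cancel_mono (kernel.ι _)]
      simp)

lemma shortExact_cyclesShortComplex (K : CochainComplex C ℤ) (n : ℤ) (h : K.ExactAt (n + 1)) :
    (cyclesShortComplex K n).ShortExact where
  exact := by
    let φ : cyclesShortComplex K n ⟶ ShortComplex.mk (kernel.ι (K.d n (n + 1))) (K.d n (n + 1))
      (kernel.condition _) :=
      { τ₁ := 𝟙 _
        τ₂ := 𝟙 _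
        τ₃ := kernel.ι _ }
    have : Mono φ.τ₃ := inferInstanceAs (Mono (kernel.ι _))
    have : Epi φ.τ₁ := inferInstanceAs (Epi (𝟙 _))
    have : IsIso φ.τ₂ := inferInstanceAs (IsIso (𝟙 _))
    exact (ShortComplex.exact_iff_of_epi_of_isIso_of_mono φ).2 (ShortComplex.exact_kernel _)
  epi_g := by
    rw [K.exactAt_iff' n (n + 1) (n + 1 + 1) (by simp) (by simp)] at h
    exact (ShortComplex.exact_iff_epi_kernel_lift _).1 h

end Homology

/-! ### Complexes of soft sheaves compute the derived proper direct image -/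

section SoftComplex

variable {X Y : TopCat.{u}} {f : Y ⟶ X}

lemma soft_of_isZero {F : Sh Y} (hF : IsZero F) : Soft f F :=
  soft_of_sum_eq_id (∅ : Finset Unit) (B := fun _ => F) (fun _ => 𝟙 F) (fun _ => 𝟙 F)
    (hF.eq_of_src _ _) (by simp)

/-- By acyclicity, Z^{n+1} is the quotient of K^n by Z^n, so softness propagates upwards from the
range where the complex vanishes. -/
lemma soft_cycles (hsep : IsSeparatedMap f) (hlp : IsLocallyProper f)
    (K : CochainComplex (Sh Y) ℤ) (a : ℤ) (ha : K.IsStrictlyGE a) (hK : ∀ n, Soft f (K.X n))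
    (hac : K.Acyclic) (n : ℤ) : Soft f (kernel (K.d n (n + 1))) := by
  -- The induction starts in degree `a - 1`, where the term of the complex, hence also its cycles,
  -- is zero.
  have h : ∀ m : ℕ, Soft f (kernel (K.d (a - 1 + m) (a - 1 + m + 1))) := by
    intro m
    induction m with
    | zero =>
      exact soft_of_isZero ((K.isZero_of_isStrictlyGE a _ (by simp)).of_mono (kernel.ι _))
    | succ m ih =>
      have := Soft.of_shortExact hsep hlp
        (shortExact_cyclesShortComplex K (a - 1 + m) (hac _)) ih (hK _)
      have e : a - 1 + ((m + 1 : ℕ) : ℤ) = a - 1 + m + 1 := by push_cast; ring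
      rw [e]
      exact this
  by_cases hn : n < a
  · exact soft_of_isZero ((K.isZero_of_isStrictlyGE a _ hn).of_mono (kernel.ι _))
  · obtain ⟨m, rfl⟩ : ∃ m : ℕ, n = a - 1 + m := ⟨(n - (a - 1)).toNat, by lia⟩
    exact h m

/-- The proper direct image of a bounded below acyclic complex of soft sheaves is acyclic. -/
lemma acyclic_properImage (hsep : IsSeparatedMap f) (hlp : IsLocallyProper f)
    (K : CochainComplex (Sh Y) ℤ) (a : ℤ) (ha : K.IsStrictlyGE a) (hK : ∀ n, Soft f (K.X n))
    (hac : K.Acyclic) : (((properImage f).mapHomologicalComplex _).obj K).Acyclic := by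
  intro n'
  obtain ⟨n, rfl⟩ : ∃ n, n' = n + 1 := ⟨n' - 1, by lia⟩
  -- The acyclic complex breaks up into short exact sequences of soft cycles, and f_(!) keeps each
  -- of them exact; the images are then spliced together.
  have hex : ∀ n, ((cyclesShortComplex K n).map (properImage f)).ShortExact := fun n =>
    properImage_map_shortExact hsep hlp (shortExact_cyclesShortComplex K n (hac _))
      (soft_cycles hsep hlp K a ha hK hac n)
  rw [HomologicalComplex.exactAt_iff' _ n (n + 1) (n + 1 + 1) (by simp) (by simp)]
  let F := properImage f
  let T : ShortComplex (Sh X) := ShortComplex.mk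
    (F.map (kernel.ι (K.d (n + 1) (n + 1 + 1)))) (F.map (K.d (n + 1) (n + 1 + 1))) (by
      rw [← F.map_comp, kernel.condition, F.map_zero])
  have hT : T.Exact := by
    let φ : (cyclesShortComplex K (n + 1)).map F ⟶ T :=
      { τ₁ := 𝟙 _
        τ₂ := 𝟙 _
        τ₃ := F.map (kernel.ι _)
        comm₂₃ := (Category.id_comp _).trans ((congrArg F.map (kernel.lift_ι ..).symm).trans
          (F.map_comp _ _)) }
    have : Mono φ.τ₃ := (hex (n + 1 + 1)).mono_f
    have : Epi φ.τ₁ := inferInstanceAs (Epi (𝟙 _))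
    have : IsIso φ.τ₂ := inferInstanceAs (IsIso (𝟙 _))
    exact (ShortComplex.exact_iff_of_epi_of_isIso_of_mono φ).1 (hex (n + 1)).exact
  -- Replacing the incoming term by the image of the cycles is harmless because f_(!) K^n maps onto
  -- it.
  let ψ : (((properImage f).mapHomologicalComplex _).obj K).sc' n (n + 1) (n + 1 + 1) ⟶ T :=
    { τ₁ := F.map (kernel.lift (K.d (n + 1) (n + 1 + 1)) (K.d n (n + 1)) (K.d_comp_d _ _ _))
      τ₂ := 𝟙 _
      τ₃ := 𝟙 _
      comm₁₂ := (F.map_comp _ _).symm.trans ((congrArg F.map (kernel.lift_ι ..)).trans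
        (Category.comp_id _).symm)
      comm₂₃ := (Category.id_comp _).trans (Category.comp_id _).symm }
  have : Epi ψ.τ₁ := (hex n).epi_g
  have : IsIso ψ.τ₂ := inferInstanceAs (IsIso (𝟙 _))
  have : Mono ψ.τ₃ := inferInstanceAs (Mono (𝟙 _))
  exact (ShortComplex.exact_iff_of_epi_of_isIso_of_mono ψ).2 hT

/-- The quotient complex is acyclic with soft terms, so its proper direct image is acyclic; softness
of the first complex keeps the sequence exact. -/
lemma quasiIso_properImage_map_f (hsep : IsSeparatedMap f) (hlp : IsLocallyProper f)
    {S : ShortComplex (CochainComplex (Sh Y) ℤ)} (hS : S.ShortExact) (a : ℤ)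
    (ha : S.X₂.IsStrictlyGE a) (h₁ : ∀ n, Soft f (S.X₁.X n)) (h₂ : ∀ n, Soft f (S.X₂.X n))
    (h : QuasiIso S.f) :
    QuasiIso (((properImage f).mapHomologicalComplex (.up ℤ)).map S.f) := by
  have hn : ∀ n, (S.map (HomologicalComplex.eval _ _ n)).ShortExact := fun n =>
    hS.map_of_exact _
  have hS' : (S.map ((properImage f).mapHomologicalComplex (.up ℤ))).ShortExact :=
    HomologicalComplex.shortExact_of_degreewise_shortExact _ fun n =>
      properImage_map_shortExact hsep hlp (hn n) (h₁ n)
  have := hS.epi_g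
  refine quasiIso_f_of_acyclic hS' (acyclic_properImage hsep hlp S.X₃ a ?_
    (fun n => Soft.of_shortExact hsep hlp (hn n) (h₁ n) (h₂ n)) (hS.acyclic_X₃ h))
  rw [CochainComplex.isStrictlyGE_iff]
  intro i hi
  have : Epi (S.g.f i) := (hn i).epi_g
  exact (S.X₂.isZero_of_isStrictlyGE a i hi).of_epi (S.g.f i)

variable [HasDerivedCategory.{w₁} (Sh X)] [HasDerivedCategory.{w₂} (Sh Y)]

lemma isIso_derivedProperImageUnit_of_injective (K : CochainComplex.Plus (InjectiveObject (Sh Y))) :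
    IsIso ((derivedProperImageUnit f).app
      ((InjectiveObject.ι (Sh Y)).mapCochainComplexPlus.obj K)) :=
  inferInstanceAs (IsIso ((properImage f).rightDerivedFunctorPlusUnit.app
      ((HomotopyCategory.Plus.quotient (Sh Y)).obj
        ((InjectiveObject.ι (Sh Y)).mapCochainComplexPlus.obj K))))

/-- The derived proper direct image of a bounded below complex of soft sheaves is computed by its
proper direct image. -/
lemma isIso_derivedProperImageUnit (hsep : IsSeparatedMap f) (hlp : IsLocallyProper f)
    (K : CochainComplex.Plus (Sh Y)) (hK : ∀ n, Soft f (K.obj.X n)) :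
    IsIso ((derivedProperImageUnit f).app K) := by
  obtain ⟨a, ha⟩ := K.property
  -- The injective resolution is chosen to be a monomorphism of complexes, so that its cokernel
  -- completes a short exact sequence.
  obtain ⟨I, i, hi, hi', hI, hI'⟩ :=
    CochainComplex.Plus.modelCategoryQuillen.exists_mono_quasiIso_injective K.obj (a - 1) a
  let J : CochainComplex (InjectiveObject (Sh Y)) ℤ :=
    HomologicalComplex.liftObjectProperty _ I hI
  have hJ : J.IsStrictlyGE (a - 1) := by
    rwa [← CochainComplex.isStrictlyGE_mapHomologicalComplex_obj_iff _ (InjectiveObject.ι _)]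
  let J' : CochainComplex.Plus (InjectiveObject (Sh Y)) := ⟨J, _, hJ⟩
  let s : K ⟶ (InjectiveObject.ι (Sh Y)).mapCochainComplexPlus.obj J' := ObjectProperty.homMk i
  have hs : IsIso ((Q Y).map s) := Localization.inverts (Q Y) (qis Y) _ hi'
  have hs' : IsIso ((Q X).map ((properImage f).mapCochainComplexPlus.map s)) := by
    refine Localization.inverts (Q X) (qis X) _ ?_
    let S : ShortComplex (CochainComplex (Sh Y) ℤ) := ShortComplex.mk i (cokernel.π i) (by simp)
    exact quasiIso_properImage_map_f hsep hlp (S := S)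
      { exact := ShortComplex.exact_cokernel i } (a - 1) hI' hK
      (fun n => have := hI n; soft_of_injective hsep hlp (I.X n)) hi'
  have := isIso_derivedProperImageUnit_of_injective (f := f) J'
  have h := (derivedProperImageUnit f).naturality s
  have h₁ : IsIso ((derivedProperImageUnit f).app K ≫ (derivedProperImage f).map ((Q Y).map s)) := by
    refine (congrArg (fun m => IsIso m) h).mp ?_
    exact IsIso.comp_isIso' hs' this
  exact IsIso.of_isIso_comp_right _ ((derivedProperImage f).map ((Q Y).map s))

end SoftComplex

end ProperImage

namespace ProperImage

/-! ### Left derived functors from functorial resolutions -/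

section LeftDerived

variable {C D H : Type*} [Category* C] [Category* D] [Category* H] (L : C ⥤ D)
  (W : MorphismProperty C) [L.IsLocalization W] {F : C ⥤ H} {R : C ⥤ C} (r : R ⟶ 𝟭 C)
  (hRF : W.IsInvertedBy (R ⋙ F))

/-- The counit of the left derived functor constructed from a functorial resolution. -/
def resolutionCounit : L ⋙ Localization.lift (R ⋙ F) hRF L ⟶ F :=
  (Localization.fac (R ⋙ F) hRF L).hom ≫ Functor.whiskerRight r F

lemma resolutionCounit_app (X : C) : (resolutionCounit L W r hRF).app X =
    (Localization.fac (R ⋙ F) hRF L).hom.app X ≫ F.map (r.app X) := rfl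

lemma isIso_resolutionCounit_app (X : C) (h : IsIso (F.map (r.app X))) :
    IsIso ((resolutionCounit L W r hRF).app X) := by
  rw [resolutionCounit_app]
  infer_instance

/-- The transformation `L ⋙ G ⟶ R ⋙ F` attached to a transformation `L ⋙ G ⟶ F`. -/
def resolutionNatTrans (hr : ∀ X, W (r.app X)) {G : D ⥤ H} (β : L ⋙ G ⟶ F) :
    L ⋙ G ⟶ R ⋙ F where
  app X := G.map (Localization.isoOfHom L W _ (hr X)).inv ≫ β.app (R.obj X)
  naturality X X' φ := by
    have h₁ : G.map (L.map (R.map φ)) ≫ β.app (R.obj X') = β.app (R.obj X) ≫ F.map (R.map φ) :=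
      β.naturality (R.map φ)
    have h₂ : L.map (R.map φ) ≫ L.map (r.app X') = L.map (r.app X) ≫ L.map φ := by
      rw [← L.map_comp, ← L.map_comp, r.naturality, Functor.id_map]
    have h₃ : L.map φ ≫ (Localization.isoOfHom L W _ (hr X')).inv =
        (Localization.isoOfHom L W _ (hr X)).inv ≫ L.map (R.map φ) := by
      rw [Iso.comp_inv_eq, Category.assoc, Localization.isoOfHom_hom, h₂,
        Localization.isoOfHom_inv_hom_id_assoc]
    change G.map (L.map φ) ≫ _ = _ ≫ F.map (R.map φ)
    rw [Category.assoc, ← h₁, ← Category.assoc, ← G.map_comp, h₃, G.map_comp, Category.assoc]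

/-- The lift to the left derived functor constructed from a functorial resolution. -/
def resolutionLift (hr : ∀ X, W (r.app X)) {G : D ⥤ H} (β : L ⋙ G ⟶ F) :
    G ⟶ Localization.lift (R ⋙ F) hRF L :=
  letI : Localization.Lifting L W (L ⋙ G) G := ⟨Iso.refl _⟩
  Localization.liftNatTrans L W (L ⋙ G) (R ⋙ F) G _ (resolutionNatTrans L W r hr β)

lemma resolutionLift_app (hr : ∀ X, W (r.app X)) {G : D ⥤ H} (β : L ⋙ G ⟶ F) (X : C) :
    (resolutionLift L W r hRF hr β).app (L.obj X) =
      G.map (Localization.isoOfHom L W _ (hr X)).inv ≫ β.app (R.obj X) ≫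
        (Localization.fac (R ⋙ F) hRF L).inv.app X := by
  let _ : Localization.Lifting L W (L ⋙ G) G := ⟨Iso.refl _⟩
  refine (Localization.liftNatTrans_app ..).trans ?_
  exact (Category.id_comp _).trans (Category.assoc _ _ _)

lemma resolutionLift_fac (hr : ∀ X, W (r.app X)) {G : D ⥤ H} (β : L ⋙ G ⟶ F) (X : C) :
    (resolutionLift L W r hRF hr β).app (L.obj X) ≫ (resolutionCounit L W r hRF).app X =
      β.app X := by
  have h : G.map (L.map (r.app X)) ≫ β.app X = β.app (R.obj X) ≫ F.map (r.app X) :=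
    β.naturality (r.app X)
  have h' : G.map (Localization.isoOfHom L W _ (hr X)).inv ≫ G.map (L.map (r.app X)) = 𝟙 _ := by
    rw [← G.map_comp, Localization.isoOfHom_inv_hom_id, G.map_id]
  rw [resolutionLift_app, resolutionCounit_app, Category.assoc, Category.assoc,
    Iso.inv_hom_id_app_assoc]
  refine (congrArg (fun m => _ ≫ m) h).symm.trans ?_
  rw [← Category.assoc, h']
  exact Category.id_comp _

/-- After localization every object is isomorphic to one in the image of `R`, and there the counit
is an isomorphism and can be cancelled. -/
lemma resolution_hom_ext (hr : ∀ X, W (r.app X)) (hRR : ∀ X, IsIso (F.map (r.app (R.obj X))))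
    {G : D ⥤ H} (γ γ' : G ⟶ Localization.lift (R ⋙ F) hRF L)
    (h : ∀ X, γ.app (L.obj X) ≫ (resolutionCounit L W r hRF).app X =
      γ'.app (L.obj X) ≫ (resolutionCounit L W r hRF).app X) : γ = γ' := by
  refine Localization.natTrans_ext L W fun X => ?_
  have hL : IsIso (L.map (r.app X)) := Localization.inverts L W _ (hr X)
  have := isIso_resolutionCounit_app L W r hRF (R.obj X) (hRR X)
  have h' : γ.app (L.obj (R.obj X)) = γ'.app (L.obj (R.obj X)) :=
    (cancel_mono ((resolutionCounit L W r hRF).app (R.obj X))).1 (h (R.obj X))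
  refine (cancel_epi (G.map (L.map (r.app X)))).1 ?_
  refine (γ.naturality _).trans (Eq.trans ?_ (γ'.naturality _).symm)
  rw [h']

/-- A functorial resolution such that `F` inverts weak equivalences between resolutions provides
a left derived functor of `F`. -/
lemma isLeftDerivedFunctor_of_resolution (hr : ∀ X, W (r.app X))
    (hRR : ∀ X, IsIso (F.map (r.app (R.obj X)))) :
    (Localization.lift (R ⋙ F) hRF L).IsLeftDerivedFunctor (resolutionCounit L W r hRF) W := by
  refine ⟨⟨⟨IsTerminal.ofUniqueHom (fun E => CostructuredArrow.homMk
    (resolutionLift L W r hRF hr E.hom) ?_) fun E γ => ?_⟩⟩⟩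
  · ext X
    exact resolutionLift_fac L W r hRF hr E.hom X
  · refine CostructuredArrow.hom_ext _ _ (resolution_hom_ext L W r hRF hr hRR _ _ fun X => ?_)
    exact (NatTrans.congr_app (CostructuredArrow.w γ) X).trans
      (resolutionLift_fac L W r hRF hr E.hom X).symm

/-- By uniqueness of left derived functors it suffices to look at the one built from the resolution,
whose counit at `X` is `F.map (r.app X)` up to an isomorphism. -/
lemma isIso_counit_of_resolution (hRF : W.IsInvertedBy (R ⋙ F)) (hr : ∀ X, W (r.app X))
    (hRR : ∀ X, IsIso (F.map (r.app (R.obj X)))) {LF : D ⥤ H} (α : L ⋙ LF ⟶ F)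
    [LF.IsLeftDerivedFunctor α W] (X : C) (h : IsIso (F.map (r.app X))) : IsIso (α.app X) := by
  have := isLeftDerivedFunctor_of_resolution L W r hRF hr hRR
  have h' := isIso_resolutionCounit_app L W r hRF X h
  let e := Functor.leftDerivedUnique _ LF α (resolutionCounit L W r hRF) W
  have he : e.hom.app (L.obj X) ≫ (resolutionCounit L W r hRF).app X = α.app X :=
    (Functor.leftDerived_fac_app _ (resolutionCounit L W r hRF) W _ _ X).trans
      (Category.comp_id _)
  rw [← he]
  infer_instance

end LeftDerived

/-! ### Existence and computation of the derived tensor product -/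

section DerivedTensor

variable {X : TopCat.{u}}

/-- Changing first the second variable uses flatness of `K`, then changing the first uses flatness
of `L'`; nothing is needed of the other two complexes. -/
lemma tensorComplex_map_mem {K K' L L' : CochainComplex.Plus (Sh X)} (hK : IsTermFlat K)
    (hL' : IsTermFlat L') (φ : K ⟶ K') (ψ : L ⟶ L') (hφ : qis X φ) (hψ : qis X ψ) :
    qis X ((tensorComplex X).map (Prod.mkHom φ ψ)) := by
  have h : Prod.mkHom φ ψ = Prod.mkHom (𝟙 K) ψ ≫ Prod.mkHom φ (𝟙 L') := by
    exact Prod.ext (Category.id_comp φ).symm (Category.comp_id ψ).symm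
  rw [h, Functor.map_comp]
  exact MorphismProperty.comp_mem _ _ _ (tensorComplex_map_right_mem hK ψ hψ)
    (tensorComplex_map_left_mem hL' φ hφ)

lemma qis_flatResolutionPlus_map {K L : CochainComplex.Plus (Sh X)} (φ : K ⟶ L) (hφ : qis X φ) :
    qis X ((flatResolutionPlus X).map φ) := by
  refine MorphismProperty.of_postcomp (W := qis X) (W' := qis X) _
    ((flatResolutionPlusMap X).app L) (qis_flatResolutionPlusMap L) ?_
  rw [(flatResolutionPlusMap X).naturality φ]
  exact MorphismProperty.comp_mem _ _ _ (qis_flatResolutionPlusMap K) hφ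

variable (X) in
/-- The augmentation of the flat resolution of pairs of complexes. -/
def flatResolutionPairMap : (flatResolutionPlus X).prod (flatResolutionPlus X) ⟶ 𝟭 _ where
  app K := Prod.mkHom ((flatResolutionPlusMap X).app K.1) ((flatResolutionPlusMap X).app K.2)
  naturality _ _ φ := Prod.ext ((flatResolutionPlusMap X).naturality φ.1)
    ((flatResolutionPlusMap X).naturality φ.2)

variable [HasDerivedCategory.{w₁} (Sh X)]

lemma isInvertedBy_flatResolutionPair : ((qis X).prod (qis X)).IsInvertedBy
    ((flatResolutionPlus X).prod (flatResolutionPlus X) ⋙ tensorComplex X ⋙ Q X) := by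
  intro K L φ hφ
  exact Localization.inverts (Q X) (qis X) _ (tensorComplex_map_mem
    (isTermFlat_flatResolutionPlus _) (isTermFlat_flatResolutionPlus _) _ _
    (qis_flatResolutionPlus_map _ hφ.1) (qis_flatResolutionPlus_map _ hφ.2))

/-- One flat factor suffices: the resolution of `K` is flat and so is `L`, which are the two
complexes required. -/
lemma isIso_flatResolutionPairMap (K L : CochainComplex.Plus (Sh X)) (hL : IsTermFlat L) :
    IsIso ((tensorComplex X ⋙ Q X).map ((flatResolutionPairMap X).app (K, L))) :=
  Localization.inverts (Q X) (qis X) _ (tensorComplex_map_mem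
    (isTermFlat_flatResolutionPlus _) hL _ _ (qis_flatResolutionPlusMap _)
    (qis_flatResolutionPlusMap _))

lemma qis_prod_flatResolutionPairMap (K : CochainComplex.Plus (Sh X) × CochainComplex.Plus (Sh X)) :
    (qis X).prod (qis X) ((flatResolutionPairMap X).app K) :=
  ⟨qis_flatResolutionPlusMap _, qis_flatResolutionPlusMap _⟩

variable (X) in
-- Resolving both variables turns pairs of quasi-isomorphisms into quasi-isomorphisms of tensor
-- products.
lemma hasDerivedTensor : HasDerivedTensor X :=
  have := isLeftDerivedFunctor_of_resolution ((Q X).prod (Q X)) ((qis X).prod (qis X))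
    (flatResolutionPairMap X) isInvertedBy_flatResolutionPair qis_prod_flatResolutionPairMap
    (fun _ => isIso_flatResolutionPairMap _ _ (isTermFlat_flatResolutionPlus _))
  Functor.HasLeftDerivedFunctor.mk' _ (resolutionCounit ((Q X).prod (Q X))
    ((qis X).prod (qis X)) (flatResolutionPairMap X) isInvertedBy_flatResolutionPair)

/-- The derived tensor product with a complex of flat sheaves is the tensor product. -/
lemma isIso_derivedTensorCounit [HasDerivedTensor X] (K L : CochainComplex.Plus (Sh X))
    (hL : IsTermFlat L) : IsIso ((derivedTensorCounit X).app (K, L)) :=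
  have : (derivedTensor X).IsLeftDerivedFunctor (derivedTensorCounit X) ((qis X).prod (qis X)) :=
    inferInstanceAs (Functor.IsLeftDerivedFunctor _
      ((tensorComplex X ⋙ Q X).totalLeftDerivedCounit ((Q X).prod (Q X))
        ((qis X).prod (qis X))) _)
  isIso_counit_of_resolution ((Q X).prod (Q X)) ((qis X).prod (qis X))
    (flatResolutionPairMap X) isInvertedBy_flatResolutionPair qis_prod_flatResolutionPairMap
    (fun _ => isIso_flatResolutionPairMap _ _ (isTermFlat_flatResolutionPlus _))
    (derivedTensorCounit X) (K, L) (isIso_flatResolutionPairMap K L hL)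

end DerivedTensor

end ProperImage

namespace ProperImage

open HomologicalComplex

/-! ### Naturality and invertibility of the projection morphism on total complexes -/

section TotalDesc

variable {A B : Type*} [Category* A] [Category* B] [Abelian A] [Abelian B]
  (P : A ⥤ B) [P.Additive] (T : A ⥤ A ⥤ A) (T' : B ⥤ B ⥤ B)
  [T.Additive] [∀ F, (T.obj F).Additive] [T'.Additive] [∀ F, (T'.obj F).Additive]
  [∀ K M : CochainComplex A ℤ, HasMapBifunctor K M T (ComplexShape.up ℤ)]
  [∀ K M : CochainComplex B ℤ, HasMapBifunctor K M T' (ComplexShape.up ℤ)]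

/-- The component in degree `n` of `totalDesc`. -/
def totalDescComponent (N L : CochainComplex B ℤ) (K M : CochainComplex A ℤ)
    (π : ∀ p q, (T'.obj (N.X p)).obj (L.X q) ⟶ P.obj ((T.obj (K.X p)).obj (M.X q))) (n : ℤ) :
    (mapBifunctor N L T' (.up ℤ)).X n ⟶ P.obj ((mapBifunctor K M T (.up ℤ)).X n) :=
  mapBifunctorDesc (fun p q h => π p q ≫ P.map (ιMapBifunctor K M T (.up ℤ) p q n h))

lemma ι_totalDescComponent (N L : CochainComplex B ℤ) (K M : CochainComplex A ℤ)
    (π : ∀ p q, (T'.obj (N.X p)).obj (L.X q) ⟶ P.obj ((T.obj (K.X p)).obj (M.X q)))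
    (p q n : ℤ) (h : p + q = n) :
    ιMapBifunctor N L T' (.up ℤ) p q n h ≫ totalDescComponent P T T' N L K M π n =
      π p q ≫ P.map (ιMapBifunctor K M T (.up ℤ) p q n h) :=
  ι_mapBifunctorDesc ..

lemma totalDescComponent_naturality {N L N' L' : CochainComplex B ℤ} {K M K' M' : CochainComplex A ℤ}
    (π : ∀ p q, (T'.obj (N.X p)).obj (L.X q) ⟶ P.obj ((T.obj (K.X p)).obj (M.X q)))
    (π' : ∀ p q, (T'.obj (N'.X p)).obj (L'.X q) ⟶ P.obj ((T.obj (K'.X p)).obj (M'.X q)))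
    (ν : N ⟶ N') (l : L ⟶ L') (κ : K ⟶ K') (μ : M ⟶ M')
    (h : ∀ p q, (T'.map (ν.f p)).app (L.X q) ≫ (T'.obj (N'.X p)).map (l.f q) ≫ π' p q =
      π p q ≫ P.map ((T.map (κ.f p)).app (M.X q) ≫ (T.obj (K'.X p)).map (μ.f q))) (n : ℤ) :
    (mapBifunctorMap ν l T' (.up ℤ)).f n ≫ totalDescComponent P T T' N' L' K' M' π' n =
      totalDescComponent P T T' N L K M π n ≫ P.map ((mapBifunctorMap κ μ T (.up ℤ)).f n) := by
  apply mapBifunctor.hom_ext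
  intro p q hpq
  rw [ι_mapBifunctorMap_assoc, ← Category.assoc (ιMapBifunctor N L T' _ _ _ _ _),
    ι_totalDescComponent _ _ _ _ _ _ _ _ _ _ _ hpq, ι_totalDescComponent _ _ _ _ _ _ _ _ _ _ _ hpq,
    Category.assoc, ← P.map_comp, ι_mapBifunctorMap, reassoc_of% (h p q), ← P.map_comp,
    Category.assoc]

/-- The inverse is the sum over `p` of projection, inverse of `π`, and inclusion. The sum is finite
since the complexes are bounded below, so the additive functor `P` respects it although it need not
preserve infinite coproducts. -/
lemma isIso_totalDescComponent {N L : CochainComplex B ℤ} {K M : CochainComplex A ℤ}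
    (π : ∀ p q, (T'.obj (N.X p)).obj (L.X q) ⟶ P.obj ((T.obj (K.X p)).obj (M.X q)))
    (hπ : ∀ p q, IsIso (π p q)) (a b : ℤ) (hN : N.IsStrictlyGE a) (hL : L.IsStrictlyGE b)
    (hK : K.IsStrictlyGE a) (hM : M.IsStrictlyGE b) (n : ℤ) :
    IsIso (totalDescComponent P T T' N L K M π n) := by
  have hn : ∀ p : ℤ, p + (n - p) = n := fun p => by ring
  let g : ∀ p, P.obj ((mapBifunctor K M T (.up ℤ)).X n) ⟶ (mapBifunctor N L T' (.up ℤ)).X n :=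
    fun p => P.map (totalProj T K M p (n - p) n (hn p)) ≫ inv (π p (n - p)) ≫
      ιMapBifunctor N L T' (.up ℤ) p (n - p) n (hn p)
  have hg : ∀ p, g p ≫ totalDescComponent P T T' N L K M π n =
      P.map (totalProj T K M p (n - p) n (hn p) ≫
        ιMapBifunctor K M T (.up ℤ) p (n - p) n (hn p)) := by
    intro p
    rw [Category.assoc, Category.assoc, ι_totalDescComponent _ _ _ _ _ _ _ _ _ _ _ (hn p),
      IsIso.inv_hom_id_assoc, P.map_comp]
  have hg' : ∀ p, totalDescComponent P T T' N L K M π n ≫ g p =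
      totalProj T' N L p (n - p) n (hn p) ≫
        ιMapBifunctor N L T' (.up ℤ) p (n - p) n (hn p) := by
    intro p
    apply mapBifunctor.hom_ext
    intro p' q' (h' : p' + q' = n)
    obtain rfl : q' = n - p' := by lia
    rw [← Category.assoc, ι_totalDescComponent _ _ _ _ _ _ _ _ _ _ _ h', Category.assoc,
      ← P.map_comp_assoc, ← Category.assoc (ιMapBifunctor N L T' _ _ _ _ _)]
    by_cases hp : p' = p
    · subst hp
      rw [ι_totalProj, ι_totalProj, P.map_id, Category.id_comp, IsIso.hom_inv_id_assoc,
        Category.id_comp]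
    · rw [ι_totalProj_of_ne _ _ _ _ _ _ _ _ _ _ hp, ι_totalProj_of_ne _ _ _ _ _ _ _ _ _ _ hp,
        P.map_zero, zero_comp, comp_zero, zero_comp]
  refine ⟨∑ p ∈ Finset.Icc a (n - b), g p, ?_, ?_⟩
  · rw [Preadditive.comp_sum, ← sum_totalProj T' N L a b n hN hL]
    exact Finset.sum_congr rfl fun p _ => hg' p
  · rw [Preadditive.sum_comp, ← P.map_id, ← sum_totalProj T K M a b n hK hM, P.map_sum]
    exact Finset.sum_congr rfl fun p _ => hg p

variable (I : B ⥤ A) [I.Additive]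
  (ρ : ∀ F G, (T'.obj (P.obj F)).obj G ⟶ P.obj ((T.obj F).obj (I.obj G)))
  (h₁ : ∀ {F F' : A} (φ : F ⟶ F') (G : B), (T'.map (P.map φ)).app G ≫ ρ F' G =
    ρ F G ≫ P.map ((T.map φ).app (I.obj G)))
  (h₂ : ∀ (F : A) {G G' : B} (ψ : G ⟶ G'), (T'.obj (P.obj F)).map ψ ≫ ρ F G' =
    ρ F G ≫ P.map ((T.obj F).map (I.map ψ)))

lemma totalProjectionPlus_naturality {K K' : CochainComplex.Plus A} {L L' : CochainComplex.Plus B}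
    (φ : K ⟶ K') (ψ : L ⟶ L') :
    (totalPlus T').map (Prod.mkHom (P.mapCochainComplexPlus.map φ) ψ) ≫
      totalProjectionPlus P T T' I ρ h₁ h₂ K' L' =
    totalProjectionPlus P T T' I ρ h₁ h₂ K L ≫ P.mapCochainComplexPlus.map
      ((totalPlus T).map (Prod.mkHom φ (I.mapCochainComplexPlus.map ψ))) := by
  have h : ∀ p q, (T'.map (P.map (φ.hom.f p))).app (L.obj.X q) ≫
      (T'.obj (P.obj (K'.obj.X p))).map (ψ.hom.f q) ≫ ρ (K'.obj.X p) (L'.obj.X q) =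
      ρ (K.obj.X p) (L.obj.X q) ≫ P.map ((T.map (φ.hom.f p)).app (I.obj (L.obj.X q)) ≫
        (T.obj (K'.obj.X p)).map (I.map (ψ.hom.f q))) := fun p q => by
    rw [h₂, reassoc_of% (h₁ (φ.hom.f p)), P.map_comp]
  have hn := totalDescComponent_naturality P T T'
    (N := (P.mapHomologicalComplex (.up ℤ)).obj K.obj)
    (N' := (P.mapHomologicalComplex (.up ℤ)).obj K'.obj)
    (M := (I.mapHomologicalComplex (.up ℤ)).obj L.obj)
    (M' := (I.mapHomologicalComplex (.up ℤ)).obj L'.obj)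
    (fun p q => ρ (K.obj.X p) (L.obj.X q)) (fun p q => ρ (K'.obj.X p) (L'.obj.X q))
    ((P.mapHomologicalComplex (.up ℤ)).map φ.hom) ψ.hom φ.hom
    ((I.mapHomologicalComplex (.up ℤ)).map ψ.hom) h
  have e₁ := totalPlus_map_hom T' (P.mapCochainComplexPlus.map φ) ψ
  have e₂ := totalPlus_map_hom T φ (I.mapCochainComplexPlus.map ψ)
  refine ObjectProperty.hom_ext _ (HomologicalComplex.hom_ext _ _ fun n => ?_)
  have l : ∀ (t : (totalPlus T').obj (P.mapCochainComplexPlus.obj K, L) ⟶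
        (totalPlus T').obj (P.mapCochainComplexPlus.obj K', L')) (m) (_ : t.hom = m),
      (t ≫ totalProjectionPlus P T T' I ρ h₁ h₂ K' L').hom.f n =
        m.f n ≫ (totalProjectionPlus P T T' I ρ h₁ h₂ K' L').hom.f n := by
    rintro t _ rfl
    rfl
  have r : ∀ (t : (totalPlus T).obj (K, I.mapCochainComplexPlus.obj L) ⟶
        (totalPlus T).obj (K', I.mapCochainComplexPlus.obj L')) (m) (_ : t.hom = m),
      (totalProjectionPlus P T T' I ρ h₁ h₂ K L ≫ P.mapCochainComplexPlus.map t).hom.f n =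
        (totalProjectionPlus P T T' I ρ h₁ h₂ K L).hom.f n ≫ P.map (m.f n) := by
    rintro t _ rfl
    rfl
  exact (l _ _ e₁).trans ((hn n).trans (r _ _ e₂).symm)

lemma isIso_totalProjectionPlus (K : CochainComplex.Plus A) (L : CochainComplex.Plus B)
    (hρ : ∀ p q, IsIso (ρ (K.obj.X p) (L.obj.X q))) :
    IsIso (totalProjectionPlus P T T' I ρ h₁ h₂ K L) := by
  obtain ⟨a, ha⟩ := K.property
  obtain ⟨b, hb⟩ := L.property
  have key : ∀ n, IsIso ((totalProjectionPlus P T T' I ρ h₁ h₂ K L).hom.f n) := fun n =>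
    isIso_totalDescComponent P T T'
      (N := (P.mapHomologicalComplex (.up ℤ)).obj K.obj)
      (M := (I.mapHomologicalComplex (.up ℤ)).obj L.obj)
      (fun p q => ρ (K.obj.X p) (L.obj.X q)) hρ a b inferInstance hb ha inferInstance n
  have h : IsIso (totalProjectionPlus P T T' I ρ h₁ h₂ K L).hom :=
    HomologicalComplex.Hom.isIso_of_components _
  have : IsIso ((CochainComplex.Plus.ι B).map (totalProjectionPlus P T T' I ρ h₁ h₂ K L)) := h
  exact isIso_of_fully_faithful (CochainComplex.Plus.ι B) _

end TotalDesc

/-! ### The projection morphism of complexes of sheaves -/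

section ProjectionComplex

variable {X Y : TopCat.{u}} {f : Y ⟶ X}

lemma projectionComplex_naturality {K K' : CochainComplex.Plus (Sh Y)}
    {L L' : CochainComplex.Plus (Sh X)} (φ : K ⟶ K') (ψ : L ⟶ L') :
    (tensorComplex X).map (Prod.mkHom ((properImage f).mapCochainComplexPlus.map φ) ψ) ≫
      projectionComplex f K' L' =
    projectionComplex f K L ≫ (properImage f).mapCochainComplexPlus.map
      ((tensorComplex Y).map (Prod.mkHom φ ((inverseImage f).mapCochainComplexPlus.map ψ))) :=
  totalProjectionPlus_naturality (properImage f) (tensorSheaf Y) (tensorSheaf X) (inverseImage f)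
    (projection f) (projection_naturality_left f) (projection_naturality_right f) φ ψ

/-- The projection morphism of complexes is an isomorphism for a complex of soft sheaves and a
complex of flat sheaves. -/
lemma isIso_projectionComplex (hsep : IsSeparatedMap f) (hlp : IsLocallyProper f)
    (K : CochainComplex.Plus (Sh Y)) (L : CochainComplex.Plus (Sh X))
    (hK : ∀ n, Soft f (K.obj.X n)) (hL : IsTermFlat L) : IsIso (projectionComplex f K L) :=
  isIso_totalProjectionPlus (properImage f) (tensorSheaf Y) (tensorSheaf X) (inverseImage f)
    (projection f) (projection_naturality_left f) (projection_naturality_right f) K L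
    fun p q => isIso_projection hsep hlp (hK p) (hL q)

/-- By boundedness each term is a finite sum of sheaves K^p ⊗ f^(*) L^q, and these are soft. -/
lemma soft_tensorComplex (hsep : IsSeparatedMap f) (hlp : IsLocallyProper f)
    (K : CochainComplex.Plus (Sh Y)) (L : CochainComplex.Plus (Sh X))
    (hK : ∀ n, Soft f (K.obj.X n)) (hL : IsTermFlat L) (n : ℤ) :
    Soft f (((tensorComplex Y).obj
      (K, (inverseImage f).mapCochainComplexPlus.obj L)).obj.X n) := by
  obtain ⟨a, ha⟩ := K.property
  obtain ⟨b, hb⟩ := L.property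
  exact soft_of_sum_eq_id _ _ _ (sum_totalProj (tensorSheaf Y) K.obj
    (((inverseImage f).mapHomologicalComplex (.up ℤ)).obj L.obj) a b n ha inferInstance)
    fun p _ => Soft.tensor hsep hlp (hK p) (hL (n - p))

end ProjectionComplex

end ProperImage

namespace ProperImage

/-! The derived projection formula is deduced from properties of the underived functors by a
formal argument: in this section `C₁` and `C₂` stand for `C⁺(Y)` and `C⁺(X)`, with localizations
`D₁` and `D₂`, the functors `S` and `S'` for the proper direct image and its derived functor, `I`
and `I'` for the inverse image, `T₁`, `T₂`, `T₁'`, `T₂'` for the tensor products and their derived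
functors, and `r : R ⟶ 𝟭` for a flat resolution. -/
section Formal

variable {C₁ C₂ D₁ D₂ : Type*} [Category* C₁] [Category* C₂] [Category* D₁] [Category* D₂]
  {Q₁ : C₁ ⥤ D₁} {Q₂ : C₂ ⥤ D₂} {S : C₁ ⥤ C₂} {S' : D₁ ⥤ D₂} (u : S ⋙ Q₂ ⟶ Q₁ ⋙ S')
  {I : C₂ ⥤ C₁} {I' : D₂ ⥤ D₁} (i : Q₂ ⋙ I' ≅ I ⋙ Q₁)
  {T₁ : C₁ × C₁ ⥤ C₁} {T₁' : D₁ × D₁ ⥤ D₁} (c₁ : Q₁.prod Q₁ ⋙ T₁' ⟶ T₁ ⋙ Q₁)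
  {T₂ : C₂ × C₂ ⥤ C₂} {T₂' : D₂ × D₂ ⥤ D₂} (c₂ : Q₂.prod Q₂ ⋙ T₂' ⟶ T₂ ⋙ Q₂)
  {R : C₂ ⥤ C₂} (r : R ⟶ 𝟭 C₂)
  {π : ∀ K L, T₂.obj (S.obj K, L) ⟶ S.obj (T₁.obj (K, I.obj L))}
  (hπ : ∀ {K K' L L'} (φ : K ⟶ K') (ψ : L ⟶ L'), T₂.map (Prod.mkHom (S.map φ) ψ) ≫ π K' L' =
    π K L ≫ S.map (T₁.map (Prod.mkHom φ (I.map ψ))))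

/-- The morphisms `(S K, R L) ⟶ (S' K, L)`. -/
def sourceResolutionMap : S.prod R ⋙ Q₂.prod Q₂ ⟶ Q₁.prod Q₂ ⋙ S'.prod (𝟭 D₂) where
  app K := Prod.mkHom (u.app K.1) (Q₂.map (r.app K.2))
  naturality _ _ φ := Prod.ext (u.naturality φ.1)
    ((Functor.whiskerRight r Q₂).naturality φ.2)

/-- The morphisms `(K, I (R L)) ⟶ (K, I' L)`. -/
def targetResolutionMap :
    (𝟭 C₁).prod (R ⋙ I) ⋙ Q₁.prod Q₁ ⟶ Q₁.prod Q₂ ⋙ (𝟭 D₁).prod I' where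
  app K := Prod.mkHom (𝟙 _) (i.inv.app _ ≫ I'.map (Q₂.map (r.app K.2)))
  naturality _ _ φ := Prod.ext ((Category.comp_id _).trans (Category.id_comp _).symm)
    ((Functor.whiskerLeft R i.inv ≫ Functor.whiskerRight r (Q₂ ⋙ I')).naturality φ.2)

lemma isIso_targetResolutionMap (K : C₁ × C₂) (hr : ∀ L, IsIso (Q₂.map (r.app L))) :
    IsIso ((targetResolutionMap (Q₁ := Q₁) i r).app K) :=
  have := hr K.2
  (isIso_prod_iff _ _).2 ⟨inferInstanceAs (IsIso (𝟙 _)), inferInstanceAs (IsIso (_ ≫ _))⟩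

lemma isIso_sourceResolutionMap (K : C₁ × C₂) (hr : ∀ L, IsIso (Q₂.map (r.app L)))
    (hu : IsIso (u.app K.1)) : IsIso ((sourceResolutionMap u r).app K) :=
  (isIso_prod_iff _ _).2 ⟨hu, hr K.2⟩

/-- The canonical morphism from `(S K) ⊗^L (R L)` to the source `(S' K) ⊗^L L` of the derived
projection morphism. -/
def toSource : (S.prod R ⋙ Q₂.prod Q₂) ⋙ T₂' ⟶ Q₁.prod Q₂ ⋙ S'.prod (𝟭 D₂) ⋙ T₂' :=
  Functor.whiskerRight (sourceResolutionMap u r) T₂'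

/-- The projection morphisms with values in a resolution. -/
def projectionResolution (R : C₂ ⥤ C₂) : S.prod R ⋙ T₂ ⟶ (𝟭 C₁).prod (R ⋙ I) ⋙ T₁ ⋙ S where
  app K := π K.1 (R.obj K.2)
  naturality _ _ φ := hπ φ.1 (R.map φ.2)

/-- The canonical morphism `S' (K ⊗^L I (R L)) ⟶ S' (K ⊗ I (R L))`. -/
def targetCounit (R : C₂ ⥤ C₂) (I : C₂ ⥤ C₁) (S' : D₁ ⥤ D₂) :
    (𝟭 C₁).prod (R ⋙ I) ⋙ Q₁.prod Q₁ ⋙ T₁' ⋙ S' ⟶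
      (𝟭 C₁).prod (R ⋙ I) ⋙ T₁ ⋙ Q₁ ⋙ S' :=
  Functor.whiskerLeft ((𝟭 C₁).prod (R ⋙ I)) (Functor.whiskerRight c₁ S')

lemma isIso_targetCounit (hc : ∀ K L, IsIso (c₁.app (K, I.obj (R.obj L)))) :
    IsIso (targetCounit c₁ R I S') := by
  have : ∀ K, IsIso ((targetCounit c₁ R I S').app K) := fun K =>
    have := hc K.1 K.2
    inferInstanceAs (IsIso (S'.map (c₁.app (K.1, I.obj (R.obj K.2)))))
  exact NatIso.isIso_of_isIso_app _

/-- The morphism from `(S K) ⊗^L (R L)` to the target `S' (K ⊗^L I' L)` of the derived projection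
morphism. -/
def toTarget (hc : ∀ K L, IsIso (c₁.app (K, I.obj (R.obj L)))) :
    (S.prod R ⋙ Q₂.prod Q₂) ⋙ T₂' ⟶ Q₁.prod Q₂ ⋙ (𝟭 D₁).prod I' ⋙ T₁' ⋙ S' :=
  (Functor.whiskerLeft (S.prod R) c₂ : (S.prod R ⋙ Q₂.prod Q₂) ⋙ T₂' ⟶ S.prod R ⋙ T₂ ⋙ Q₂) ≫
    (Functor.whiskerRight (projectionResolution hπ R) Q₂ :
      S.prod R ⋙ T₂ ⋙ Q₂ ⟶ (𝟭 C₁).prod (R ⋙ I) ⋙ T₁ ⋙ S ⋙ Q₂) ≫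
    (Functor.whiskerLeft ((𝟭 C₁).prod (R ⋙ I) ⋙ T₁) u :
      (𝟭 C₁).prod (R ⋙ I) ⋙ T₁ ⋙ S ⋙ Q₂ ⟶ (𝟭 C₁).prod (R ⋙ I) ⋙ T₁ ⋙ Q₁ ⋙ S') ≫
    have := isIso_targetCounit (S' := S') c₁ hc
    inv (targetCounit c₁ R I S') ≫
    (Functor.whiskerRight (targetResolutionMap i r) (T₁' ⋙ S') :
      (𝟭 C₁).prod (R ⋙ I) ⋙ Q₁.prod Q₁ ⋙ T₁' ⋙ S' ⟶ _)

lemma toTarget_app (hc : ∀ K L, IsIso (c₁.app (K, I.obj (R.obj L)))) (K : C₁) (L : C₂) :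
    have := hc K L
    (toTarget u i c₁ c₂ r hπ hc).app (K, L) =
      c₂.app (S.obj K, R.obj L) ≫ Q₂.map (π K (R.obj L)) ≫
      u.app (T₁.obj (K, I.obj (R.obj L))) ≫
      inv (S'.map (c₁.app (K, I.obj (R.obj L)))) ≫
      S'.map (T₁'.map (Prod.mkHom (𝟙 _) (i.inv.app _ ≫ I'.map (Q₂.map (r.app L))))) := by
  intro this
  have h := isIso_targetCounit (S' := S') c₁ hc
  have h' : (inv (targetCounit c₁ R I S')).app (K, L) =
      inv (S'.map (c₁.app (K, I.obj (R.obj L)))) := NatIso.isIso_inv_app _ _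
  rw [← h']
  rfl

lemma isIso_toTarget_app (hc : ∀ K L, IsIso (c₁.app (K, I.obj (R.obj L))))
    (hr : ∀ L, IsIso (Q₂.map (r.app L))) (K : C₁) (L : C₂)
    (h₁ : IsIso (c₂.app (S.obj K, R.obj L))) (h₂ : IsIso (π K (R.obj L)))
    (h₃ : IsIso (u.app (T₁.obj (K, I.obj (R.obj L))))) :
    IsIso ((toTarget u i c₁ c₂ r hπ hc).app (K, L)) := by
  have := hc K L
  have h₄ : IsIso (Prod.mkHom (𝟙 (Q₁.obj K)) (i.inv.app (R.obj L) ≫ I'.map (Q₂.map (r.app L)))) :=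
    isIso_targetResolutionMap i r (K, L) hr
  rw [toTarget_app]
  have h₅ : IsIso (S'.map (T₁'.map (Prod.mkHom (𝟙 (Q₁.obj K))
    (i.inv.app (R.obj L) ≫ I'.map (Q₂.map (r.app L)))))) := inferInstance
  refine IsIso.comp_isIso' h₁ (IsIso.comp_isIso' inferInstance
    (IsIso.comp_isIso' h₃ (IsIso.comp_isIso' inferInstance h₅)))

/-- The canonicity square with `L` replaced by its resolution: naturality moves the augmentation
`r.app L` past every arrow until the inverted counit cancels. -/
lemma toTarget_app_comp (hc : ∀ K L, IsIso (c₁.app (K, I.obj (R.obj L)))) (K : C₁) (L : C₂) :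
    (toTarget u i c₁ c₂ r hπ hc).app (K, L) ≫
      S'.map (T₁'.map (Prod.mkHom (𝟙 (Q₁.obj K)) (i.hom.app L)) ≫ c₁.app (K, I.obj L)) =
    T₂'.map (Prod.mkHom (𝟙 (Q₂.obj (S.obj K))) (Q₂.map (r.app L))) ≫
      c₂.app (S.obj K, L) ≫ Q₂.map (π K L) ≫ u.app (T₁.obj (K, I.obj L)) := by
  have := hc K L
  have e₁ : T₂'.map (Prod.mkHom (𝟙 (Q₂.obj (S.obj K))) (Q₂.map (r.app L))) ≫
      c₂.app (S.obj K, L) =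
      c₂.app (S.obj K, R.obj L) ≫ Q₂.map (T₂.map (Prod.mkHom (𝟙 (S.obj K)) (r.app L))) := by
    have := c₂.naturality (Prod.mkHom (𝟙 (S.obj K)) (r.app L))
    rw [← Q₂.map_id]
    exact this
  have e₂ : T₂.map (Prod.mkHom (𝟙 (S.obj K)) (r.app L)) ≫ π K L =
      π K (R.obj L) ≫ S.map (T₁.map (Prod.mkHom (𝟙 K) (I.map (r.app L)))) := by
    have := hπ (𝟙 K) (r.app L)
    rw [← S.map_id]
    exact this
  have e₃ : Q₂.map (S.map (T₁.map (Prod.mkHom (𝟙 K) (I.map (r.app L))))) ≫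
      u.app (T₁.obj (K, I.obj L)) = u.app (T₁.obj (K, I.obj (R.obj L))) ≫
        S'.map (Q₁.map (T₁.map (Prod.mkHom (𝟙 K) (I.map (r.app L))))) := u.naturality _
  have e₄ : T₁'.map (Prod.mkHom (𝟙 (Q₁.obj K)) (Q₁.map (I.map (r.app L)))) ≫
      c₁.app (K, I.obj L) =
      c₁.app (K, I.obj (R.obj L)) ≫ Q₁.map (T₁.map (Prod.mkHom (𝟙 K) (I.map (r.app L)))) := by
    have := c₁.naturality (Prod.mkHom (𝟙 K) (I.map (r.app L)))
    rw [← Q₁.map_id]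
    exact this
  have e₅ : I'.map (Q₂.map (r.app L)) ≫ i.hom.app L =
      i.hom.app (R.obj L) ≫ Q₁.map (I.map (r.app L)) := i.hom.naturality (r.app L)
  have e₆ : T₁'.map (Prod.mkHom (𝟙 (Q₁.obj K)) (i.inv.app (R.obj L) ≫ I'.map (Q₂.map (r.app L)))) ≫
      T₁'.map (Prod.mkHom (𝟙 (Q₁.obj K)) (i.hom.app L)) =
      T₁'.map (Prod.mkHom (𝟙 (Q₁.obj K)) (Q₁.map (I.map (r.app L)))) := by
    rw [← T₁'.map_comp]
    refine congrArg T₁'.map (Prod.ext (Category.comp_id _) ?_)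
    exact (Category.assoc _ _ _).trans ((congrArg (fun m => _ ≫ m) e₅).trans
      (Iso.inv_hom_id_app_assoc _ _ _))
  rw [toTarget_app, reassoc_of% e₁, ← Q₂.map_comp_assoc, e₂, Q₂.map_comp_assoc, e₃]
  simp only [Category.assoc]
  rw [← S'.map_comp, reassoc_of% e₆, e₄, S'.map_comp, IsIso.inv_hom_id_assoc]

/-- The formal derivation of the projection formula: `J` is the inclusion of a category of
complexes which suffices to compute the localization `D₁` and on which all the functors are computed
by underived functors. -/
lemma exists_projection_iso {C₀ : Type*} [Category* C₀] (J : C₀ ⥤ C₁) (W₀ : MorphismProperty C₀)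
    (W₂ : MorphismProperty C₂) [((J ⋙ Q₁).prod Q₂).IsLocalization (W₀.prod W₂)]
    (hπ : ∀ {K K' L L'} (φ : K ⟶ K') (ψ : L ⟶ L'), T₂.map (Prod.mkHom (S.map φ) ψ) ≫ π K' L' =
      π K L ≫ S.map (T₁.map (Prod.mkHom φ (I.map ψ))))
    (hr : ∀ L, IsIso (Q₂.map (r.app L)))
    (hc : ∀ K L, IsIso (c₁.app (K, I.obj (R.obj L))))
    (hJ : ∀ K, ∃ (M : C₀) (s : K ⟶ J.obj M), IsIso (Q₁.map s))
    (hu : ∀ M, IsIso (u.app (J.obj M)))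
    (h₁ : ∀ M L, IsIso (c₂.app (S.obj (J.obj M), R.obj L)))
    (h₂ : ∀ M L, IsIso (π (J.obj M) (R.obj L)))
    (h₃ : ∀ M L, IsIso (u.app (T₁.obj (J.obj M, I.obj (R.obj L))))) :
    ∃ e : S'.prod (𝟭 D₂) ⋙ T₂' ≅ (𝟭 D₁).prod I' ⋙ T₁' ⋙ S', ∀ (K : C₁) (L : C₂),
      T₂'.map (Prod.mkHom (u.app K) (𝟙 (Q₂.obj L))) ≫ e.hom.app (Q₁.obj K, Q₂.obj L) ≫
        S'.map (T₁'.map (Prod.mkHom (𝟙 (Q₁.obj K)) (i.hom.app L)) ≫ c₁.app (K, I.obj L)) =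
      c₂.app (S.obj K, L) ≫ Q₂.map (π K L) ≫ u.app (T₁.obj (K, I.obj L)) := by
  let α := toSource (T₂' := T₂') u r
  let β := toTarget u i c₁ c₂ r hπ hc
  let LI := (J ⋙ Q₁).prod Q₂
  let A := S'.prod (𝟭 D₂) ⋙ T₂'
  let B := (𝟭 D₁).prod I' ⋙ T₁' ⋙ S'
  have hα : ∀ K, IsIso ((Functor.whiskerLeft (J.prod (𝟭 C₂)) α).app K) := fun K =>
    have := isIso_sourceResolutionMap u r (J.obj K.1, K.2) hr (hu K.1)
    inferInstanceAs (IsIso (T₂'.map ((sourceResolutionMap u r).app (J.obj K.1, K.2))))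
  have hβ : ∀ K, IsIso ((Functor.whiskerLeft (J.prod (𝟭 C₂)) β).app K) := fun K =>
    isIso_toTarget_app u i c₁ c₂ r hπ hc hr (J.obj K.1) K.2 (h₁ _ _) (h₂ _ _) (h₃ _ _)
  have hα' : IsIso (Functor.whiskerLeft (J.prod (𝟭 C₂)) α) := NatIso.isIso_of_isIso_app _
  have hβ' : IsIso (Functor.whiskerLeft (J.prod (𝟭 C₂)) β) := NatIso.isIso_of_isIso_app _
  -- On objects coming from `C₀` both comparison morphisms out of (S K) ⊗^L (R L) are invertible.
  -- The resulting isomorphism descends to the localization.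
  let τ : LI ⋙ A ≅ LI ⋙ B :=
    (asIso (Functor.whiskerLeft (J.prod (𝟭 C₂)) α)).symm ≪≫
      asIso (Functor.whiskerLeft (J.prod (𝟭 C₂)) β)
  let _ : Localization.Lifting LI (W₀.prod W₂) (LI ⋙ A) A := ⟨Iso.refl _⟩
  let _ : Localization.Lifting LI (W₀.prod W₂) (LI ⋙ B) B := ⟨Iso.refl _⟩
  let e : A ≅ B := Localization.liftNatIso LI (W₀.prod W₂) (LI ⋙ A) (LI ⋙ B) A B τ
  have he : ∀ M L, α.app (J.obj M, L) ≫ e.hom.app (Q₁.obj (J.obj M), Q₂.obj L) =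
      β.app (J.obj M, L) := by
    intro M L
    have h : e.hom.app (Q₁.obj (J.obj M), Q₂.obj L) = τ.hom.app (M, L) :=
      (Localization.liftNatTrans_app LI (W₀.prod W₂) (LI ⋙ A) (LI ⋙ B) A B τ.hom (M, L)).trans
        ((Category.id_comp _).trans (Category.comp_id _))
    rw [h]
    exact NatTrans.congr_app ((asIso (Functor.whiskerLeft (J.prod (𝟭 C₂)) α)).hom_inv_id_assoc
      (Functor.whiskerLeft (J.prod (𝟭 C₂)) β)) (M, L)
  refine ⟨e, fun K L => ?_⟩
  -- The relation defining `e` is extended to arbitrary `K` by naturality along `s : K ⟶ J.obj M`,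
  -- which becomes invertible in `D₁`.
  have hKL : α.app (K, L) ≫ e.hom.app (Q₁.obj K, Q₂.obj L) = β.app (K, L) := by
    obtain ⟨M, s, hs⟩ := hJ K
    have hs' : IsIso ((Q₁.prod Q₂).map (Prod.mkHom s (𝟙 L))) :=
      (isIso_prod_iff _ _).2 ⟨hs, inferInstanceAs (IsIso (Q₂.map (𝟙 L)))⟩
    refine (cancel_mono (B.map ((Q₁.prod Q₂).map (Prod.mkHom s (𝟙 L))))).1 ?_
    refine Eq.trans ?_ (β.naturality (Prod.mkHom s (𝟙 L)))
    refine Eq.trans ?_ (congrArg (fun m => _ ≫ m) (he M L))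
    refine Eq.trans ?_ (Category.assoc _ _ _)
    refine Eq.trans ?_ (congrArg (fun m => m ≫ _) (α.naturality (Prod.mkHom s (𝟙 L))).symm)
    refine (Category.assoc _ _ _).trans (Eq.trans ?_ (Category.assoc _ _ _).symm)
    exact congrArg (fun m => _ ≫ m) (e.hom.naturality _).symm
  have hα₀ : α.app (K, L) = T₂'.map (Prod.mkHom (𝟙 (Q₂.obj (S.obj K))) (Q₂.map (r.app L))) ≫
      T₂'.map (Prod.mkHom (u.app K) (𝟙 (Q₂.obj L))) := by
    rw [← T₂'.map_comp]
    exact congrArg T₂'.map (Prod.ext (Category.id_comp _).symm (Category.comp_id _).symm)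
  have hrL : IsIso (Prod.mkHom (𝟙 (Q₂.obj (S.obj K))) (Q₂.map (r.app L))) :=
    (isIso_prod_iff _ _).2 ⟨inferInstanceAs (IsIso (𝟙 _)), hr L⟩
  -- Precomposing with the invertible augmentation of `L` turns the left side into `α` followed by
  -- `e`, to which the previous relation applies.
  refine (cancel_epi (T₂'.map (Prod.mkHom (𝟙 (Q₂.obj (S.obj K))) (Q₂.map (r.app L))))).1 ?_
  refine Eq.trans ?_ (toTarget_app_comp u i c₁ c₂ r hπ hc K L)
  rw [← Category.assoc, ← hα₀, ← Category.assoc, hKL]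

end Formal

end ProperImage

namespace ProperImage

/-! ### The derived projection formula for sheaves -/

section DerivedProjection

variable {X Y : TopCat.{u}} (f : Y ⟶ X)

lemma soft_mapCochainComplexPlus_obj (hsep : IsSeparatedMap f) (hlp : IsLocallyProper f)
    (M : CochainComplex.Plus (InjectiveObject (Sh Y))) (n : ℤ) :
    Soft f (((InjectiveObject.ι (Sh Y)).mapCochainComplexPlus.obj M).obj.X n) :=
  have : Injective (((InjectiveObject.ι (Sh Y)).mapCochainComplexPlus.obj M).obj.X n) :=
    (M.obj.X n).property
  soft_of_injective hsep hlp _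

variable [HasDerivedCategory.{w₁} (Sh X)] [HasDerivedCategory.{w₂} (Sh Y)]
  [HasDerivedTensor X] [HasDerivedTensor Y]

/-- The formal argument is applied with complexes of injectives on `Y` and flat resolutions on `X`.
Injectives are soft, and tensoring them with a pulled back flat resolution stays soft, so all the
required morphisms are invertible. -/
lemma exists_isCanonicalProjection (hsep : IsSeparatedMap f) (hlp : IsLocallyProper f) :
    ∃ e : (derivedProperImage f).prod (𝟭 (DPlus X)) ⋙ derivedTensor X ≅
        (𝟭 (DPlus Y)).prod (derivedInverseImage f) ⋙ derivedTensor Y ⋙ derivedProperImage f,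
      IsCanonicalProjection f e.hom := by
  have : (((InjectiveObject.ι (Sh Y)).mapCochainComplexPlus ⋙ Q Y).prod (Q X)).IsLocalization
      (((qis Y).inverseImage (InjectiveObject.ι (Sh Y)).mapCochainComplexPlus).prod (qis X)) := by
    have : ((qis Y).inverseImage
        (InjectiveObject.ι (Sh Y)).mapCochainComplexPlus).ContainsIdentities := inferInstance
    have : ((InjectiveObject.ι (Sh Y)).mapCochainComplexPlus ⋙ Q Y).IsLocalization
      ((qis Y).inverseImage (InjectiveObject.ι (Sh Y)).mapCochainComplexPlus) := inferInstance
    infer_instance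
  refine exists_projection_iso (derivedProperImageUnit f) (derivedInverseImageIso f)
    (derivedTensorCounit Y) (derivedTensorCounit X) (flatResolutionPlusMap X)
    (InjectiveObject.ι (Sh Y)).mapCochainComplexPlus
    ((qis Y).inverseImage (InjectiveObject.ι (Sh Y)).mapCochainComplexPlus) (qis X)
    (projectionComplex_naturality (f := f)) (fun L => ?_) (fun K L => ?_) (fun K => ?_) (fun M => ?_) (fun M L => ?_)
    (fun M L => ?_) (fun M L => ?_)
  · exact Localization.inverts (Q X) (qis X) _ (qis_flatResolutionPlusMap L)
  · exact isIso_derivedTensorCounit _ _ ((isTermFlat_flatResolutionPlus L).inverseImage f)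
  · obtain ⟨a, ha⟩ := K.property
    obtain ⟨M, -, s, hs⟩ := CochainComplex.Plus.exists_quasiIso_injective K a
    exact ⟨M, s, Localization.inverts (Q Y) (qis Y) _ hs⟩
  · exact isIso_derivedProperImageUnit_of_injective M
  · exact isIso_derivedTensorCounit _ _ (isTermFlat_flatResolutionPlus L)
  · exact isIso_projectionComplex hsep hlp _ _ (soft_mapCochainComplexPlus_obj f hsep hlp M)
      (isTermFlat_flatResolutionPlus L)
  · exact isIso_derivedProperImageUnit hsep hlp _ (soft_tensorComplex hsep hlp _ _
      (soft_mapCochainComplexPlus_obj f hsep hlp M) (isTermFlat_flatResolutionPlus L))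

end DerivedProjection

end ProperImage
end

theorem theoremt {X Y : TopCat.{u}}
    [HasDerivedCategory.{w₁} (ProperImage.Sh X)] [HasDerivedCategory.{w₂} (ProperImage.Sh Y)]
    (f : Y ⟶ X) (hsep : IsSeparatedMap f) (hlp : ProperImage.IsLocallyProper f) :
    ∃ (_ : ProperImage.HasDerivedTensor X) (_ : ProperImage.HasDerivedTensor Y)
      (e : (ProperImage.derivedProperImage f).prod (𝟭 (ProperImage.DPlus X)) ⋙
            ProperImage.derivedTensor X ≅
          (𝟭 (ProperImage.DPlus Y)).prod (ProperImage.derivedInverseImage f) ⋙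
            ProperImage.derivedTensor Y ⋙ ProperImage.derivedProperImage f),
      ProperImage.IsCanonicalProjection f e.hom :=
  have hX := ProperImage.hasDerivedTensor X
  have hY := ProperImage.hasDerivedTensor Y
  ⟨hX, hY, ProperImage.exists_isCanonicalProjection f hsep hlp⟩
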